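/- Let $\alpha_1,\alpha_2\ge 0$ be fixed integers. For every $n\ge 1$ let $\Sigma_n$ be a Hermitian positive definite $n\times n$ matrix, and let $\mathbf X_1\in\mathbb C^{(n+\alpha_1)\times n}$ and $\mathbf X_2\in\mathbb C^{(n+\alpha_2)\times n}$ be independent random matrices such that, for each of them, the columns of $\mathbf X_i^\dagger$ are independent centred circularly symmetric complex Gaussian vectors with covariance matrix $\Sigma_n$, i.e. with density $\pi^{-n}\det(\Sigma_n)^{-1}e^{-z^\dagger\Sigma_n^{-1}z}$ on $\mathbb C^n$. Put $\mathbf W_i=\mathbf X_i^\dagger\mathbf X_i$ (complex Wishart matrices with $n+\alpha_i$ degrees of freedom), and let $\phi_n$ and $\phi_1$ be the smallest and the largest eigenvalue of $\mathbf W=(\mathbf W_1+\mathbf W_2)^{-1}\mathbf W_1$ (almost surely all eigenvalues are real and lie in $[0,1]$). Write $F_Y$ for the cumulative distribution function of a real random variable $Y$, let $$I_l(z)=I_{-l}(z)=\Big(\frac z2\Big)^{l}\sum_{k=0}^\infty\frac{z^{2k}}{2^{2k}\,k!\,(l+k)!}\qquad(l=0,1,2,\dots)$$ be the modified Bessel functions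 of the first kind, and, for an integer $\alpha\ge 0$ (the empty determinant being $1$), put $$F_\infty^{(\alpha)}(x)=1-e^{-x}\det\big[I_{i-j}(\sqrt{4x})\big]_{i,j=1,\dots,\alpha}.$$ Then, for every $x\ge 0$, $$\lim_{n\to\infty}F_{n^2\phi_n}(x)=\lim_{n\to\infty}F_{\phi_n}\!\Big(\frac{x}{n^2}\Big)=F_\infty^{(\alpha_1)}(x)$$ and $$\lim_{n\to\infty}F_{n^2(1-\phi_1)}(x)=1-\lim_{n\to\infty}F_{\phi_1}\!\Big(1-\frac{x}{n^2}\Big)=F_\infty^{(\alpha_2)}(x).$$ -/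

import Mathlib

open MeasureTheory ProbabilityTheory Filter Topology
open scoped ComplexOrder

noncomputable section

namespace DoubleWishart

/-- The centred circularly symmetric complex Gaussian distribution on `ℂⁿ` with covariance
matrix `S = 𝔼[z zᴴ]` (for `S` positive definite), through its density
`π⁻ⁿ (det S)⁻¹ exp (- zᴴ S⁻¹ z)` with respect to Lebesgue measure. -/
def complexGaussian {n : ℕ} (S : Matrix (Fin n) (Fin n) ℂ) : Measure (Fin n → ℂ) :=
  volume.withDensity fun z =>
    ENNReal.ofReal ((Real.pi ^ n * S.det.re)⁻¹ *
      Real.exp (-(star z ⬝ᵥ Matrix.mulVec S⁻¹ z).re))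

/-- `X` is a random `m × n` complex Gaussian matrix such that the columns of `Xᴴ` (the conjugated
rows of `X`) are independent and all have the distribution `complexGaussian S`, so that
`Xᴴ * X` is a complex Wishart matrix with `m` degrees of freedom and covariance matrix `S`. -/
structure IsComplexGaussianMatrix {Ω : Type*} [MeasurableSpace Ω] {m n : ℕ}
    (X : Ω → Matrix (Fin m) (Fin n) ℂ) (S : Matrix (Fin n) (Fin n) ℂ) (μ : Measure Ω) :
    Prop where
  hasLaw_col : ∀ k, HasLaw (fun ω => (X ω).conjTranspose.col k) (complexGaussian S) μ
  indep_col : iIndepFun (fun k ω => (X ω).conjTranspose.col k) μ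

/-- The complex Wishart matrix `Xᴴ X`. -/
def wishart {m n : ℕ} (X : Matrix (Fin m) (Fin n) ℂ) : Matrix (Fin n) (Fin n) ℂ :=
  X.conjTranspose * X

/-- The double Wishart matrix `(W₁ + W₂)⁻¹ W₁` with `W₁ = X₁ᴴ X₁` and `W₂ = X₂ᴴ X₂`. -/
def doubleWishart {m₁ m₂ n : ℕ} (X₁ : Matrix (Fin m₁) (Fin n) ℂ)
    (X₂ : Matrix (Fin m₂) (Fin n) ℂ) : Matrix (Fin n) (Fin n) ℂ :=
  (wishart X₁ + wishart X₂)⁻¹ * wishart X₁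

/-- The smallest real eigenvalue of a complex matrix. If `W₁ + W₂` is invertible, then all
eigenvalues of `(W₁ + W₂)⁻¹ W₁` are real. -/
def smallestEigenvalue {n : ℕ} (A : Matrix (Fin n) (Fin n) ℂ) : ℝ :=
  sInf {t : ℝ | (t : ℂ) ∈ spectrum ℂ A}

/-- The largest real eigenvalue of a complex matrix. -/
def largestEigenvalue {n : ℕ} (A : Matrix (Fin n) (Fin n) ℂ) : ℝ :=
  sSup {t : ℝ | (t : ℂ) ∈ spectrum ℂ A}

/-- The cumulative distribution function of the random variable `Y`. -/
def distFun {Ω : Type*} [MeasurableSpace Ω] (μ : Measure Ω) (Y : Ω → ℝ) (x : ℝ) : ℝ :=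
  cdf (μ.map Y) x

/-- The modified Bessel function of the first kind `I_l` of integer order on the real line, by its
power series, with `I_{-l} = I_l`. -/
def besselI (l : ℤ) (z : ℝ) : ℝ :=
  (z / 2) ^ l.natAbs *
    ∑' k : ℕ, z ^ (2 * k) / (2 ^ (2 * k) * (k.factorial : ℝ) * ((l.natAbs + k).factorial : ℝ))

/-- `F_∞^{(α)}(x) = 1 - e^{-x} det [I_{i-j}(√(4x))]_{i,j=1,…,α}`. -/
def limitCDF (α : ℕ) (x : ℝ) : ℝ :=
  1 - Real.exp (-x) *
    (Matrix.of fun i j : Fin α => besselI ((i : ℤ) - (j : ℤ)) (Real.sqrt (4 * x))).det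

end DoubleWishart

end

/-! Almost surely `W₁ + W₂` is positive definite. Then the smallest eigenvalue exceeds `t` exactly
when `(1 - t)W₁ - tW₂` is positive definite, that is, when `W₁ > sW₂` in the Loewner order with `s =
t/(1 - t)`; the largest one is below `1 - t` exactly when `W₂ > sW₁`. Both claims thus concern one
probability, with the two matrices exchanged. Writing the rows as a fixed invertible matrix applied
to standard Gaussian vectors turns the covariance into a congruence, which the Loewner order does
not see. The probability is computed exactly for every `n`, and only then does `n` tend to infinity.

Exact formula. With `n + α` degrees of freedom, `W` has density proportional to `det(X)^α exp(-tr
X)` on the positive definite cone. Translating by `B` gives `P(W > B) = exp(-tr B) E det(W₀ + B)^α /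
E det(W₀)^α` with `W₀` a square Wishart matrix (`measure_posDef_outerSum_sub`). For `B = sW₂` the
exponential factor only shrinks the Gaussian law of `W₂` by `1 - t`, so `sW₂` becomes `tW₂` and the
probability is `(1 - t)^(nm)` times a ratio of moments of `det(W₀ + tW₂)`, where `m` is the number
of rows behind `W₂` (`measure_posDef_outerSum_sub_smul`).

The moments. `F(t) = E det(∑ tᵢ zᵢ zᵢ†)^α` is a multiple of the Schur polynomial of an `n × α`
rectangle. Gaussian integration by parts and invariance under rotations of the rows give a second
order differential equation for `F` (`detMoment_pde`). After multiplication by the Vandermonde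
product it says that the product is an eigenfunction of `∑ (tᵢ ∂ᵢ)²`, for which monomials are
eigenvectors (`sum_euler_euler_vdm_mul`). The product is alternating, its exponents are bounded, and
their sum and sum of squares are prescribed; only the exponents of the rectangle satisfy this
(`exists_perm_rectExp`). The dual Jacobi–Trudi identity then yields an `α × α` Toeplitz determinant
in the coefficients of `(X + t)^m (X + 1)^n`, normalised by its value `1` at `t = 0`.

The limit. For `t = x/n²` the prefactor tends to `exp(-x)`. After conjugation by powers of `n`, the
Toeplitz entries converge by dominated convergence to Bessel series (`tendsto_tailProb`). -/

noncomputable section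

set_option linter.unusedSectionVars false

namespace DoubleWishart

section Moments

open MvPolynomial ComplexConjugate

/-! ### The Gaussian expectation as a functional on polynomials -/

section Wick

variable {ι κ : Type*} [Fintype ι] [Fintype κ] [DecidableEq ι] [DecidableEq κ]

/-- Index type for the entries of a complex matrix, their conjugates, and one scale per row. -/
abbrev GVar (ι κ : Type*) := (ι × κ) ⊕ ((ι × κ) ⊕ ι)

/-- The variable standing for a matrix entry. -/
def gvar (v : ι × κ) : MvPolynomial (GVar ι κ) ℂ := X (Sum.inl v)

/-- The variable standing for the conjugate of a matrix entry. -/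
def hvar (v : ι × κ) : MvPolynomial (GVar ι κ) ℂ := X (Sum.inr (Sum.inl v))

/-- The variable standing for the scale of a row. -/
def tvar (i : ι) : MvPolynomial (GVar ι κ) ℂ := X (Sum.inr (Sum.inr i))

/-- The exponents of the scale variables. -/
def scaleExp (s : GVar ι κ →₀ ℕ) : ι →₀ ℕ :=
  Finsupp.equivFunOnFinite.symm fun i => s (Sum.inr (Sum.inr i))

@[simp] lemma scaleExp_apply (s : GVar ι κ →₀ ℕ) (i : ι) :
    scaleExp s i = s (Sum.inr (Sum.inr i)) := rfl

/-- Expectation over independent standard complex Gaussian entries, as a linear functional with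
values in the polynomials in the scale variables. -/
def wick : MvPolynomial (GVar ι κ) ℂ →ₗ[ℂ] MvPolynomial ι ℂ :=
  (basisMonomials (GVar ι κ) ℂ).constr ℂ fun s =>
    if ∀ v, s (Sum.inl v) = s (Sum.inr (Sum.inl v)) then
      monomial (scaleExp s) (∏ v, ((s (Sum.inl v)).factorial : ℂ)) else 0

lemma wick_monomial (s : GVar ι κ →₀ ℕ) (c : ℂ) :
    wick (monomial s c) = if ∀ v, s (Sum.inl v) = s (Sum.inr (Sum.inl v)) then
      monomial (scaleExp s) (c * ∏ v, ((s (Sum.inl v)).factorial : ℂ)) else 0 := by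
  have : monomial s c = c • basisMonomials (GVar ι κ) ℂ s := by
    simp [coe_basisMonomials, smul_monomial]
  rw [this, map_smul, wick, Module.Basis.constr_basis]
  split_ifs
  · rw [smul_monomial, smul_eq_mul]
  · simp

lemma wick_tvar_mul (i : ι) (p : MvPolynomial (GVar ι κ) ℂ) :
    wick (tvar i * p) = X i * wick p := by
  induction p using MvPolynomial.induction_on' with
  | add p q hp hq => rw [mul_add, map_add, hp, hq, map_add, mul_add]
  | monomial s c =>
    have h1 : (tvar i : MvPolynomial (GVar ι κ) ℂ) * monomial s c =
        monomial (Finsupp.single (Sum.inr (Sum.inr i)) 1 + s) c := by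
      rw [tvar, X, monomial_mul, one_mul]
    have h2 : scaleExp (Finsupp.single (Sum.inr (Sum.inr i)) 1 + s) =
        Finsupp.single i 1 + scaleExp s := by
      ext j
      simp [Finsupp.single_apply]
    rw [h1, wick_monomial, wick_monomial, h2]
    simp only [Finsupp.add_apply, Finsupp.single_apply, reduceCtorEq, if_false, zero_add,
      Sum.inr.injEq]
    split_ifs
    · rw [X, monomial_mul, one_mul]
    · simp

lemma wick_pderiv_tvar (i : ι) (p : MvPolynomial (GVar ι κ) ℂ) :
    wick (pderiv (Sum.inr (Sum.inr i)) p) = pderiv i (wick p) := by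
  induction p using MvPolynomial.induction_on' with
  | add p q hp hq => rw [map_add, map_add, hp, hq, map_add, map_add]
  | monomial s c =>
    have h2 : scaleExp (s - Finsupp.single (Sum.inr (Sum.inr i)) 1) =
        scaleExp s - Finsupp.single i 1 := by
      ext j
      simp [Finsupp.single_apply]
    rw [pderiv_monomial, wick_monomial, wick_monomial, h2]
    simp only [Finsupp.tsub_apply, Finsupp.single_apply, reduceCtorEq, if_false, tsub_zero,
      Sum.inr.injEq]
    split_ifs
    · rw [pderiv_monomial]
      congr 1
      simp
      ring
    · simp

/-- Gaussian integration by parts, `E[z f] = E[∂f/∂z̄]`; on monomials it is `(k + 1)! = (k + 1) ·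
k!`. -/
lemma wick_gvar_mul (v : ι × κ) (p : MvPolynomial (GVar ι κ) ℂ) :
    wick (gvar v * p) = wick (pderiv (Sum.inr (Sum.inl v)) p) := by
  induction p using MvPolynomial.induction_on' with
  | add p q hp hq => rw [mul_add, map_add, hp, hq, map_add, map_add]
  | monomial s c =>
    have h1 : (gvar v : MvPolynomial (GVar ι κ) ℂ) * monomial s c =
        monomial (Finsupp.single (Sum.inl v) 1 + s) c := by
      rw [gvar, X, monomial_mul, one_mul]
    rw [h1, pderiv_monomial, wick_monomial, wick_monomial]
    have e1 : scaleExp (Finsupp.single (Sum.inl v) 1 + s) = scaleExp s := by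
      ext j; simp
    have e2 : scaleExp (s - Finsupp.single (Sum.inr (Sum.inl v)) 1) = scaleExp s := by
      ext j; simp
    rw [e1, e2]
    -- Here the subtraction of exponents truncates, but the derivative has coefficient zero and the
    -- left monomial is unbalanced at `v`, so both sides vanish.
    by_cases hs : s (Sum.inr (Sum.inl v)) = 0
    · rw [if_neg, hs]
      · simp
      · intro h
        have := h v
        simp [hs] at this
    have hiff : (∀ w, (Finsupp.single (Sum.inl v) 1 + s : GVar ι κ →₀ ℕ) (Sum.inl w) =
          (Finsupp.single (Sum.inl v) 1 + s : GVar ι κ →₀ ℕ) (Sum.inr (Sum.inl w))) ↔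
        (∀ w, (s - Finsupp.single (Sum.inr (Sum.inl v)) 1 : GVar ι κ →₀ ℕ) (Sum.inl w) =
          (s - Finsupp.single (Sum.inr (Sum.inl v)) 1 : GVar ι κ →₀ ℕ) (Sum.inr (Sum.inl w))) := by
      refine forall_congr' fun w => ?_
      by_cases hw : v = w
      · subst hw
        simp
        omega
      · simp [hw]
    by_cases h : ∀ w, (Finsupp.single (Sum.inl v) 1 + s : GVar ι κ →₀ ℕ) (Sum.inl w) =
          (Finsupp.single (Sum.inl v) 1 + s : GVar ι κ →₀ ℕ) (Sum.inr (Sum.inl w))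
    · rw [if_pos h, if_pos (hiff.mp h), mul_assoc]
      congr 2
      have hv : s (Sum.inr (Sum.inl v)) = s (Sum.inl v) + 1 := by
        have := h v
        simp at this
        omega
      rw [← Finset.mul_prod_erase _ _ (Finset.mem_univ v),
        ← Finset.mul_prod_erase _ _ (Finset.mem_univ v), ← mul_assoc]
      congr 1
      · simp [hv, Nat.factorial_succ, add_comm 1]
      · refine Finset.prod_congr rfl fun w hw => ?_
        have : v ≠ w := (Finset.ne_of_mem_erase hw).symm
        simp [this]
    · rw [if_neg h, if_neg (fun h' => h (hiff.mpr h'))]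

lemma wick_hvar_mul (v : ι × κ) (p : MvPolynomial (GVar ι κ) ℂ) :
    wick (hvar v * p) = wick (pderiv (Sum.inl v) p) := by
  induction p using MvPolynomial.induction_on' with
  | add p q hp hq => rw [mul_add, map_add, hp, hq, map_add, map_add]
  | monomial s c =>
    have h1 : (hvar v : MvPolynomial (GVar ι κ) ℂ) * monomial s c =
        monomial (Finsupp.single (Sum.inr (Sum.inl v)) 1 + s) c := by
      rw [hvar, X, monomial_mul, one_mul]
    rw [h1, pderiv_monomial, wick_monomial, wick_monomial]
    have e1 : scaleExp (Finsupp.single (Sum.inr (Sum.inl v)) 1 + s) = scaleExp s := by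
      ext j; simp
    have e2 : scaleExp (s - Finsupp.single (Sum.inl v) 1) = scaleExp s := by
      ext j; simp
    rw [e1, e2]
    by_cases hs : s (Sum.inl v) = 0
    · rw [if_neg, hs]
      · simp
      · intro h
        have := h v
        simp [hs] at this
        omega
    have hiff : (∀ w, (Finsupp.single (Sum.inr (Sum.inl v)) 1 + s : GVar ι κ →₀ ℕ) (Sum.inl w) =
          (Finsupp.single (Sum.inr (Sum.inl v)) 1 + s : GVar ι κ →₀ ℕ) (Sum.inr (Sum.inl w))) ↔
        (∀ w, (s - Finsupp.single (Sum.inl v) 1 : GVar ι κ →₀ ℕ) (Sum.inl w) =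
          (s - Finsupp.single (Sum.inl v) 1 : GVar ι κ →₀ ℕ) (Sum.inr (Sum.inl w))) := by
      refine forall_congr' fun w => ?_
      by_cases hw : v = w
      · subst hw
        simp
        omega
      · simp [hw]
    by_cases h : ∀ w, (Finsupp.single (Sum.inr (Sum.inl v)) 1 + s : GVar ι κ →₀ ℕ) (Sum.inl w) =
          (Finsupp.single (Sum.inr (Sum.inl v)) 1 + s : GVar ι κ →₀ ℕ) (Sum.inr (Sum.inl w))
    · rw [if_pos h, if_pos (hiff.mp h), mul_assoc]
      congr 2
      rw [← Finset.mul_prod_erase _ _ (Finset.mem_univ v),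
        ← Finset.mul_prod_erase _ _ (Finset.mem_univ v), ← mul_assoc]
      congr 1
      · obtain ⟨k, hk⟩ := Nat.exists_eq_succ_of_ne_zero hs
        simp [hk, Nat.factorial_succ]
      · refine Finset.prod_congr rfl fun w hw => ?_
        have : v ≠ w := (Finset.ne_of_mem_erase hw).symm
        simp [this]
    · rw [if_neg h, if_neg (fun h' => h (hiff.mpr h'))]

lemma pderiv_comm {σ : Type*} (i j : σ) (p : MvPolynomial σ ℂ) :
    pderiv i (pderiv j p) = pderiv j (pderiv i p) := by
  classical
  ext m
  simp only [coeff_pderiv]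
  rw [add_right_comm]
  by_cases h : i = j
  · subst h; rfl
  · simp [h, Ne.symm h]
    ring

/-- The infinitesimal rotation sending row `i` to row `j`, acting on the entries and dually on
the conjugate entries. -/
def rowRotation (i j : ι) : Derivation ℂ (MvPolynomial (GVar ι κ) ℂ) (MvPolynomial (GVar ι κ) ℂ) :=
  ∑ k : κ, (gvar (j, k) • pderiv (Sum.inl (i, k)) -
    hvar (i, k) • pderiv (Sum.inr (Sum.inl (j, k))))

lemma rowRotation_apply (i j : ι) (p : MvPolynomial (GVar ι κ) ℂ) :
    rowRotation i j p = ∑ k : κ, (gvar (j, k) * pderiv (Sum.inl (i, k)) p -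
      hvar (i, k) * pderiv (Sum.inr (Sum.inl (j, k))) p) := by
  have : ∀ (s : Finset κ) (D : κ → Derivation ℂ (MvPolynomial (GVar ι κ) ℂ)
      (MvPolynomial (GVar ι κ) ℂ)), (∑ k ∈ s, D k) p = ∑ k ∈ s, D k p := by
    intro s D
    induction s using Finset.cons_induction with
    | empty => simp
    | cons a s ha ih => rw [Finset.sum_cons, Finset.sum_cons, Derivation.add_apply, ih]
  rw [rowRotation, this]
  rfl

/-- Infinitesimal invariance of the Gaussian law under unitary rotations of the rows: integration by
parts turns both halves of the derivation into the same mixed second derivative. -/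
lemma wick_rowRotation (i j : ι) (p : MvPolynomial (GVar ι κ) ℂ) : wick (rowRotation i j p) = 0 := by
  rw [rowRotation_apply, map_sum]
  refine Finset.sum_eq_zero fun k _ => ?_
  rw [map_sub, wick_gvar_mul, wick_hvar_mul, pderiv_comm, sub_self]

end Wick

/-! ### Derivations of determinants -/

section DetDerivation

variable {R A : Type*} [CommRing R] [CommRing A] [Algebra R A]

lemma derivation_prod {ι : Type*} [DecidableEq ι] (D : Derivation R A A) (s : Finset ι)
    (f : ι → A) : D (∏ i ∈ s, f i) = ∑ i ∈ s, (∏ j ∈ s.erase i, f j) * D (f i) := by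
  induction s using Finset.induction_on with
  | empty => simp
  | insert a s ha ih =>
    rw [Finset.prod_insert ha, Derivation.leibniz, ih, Finset.sum_insert ha,
      Finset.erase_insert ha, smul_eq_mul, smul_eq_mul, add_comm, Finset.mul_sum]
    congr 1
    refine Finset.sum_congr rfl fun i hi => ?_
    have hia : a ≠ i := fun h => ha (h ▸ hi)
    rw [Finset.erase_insert_of_ne hia, Finset.prod_insert
      (fun h => ha (Finset.mem_of_mem_erase h)), mul_assoc]

variable {κ : Type*} [Fintype κ] [DecidableEq κ]

/-- Jacobi's formula for an arbitrary derivation: Leibniz column by column, each resulting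
determinant being a Cramer expression. -/
lemma derivation_det (D : Derivation R A A) (M : Matrix κ κ A) :
    D M.det = (M.adjugate * M.map D).trace := by
  have h1 : D M.det = ∑ i, (M.updateCol i fun k => D (M k i)).det := by
    simp only [Matrix.det_apply]
    rw [map_sum, Finset.sum_comm]
    refine Finset.sum_congr rfl fun σ _ => ?_
    rw [Units.smul_def, map_zsmul, derivation_prod, Finset.smul_sum]
    refine Finset.sum_congr rfl fun i _ => ?_
    congr 1
    rw [← Finset.prod_erase_mul _ _ (Finset.mem_univ i)]
    congr 1
    · refine Finset.prod_congr rfl fun j hj => ?_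
      rw [Matrix.updateCol_ne (Finset.ne_of_mem_erase hj)]
    · simp
  rw [h1, Matrix.trace]
  refine Finset.sum_congr rfl fun i _ => ?_
  rw [← Matrix.cramer_apply, Matrix.cramer_eq_adjugate_mulVec]
  rfl

/-- Apply `D` to `adj(M) M = det(M) 1` and multiply by `adj(M)` on the right. The factor `det(M)`
stays because it need not be invertible. -/
lemma det_smul_derivation_adjugate (D : Derivation R A A) (M : Matrix κ κ A) :
    M.det • M.adjugate.map D =
      D M.det • M.adjugate - M.adjugate * M.map D * M.adjugate := by
  have h1 : (M.adjugate * M).map D = M.adjugate.map D * M + M.adjugate * M.map D := by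
    ext i j
    simp only [Matrix.map_apply, Matrix.mul_apply, Matrix.add_apply, map_sum, Derivation.leibniz,
      smul_eq_mul, ← Finset.sum_add_distrib]
    refine Finset.sum_congr rfl fun k _ => ?_
    ring
  have h2 : (M.adjugate * M).map D = D M.det • (1 : Matrix κ κ A) := by
    rw [Matrix.adjugate_mul]
    ext i j
    by_cases h : i = j
    · subst h; simp
    · simp [h]
  have h3 : M.adjugate.map D * M = D M.det • (1 : Matrix κ κ A) - M.adjugate * M.map D := by
    rw [← h2, h1, add_sub_cancel_right]
  calc M.det • M.adjugate.map D = M.adjugate.map D * (M * M.adjugate) := by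
        rw [Matrix.mul_adjugate]; simp
    _ = _ := by
        rw [← Matrix.mul_assoc, h3, Matrix.sub_mul]; simp

end DetDerivation

lemma derivation_dotProduct_mulVec {R A κ : Type*} [CommRing R] [CommRing A] [Algebra R A]
    [Fintype κ] (D : Derivation R A A) (h g : κ → A) (B : Matrix κ κ A) :
    D (h ⬝ᵥ B.mulVec g) = (D ∘ h) ⬝ᵥ B.mulVec g + h ⬝ᵥ (B.map D).mulVec g +
      h ⬝ᵥ B.mulVec (D ∘ g) := by
  simp only [dotProduct, Matrix.mulVec, map_sum, Derivation.leibniz, smul_eq_mul,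
    Finset.mul_sum, ← Finset.sum_add_distrib, Matrix.map_apply, Function.comp_apply]
  refine Finset.sum_congr rfl fun k _ => Finset.sum_congr rfl fun l _ => ?_
  ring

/-! ### The determinant of a generic scaled Gram matrix -/

section Gram

variable {ι κ : Type*} [Fintype ι] [Fintype κ] [DecidableEq ι] [DecidableEq κ]

/-- The `i`-th row of matrix entries. -/
def gvec (i : ι) : κ → MvPolynomial (GVar ι κ) ℂ := fun k => gvar (i, k)

/-- The `i`-th row of conjugate entries. -/
def hvec (i : ι) : κ → MvPolynomial (GVar ι κ) ℂ := fun k => hvar (i, k)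

/-- The generic matrix `∑ᵢ tᵢ gᵢ hᵢᵀ`. -/
def gram (ι κ : Type*) [Fintype ι] : Matrix κ κ (MvPolynomial (GVar ι κ) ℂ) :=
  ∑ i : ι, (tvar i : MvPolynomial (GVar ι κ) ℂ) • Matrix.vecMulVec (gvec i) (hvec i)

/-- The bilinear expression `hᵢᵀ adj(M) gⱼ` in the rows `i`, `j`. -/
def adjForm (i j : ι) : MvPolynomial (GVar ι κ) ℂ :=
  hvec i ⬝ᵥ (gram ι κ).adjugate.mulVec (gvec j)

lemma gram_apply (k l : κ) :
    gram ι κ k l = ∑ i : ι, tvar i * (gvar (i, k) * hvar (i, l)) := by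
  simp [gram, Matrix.sum_apply, Matrix.vecMulVec_apply, gvec, hvec]

lemma trace_mul_vecMulVec {A : Type*} [CommRing A] (B : Matrix κ κ A) (g h : κ → A) :
    (B * Matrix.vecMulVec g h).trace = h ⬝ᵥ B.mulVec g := by
  rw [Matrix.mul_vecMulVec, Matrix.trace_vecMulVec, dotProduct_comm]

lemma pderiv_comp_gvec (i j : ι) :
    pderiv (Sum.inr (Sum.inr i)) ∘ (gvec j : κ → MvPolynomial (GVar ι κ) ℂ) = 0 := by
  ext1 k
  simp [gvec, gvar, pderiv_X]

lemma pderiv_comp_hvec (i j : ι) :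
    pderiv (Sum.inr (Sum.inr i)) ∘ (hvec j : κ → MvPolynomial (GVar ι κ) ℂ) = 0 := by
  ext1 k
  simp [hvec, hvar, pderiv_X]

lemma map_pderiv_gram (i : ι) :
    (gram ι κ).map (pderiv (Sum.inr (Sum.inr i))) = Matrix.vecMulVec (gvec i) (hvec i) := by
  ext1 k l
  simp only [gram_apply, Matrix.map_apply, map_sum, Matrix.vecMulVec_apply]
  rw [Finset.sum_eq_single i]
  · simp [tvar, gvar, hvar, pderiv_X, gvec, hvec]
  · intro j _ hj
    simp [tvar, gvar, hvar, pderiv_X, hj]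
  · simp

lemma rowRotation_tvar (i j a : ι) : rowRotation (κ := κ) i j (tvar a) = 0 := by
  simp [rowRotation_apply, tvar, pderiv_X]

lemma rowRotation_gvar (i j a : ι) (k : κ) :
    rowRotation i j (gvar (a, k)) = if a = i then gvar (j, k) else 0 := by
  rw [rowRotation_apply, Finset.sum_eq_single k]
  · by_cases h : a = i
    · subst h; simp [gvar, pderiv_X]
    · simp [gvar, pderiv_X, h]
  · intro l _ hl
    simp [gvar, pderiv_X, Ne.symm hl]
  · simp

lemma rowRotation_hvar (i j a : ι) (k : κ) :
    rowRotation i j (hvar (a, k)) = if a = j then -hvar (i, k) else 0 := by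
  rw [rowRotation_apply, Finset.sum_eq_single k]
  · by_cases h : a = j
    · subst h; simp [hvar, pderiv_X]
    · simp [hvar, pderiv_X, h]
  · intro l _ hl
    simp [hvar, pderiv_X, Ne.symm hl]
  · simp

/-- With equal scales the matrix would be invariant under the rotation; the defect `tᵢ - tⱼ` is the
source of the divided differences in the differential equation. -/
lemma map_rowRotation_gram (i j : ι) :
    (gram ι κ).map (rowRotation i j) =
      (tvar i - tvar j : MvPolynomial (GVar ι κ) ℂ) • Matrix.vecMulVec (gvec j) (hvec i) := by
  ext1 k l
  simp only [gram_apply, Matrix.map_apply, map_sum, Matrix.smul_apply, smul_eq_mul,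
    Derivation.leibniz, rowRotation_tvar, rowRotation_gvar, rowRotation_hvar, mul_zero, add_zero, mul_ite,
    Finset.sum_add_distrib, Finset.sum_ite_eq', Finset.mem_univ, if_true, mul_add,
    Matrix.vecMulVec_apply, gvec, hvec]
  ring

lemma pderiv_det_gram (i : ι) :
    pderiv (Sum.inr (Sum.inr i)) (gram ι κ).det = adjForm i i := by
  rw [derivation_det, map_pderiv_gram, trace_mul_vecMulVec, adjForm]

lemma rowRotation_det_gram (i j : ι) :
    rowRotation i j (gram ι κ).det = (tvar i - tvar j) * adjForm i j := by
  rw [derivation_det, map_rowRotation_gram, Matrix.mul_smul, Matrix.trace_smul, trace_mul_vecMulVec,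
    adjForm, smul_eq_mul]

lemma dotProduct_adj_vecMulVec_adj {A : Type*} [CommRing A] (B : Matrix κ κ A) (g h g' h' : κ → A) :
    h' ⬝ᵥ (B * Matrix.vecMulVec g h * B).mulVec g' =
      (h' ⬝ᵥ B.mulVec g) * (h ⬝ᵥ B.mulVec g') := by
  rw [← Matrix.mulVec_mulVec, ← Matrix.mulVec_mulVec, Matrix.vecMulVec_mulVec]
  simp [Matrix.mulVec_smul, mul_comm]

/-- `∂/∂tⱼ` changes the matrix by the rank one term `gⱼ hⱼᵀ`, hence the `2 × 2` minor. It vanishes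
for `i = j`: the determinant is affine in each scale. -/
lemma det_mul_pderiv_adjForm (i j : ι) :
    (gram ι κ).det * pderiv (Sum.inr (Sum.inr j)) (adjForm i i) =
      adjForm i i * adjForm j j - adjForm i j * adjForm j i := by
  rw [adjForm, derivation_dotProduct_mulVec, pderiv_comp_gvec, pderiv_comp_hvec, zero_dotProduct,
    Matrix.mulVec_zero, dotProduct_zero, zero_add, add_zero, ← smul_eq_mul, ← dotProduct_smul,
    ← Matrix.smul_mulVec, det_smul_derivation_adjugate, Matrix.sub_mulVec, dotProduct_sub,
    pderiv_det_gram, map_pderiv_gram, dotProduct_adj_vecMulVec_adj, Matrix.smul_mulVec,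
    dotProduct_smul, smul_eq_mul]
  simp only [adjForm]
  ring

/-- The rotation sends `gᵢ` to `gⱼ` and `hⱼ` to `-hᵢ`, which gives the difference of diagonal forms;
its action on the adjugate gives the same `2 × 2` minor as above. -/
lemma det_mul_rowRotation_adjForm (i j : ι) :
    (gram ι κ).det * rowRotation i j (adjForm j i) =
      (gram ι κ).det * (adjForm j j - adjForm i i) +
        (tvar i - tvar j) * (adjForm i j * adjForm j i - adjForm i i * adjForm j j) := by
  have hg : rowRotation i j ∘ (gvec i : κ → MvPolynomial (GVar ι κ) ℂ) = gvec j := by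
    ext1 k
    simp [gvec, rowRotation_gvar]
  have hh : rowRotation i j ∘ (hvec j : κ → MvPolynomial (GVar ι κ) ℂ) = -hvec i := by
    ext1 k
    simp [hvec, rowRotation_hvar]
  have hmid : (gram ι κ).det * (hvec j ⬝ᵥ ((gram ι κ).adjugate.map (rowRotation i j)).mulVec (gvec i))
      = (tvar i - tvar j) * (adjForm i j * adjForm j i - adjForm i i * adjForm j j) := by
    rw [← smul_eq_mul, ← dotProduct_smul,
      ← Matrix.smul_mulVec, det_smul_derivation_adjugate, Matrix.sub_mulVec, dotProduct_sub,
      rowRotation_det_gram, map_rowRotation_gram, Matrix.mul_smul, Matrix.smul_mul, Matrix.smul_mulVec,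
      Matrix.smul_mulVec, dotProduct_smul, dotProduct_smul, dotProduct_adj_vecMulVec_adj,
      smul_eq_mul, smul_eq_mul]
    simp only [adjForm]
    ring
  rw [adjForm, derivation_dotProduct_mulVec, hg, hh, mul_add, mul_add, hmid, neg_dotProduct]
  simp only [adjForm]
  ring

/-- Expand the middle factor of `adj(M) M adj(M) = det(M) adj(M)` as a sum of rank one terms. -/
lemma sum_tvar_mul_adjForm_mul (i : ι) :
    ∑ j, tvar j * (adjForm i j * adjForm j i) =
      (gram ι κ).det * (adjForm i i : MvPolynomial (GVar ι κ) ℂ) := by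
  have h1 : hvec i ⬝ᵥ ((gram ι κ).adjugate * gram ι κ * (gram ι κ).adjugate).mulVec (gvec i) =
      (gram ι κ).det * (adjForm i i : MvPolynomial (GVar ι κ) ℂ) := by
    rw [Matrix.adjugate_mul, Matrix.smul_mul, Matrix.one_mul, Matrix.smul_mulVec, dotProduct_smul,
      smul_eq_mul, adjForm]
  rw [← h1]
  conv_rhs => enter [2, 1, 1, 2]; rw [gram]
  rw [Matrix.mul_sum, Matrix.sum_mul, Matrix.sum_mulVec, dotProduct_sum]
  refine Finset.sum_congr rfl fun j _ => ?_
  rw [Matrix.mul_smul, Matrix.smul_mul, Matrix.smul_mulVec, dotProduct_smul,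
    dotProduct_adj_vecMulVec_adj, smul_eq_mul, adjForm, adjForm]

lemma sum_tvar_mul_adjForm :
    ∑ j, tvar j * (adjForm j j : MvPolynomial (GVar ι κ) ℂ) =
      (Fintype.card κ : MvPolynomial (GVar ι κ) ℂ) * (gram ι κ).det := by
  have h1 : ((gram ι κ).adjugate * gram ι κ).trace =
      (Fintype.card κ : MvPolynomial (GVar ι κ) ℂ) * (gram ι κ).det := by
    rw [Matrix.adjugate_mul, Matrix.trace_smul, Matrix.trace_one, smul_eq_mul, mul_comm]
  rw [← h1]
  conv_rhs => enter [1, 2]; rw [gram]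
  rw [Matrix.mul_sum, Matrix.trace_sum]
  refine Finset.sum_congr rfl fun j _ => ?_
  rw [Matrix.mul_smul, Matrix.trace_smul, trace_mul_vecMulVec, smul_eq_mul, adjForm]

end Gram

/-! ### Moments of the determinant and their differential equations -/

section DetMoment

variable {ι κ : Type*} [Fintype ι] [Fintype κ] [DecidableEq ι] [DecidableEq κ]

/-- With as many rows as columns, the rows `f k` can be set to the standard basis and the others to
zero, so that the matrix becomes `1`. This allows cancelling the determinant in the polynomial ring.
-/
lemma det_gram_ne_zero (f : κ ↪ ι) : (gram ι κ).det ≠ 0 := by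
  intro h
  let φ : MvPolynomial (GVar ι κ) ℂ →+* ℂ := eval (Sum.elim (fun v => if v.1 = f v.2 then 1 else 0)
    (Sum.elim (fun v => if v.1 = f v.2 then 1 else 0) fun _ => 1))
  have h1 : φ (gram ι κ).det = 1 := by
    rw [RingHom.map_det]
    have : φ.mapMatrix (gram ι κ) = 1 := by
      ext k l
      rw [RingHom.mapMatrix_apply, Matrix.map_apply, gram_apply, map_sum]
      simp only [φ, tvar, gvar, hvar, map_mul, eval_X, Sum.elim_inl, Sum.elim_inr, one_mul]
      rw [Finset.sum_eq_single (f k)]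
      · simp [Matrix.one_apply]
      · intro i _ hi
        simp [hi]
      · simp
    rw [this, Matrix.det_one]
  rw [h, map_zero] at h1
  exact zero_ne_one h1

variable (ι κ) in
/-- The polynomial in the scales given by the Gaussian expectation of `det(M) ^ α`. -/
def detMoment (α : ℕ) : MvPolynomial ι ℂ := wick ((gram ι κ).det ^ α)

/-- The polynomial whose expectation is the divided difference of the first partial derivatives
of the moments of the determinant. -/
def gramDivDiff (a : ℕ) (i j : ι) : MvPolynomial (GVar ι κ) ℂ :=
  (a : MvPolynomial (GVar ι κ) ℂ) * (gram ι κ).det ^ (a - 1) * (adjForm i j * adjForm j i) -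
    (gram ι κ).det ^ a * pderiv (Sum.inr (Sum.inr j)) (adjForm i i)

/-- The two minors above cancel, so that only first order data and one mixed derivative remain. -/
lemma rowRotation_adjForm (hd : (gram ι κ).det ≠ 0) (i j : ι) :
    rowRotation i j (adjForm j i : MvPolynomial (GVar ι κ) ℂ) = adjForm j j - adjForm i i -
      (tvar i - tvar j) * pderiv (Sum.inr (Sum.inr j)) (adjForm i i) := by
  apply mul_left_cancel₀ hd
  rw [det_mul_rowRotation_adjForm, mul_sub _ (adjForm j j - adjForm i i), mul_left_comm,
    det_mul_pderiv_adjForm]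
  ring

lemma pderiv_adjForm_self (hd : (gram ι κ).det ≠ 0) (i : ι) :
    pderiv (Sum.inr (Sum.inr i)) (adjForm i i : MvPolynomial (GVar ι κ) ℂ) = 0 := by
  apply mul_left_cancel₀ hd
  rw [det_mul_pderiv_adjForm, mul_zero, sub_self]

lemma pderiv_det_gram_pow (a : ℕ) (i : ι) :
    pderiv (Sum.inr (Sum.inr i)) ((gram ι κ).det ^ (a + 1)) =
      C ((a : ℂ) + 1) * ((gram ι κ).det ^ a * adjForm i i) := by
  rw [pderiv_pow, pderiv_det_gram]
  simp
  ring

lemma rowRotation_det_pow_mul_adjForm (hd : (gram ι κ).det ≠ 0) (a : ℕ) (i j : ι) :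
    rowRotation i j ((gram ι κ).det ^ a * adjForm j i) =
      (gram ι κ).det ^ a * adjForm j j - (gram ι κ).det ^ a * adjForm i i +
        (tvar i - tvar j) * gramDivDiff a i j := by
  rw [Derivation.leibniz, Derivation.leibniz_pow, rowRotation_adjForm hd, rowRotation_det_gram,
    gramDivDiff]
  simp only [smul_eq_mul, nsmul_eq_mul]
  ring

lemma pderiv_pderiv_det_gram_pow (hd : (gram ι κ).det ≠ 0) (a : ℕ) (i : ι) :
    pderiv (Sum.inr (Sum.inr i)) (pderiv (Sum.inr (Sum.inr i)) ((gram ι κ).det ^ (a + 1))) =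
      C ((a : ℂ) + 1) * gramDivDiff a i i := by
  rw [pderiv_det_gram_pow, pderiv_C_mul, pderiv_mul, pderiv_adjForm_self hd, pderiv_pow,
    pderiv_det_gram, gramDivDiff, pderiv_adjForm_self hd]
  ring

/-- After multiplication by the determinant every term is a product of two adjugate forms, and the
double sum collapses by `sum_tvar_mul_adjForm_mul` and `sum_tvar_mul_adjForm`. -/
lemma sum_sum_tvar_mul_gramDivDiff (hd : (gram ι κ).det ≠ 0) (a : ℕ) :
    ∑ i, ∑ j, tvar i * (tvar j * (gramDivDiff a i j : MvPolynomial (GVar ι κ) ℂ)) =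
      C ((Fintype.card κ : ℂ) * ((a : ℂ) + 1 - Fintype.card κ)) * (gram ι κ).det ^ (a + 1) := by
  apply mul_left_cancel₀ hd
  set d := (gram ι κ).det with hdd
  have h1 : ∀ i j, d * gramDivDiff a i j =
      ((a : MvPolynomial (GVar ι κ) ℂ) + 1) * d ^ a * (adjForm i j * adjForm j i) -
        d ^ a * (adjForm i i * adjForm j j) := by
    intro i j
    rw [gramDivDiff, ← hdd, mul_sub, mul_left_comm d (d ^ a), hdd, det_mul_pderiv_adjForm, ← hdd]
    -- The case `a = 0` is separate because `d * d ^ (a - 1) = d ^ a` then fails; the coefficient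
    -- `a` removes that term.
    rcases a with _ | a
    · simp
    · simp only [Nat.add_sub_cancel, Nat.cast_add, Nat.cast_one]
      ring
  have h2 : ∀ i, ∑ j, tvar i * (tvar j * (d * gramDivDiff a i j)) =
      tvar i * (((a : MvPolynomial (GVar ι κ) ℂ) + 1) * d ^ a * (d * adjForm i i) -
        d ^ a * adjForm i i * ((Fintype.card κ : MvPolynomial (GVar ι κ) ℂ) * d)) := by
    intro i
    rw [← Finset.mul_sum, ← sum_tvar_mul_adjForm_mul, ← sum_tvar_mul_adjForm, Finset.mul_sum (a := (_ + 1) * d ^ a),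
      Finset.mul_sum (a := d ^ a * _), ← Finset.sum_sub_distrib]
    congr 1
    refine Finset.sum_congr rfl fun j _ => ?_
    rw [h1]
    ring
  calc d * ∑ i, ∑ j, tvar i * (tvar j * gramDivDiff a i j)
      = ∑ i, ∑ j, tvar i * (tvar j * (d * gramDivDiff a i j)) := by
        rw [Finset.mul_sum]
        refine Finset.sum_congr rfl fun i _ => ?_
        rw [Finset.mul_sum]
        refine Finset.sum_congr rfl fun j _ => ?_
        ring
    _ = ∑ i, (((a : MvPolynomial (GVar ι κ) ℂ) + 1 - (Fintype.card κ : MvPolynomial (GVar ι κ) ℂ)) * d ^ (a + 1)) *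
          (tvar i * adjForm i i) := by
        refine Finset.sum_congr rfl fun i _ => ?_
        rw [h2]
        ring
    _ = _ := by
        rw [← Finset.mul_sum, sum_tvar_mul_adjForm]
        simp only [map_mul, map_sub, map_add, map_natCast, map_one]
        ring

/-- The partial differential equation satisfied by the moments of the determinant. -/
lemma detMoment_pde (hd : (gram ι κ).det ≠ 0) (α : ℕ) :
    ∃ R : ι → ι → MvPolynomial ι ℂ,
      (∀ i, R i i = pderiv i (pderiv i (detMoment ι κ α))) ∧
      (∀ i j, (X i - X j) * R i j = pderiv i (detMoment ι κ α) - pderiv j (detMoment ι κ α)) ∧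
      ∑ i, ∑ j, X i * (X j * R i j) =
        C ((α : ℂ) * (Fintype.card κ * ((α : ℂ) - Fintype.card κ))) * detMoment ι κ α := by
  rcases α with _ | a
  · refine ⟨fun _ _ => 0, ?_, ?_, ?_⟩
    all_goals
      have h1 : ∀ i, pderiv i (detMoment ι κ 0) = 0 := by
        intro i
        rw [detMoment, ← wick_pderiv_tvar, pow_zero, pderiv_one, map_zero]
      simp [h1]
  · refine ⟨fun i j => C ((a : ℂ) + 1) * wick (gramDivDiff (κ := κ) a i j), ?_, ?_, ?_⟩
    · intro i
      beta_reduce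
      rw [detMoment, ← wick_pderiv_tvar, ← wick_pderiv_tvar, pderiv_pderiv_det_gram_pow hd,
        ← smul_eq_C_mul, ← smul_eq_C_mul, map_smul]
    · intro i j
      -- Rotating this polynomial produces the difference of two first derivatives plus `tᵢ - tⱼ`
      -- times the candidate for `R i j`; its expectation is zero.
      have h := wick_rowRotation i j ((gram ι κ).det ^ a * adjForm j i)
      rw [rowRotation_det_pow_mul_adjForm hd, map_add, map_sub, sub_mul, map_sub, wick_tvar_mul,
        wick_tvar_mul, ← sub_mul] at h
      beta_reduce
      rw [detMoment, ← wick_pderiv_tvar, ← wick_pderiv_tvar, pderiv_det_gram_pow,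
        pderiv_det_gram_pow, ← smul_eq_C_mul, ← smul_eq_C_mul, ← smul_eq_C_mul, map_smul, map_smul,
        ← smul_sub, mul_smul_comm]
      congr 1
      linear_combination h
    · have h := congrArg wick (sum_sum_tvar_mul_gramDivDiff hd a)
      simp only [map_sum, wick_tvar_mul] at h
      rw [← smul_eq_C_mul, map_smul, smul_eq_C_mul] at h
      have h2 : ∀ i j : ι, X i * (X j * (C ((a : ℂ) + 1) * wick (gramDivDiff (κ := κ) a i j))) =
          C ((a : ℂ) + 1) * (X i * (X j * wick (gramDivDiff (κ := κ) a i j))) := by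
        intro i j
        ring
      simp only [h2, ← Finset.mul_sum] at h ⊢
      rw [h, detMoment, ← mul_assoc, ← C_mul]
      push_cast
      ring_nf

/-- Euler's identity: the moment is homogeneous of degree `αn` in the scales, with `n` the size of
the matrix. -/
lemma sum_X_mul_pderiv_detMoment (α : ℕ) :
    ∑ i, X i * pderiv i (detMoment ι κ α) =
      C ((α : ℂ) * Fintype.card κ) * detMoment ι κ α := by
  rcases α with _ | a
  · have h1 : ∀ i, pderiv i (detMoment ι κ 0) = 0 := by
      intro i
      rw [detMoment, ← wick_pderiv_tvar, pow_zero, pderiv_one, map_zero]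
    simp [h1]
  · have h : ∑ i, tvar i * pderiv (Sum.inr (Sum.inr i)) ((gram ι κ).det ^ (a + 1)) =
        C (((a : ℂ) + 1) * Fintype.card κ) * (gram ι κ).det ^ (a + 1) := by
      have h2 : ∀ i, tvar i * pderiv (Sum.inr (Sum.inr i)) ((gram ι κ).det ^ (a + 1)) =
          (C ((a : ℂ) + 1) * (gram ι κ).det ^ a) * (tvar i * adjForm i i) := by
        intro i
        rw [pderiv_det_gram_pow]
        ring
      simp only [h2, ← Finset.mul_sum]
      rw [sum_tvar_mul_adjForm]
      simp only [map_mul, map_natCast]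
      ring
    have h3 := congrArg wick h
    simp only [map_sum, wick_tvar_mul, wick_pderiv_tvar] at h3
    rw [← smul_eq_C_mul, map_smul, smul_eq_C_mul] at h3
    rw [detMoment, h3]
    push_cast
    rfl

lemma coeff_eq_zero_of_pderiv_pderiv {σ : Type*} (i : σ) (p : MvPolynomial σ ℂ)
    (h : pderiv i (pderiv i p) = 0) (m : σ →₀ ℕ) (hm : 1 < m i) : coeff m p = 0 := by
  classical
  have h1 := congrArg (coeff (m - Finsupp.single i 2)) h
  have hm' : m - Finsupp.single i 2 + Finsupp.single i 1 + Finsupp.single i 1 = m := by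
    ext j
    by_cases hj : i = j
    · subst hj; simp; omega
    · simp [hj]
  rw [coeff_pderiv, coeff_pderiv, hm', coeff_zero] at h1
  simp only [mul_eq_zero] at h1
  rcases h1 with (h1 | h1) | h1
  · exact h1
  · norm_cast at h1
  · norm_cast at h1

lemma degreeOf_wick_le (i : ι) (p : MvPolynomial (GVar ι κ) ℂ) :
    degreeOf i (wick p) ≤ degreeOf (Sum.inr (Sum.inr i)) p := by
  conv_lhs => rw [p.as_sum, map_sum]
  refine (degreeOf_sum_le _ _ _).trans (Finset.sup_le fun s hs => ?_)
  rw [wick_monomial]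
  split_ifs
  · refine (degreeOf_le_iff.mpr fun m hm => ?_)
    have : m = scaleExp s := by
      by_contra hne
      rw [mem_support_iff, coeff_monomial, if_neg (Ne.symm hne)] at hm
      exact hm rfl
    rw [this, scaleExp_apply]
    exact degreeOf_le_iff.mp le_rfl s hs
  · simp

/-- The determinant is affine in each scale and taking expectations does not raise exponents of
scales. The bound later keeps the exponents in the range where the rectangle is extremal. -/
lemma degreeOf_detMoment_le (hd : (gram ι κ).det ≠ 0) (α : ℕ) (i : ι) :
    degreeOf i (detMoment ι κ α) ≤ α := by
  refine (degreeOf_wick_le i _).trans ((degreeOf_pow_le _ _ _).trans ?_)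
  have : degreeOf (Sum.inr (Sum.inr i)) (gram ι κ).det ≤ 1 := by
    refine degreeOf_le_iff.mpr fun m hm => ?_
    by_contra! h
    exact (mem_support_iff.mp hm) (coeff_eq_zero_of_pderiv_pderiv _ _
      (by rw [pderiv_det_gram, pderiv_adjForm_self hd]) m h)
  nlinarith

/-- The action of a permutation of the rows on the variables. -/
def permVar (e : Equiv.Perm ι) : GVar ι κ → GVar ι κ :=
  Sum.map (Prod.map e id) (Sum.map (Prod.map e id) e)

lemma permVar_injective (e : Equiv.Perm ι) : Function.Injective (permVar (κ := κ) e) :=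
  Function.Injective.sumMap (e.injective.prodMap Function.injective_id)
    (Function.Injective.sumMap (e.injective.prodMap Function.injective_id) e.injective)

lemma wick_rename (e : Equiv.Perm ι) (p : MvPolynomial (GVar ι κ) ℂ) :
    wick (rename (permVar e) p) = rename e (wick p) := by
  induction p using MvPolynomial.induction_on' with
  | add p q hp hq => rw [map_add, map_add, hp, hq, map_add, map_add]
  | monomial s c =>
    have hl : ∀ v : ι × κ, Finsupp.mapDomain (permVar e) s (Sum.inl (Prod.map e id v)) =
        s (Sum.inl v) := fun v =>
      Finsupp.mapDomain_apply (permVar_injective e) s (Sum.inl v)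
    have hr : ∀ v : ι × κ, Finsupp.mapDomain (permVar e) s (Sum.inr (Sum.inl (Prod.map e id v))) =
        s (Sum.inr (Sum.inl v)) := fun v =>
      Finsupp.mapDomain_apply (permVar_injective e) s (Sum.inr (Sum.inl v))
    have ht : ∀ i : ι, Finsupp.mapDomain (permVar e) s (Sum.inr (Sum.inr (e i))) =
        s (Sum.inr (Sum.inr i)) := fun i =>
      Finsupp.mapDomain_apply (permVar_injective e) s (Sum.inr (Sum.inr i))
    have hsurj : Function.Surjective (Prod.map e id : ι × κ → ι × κ) :=
      e.surjective.prodMap Function.surjective_id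
    have hexp : scaleExp (Finsupp.mapDomain (permVar e) s) =
        Finsupp.mapDomain e (scaleExp s) := by
      ext i
      obtain ⟨i, rfl⟩ := e.surjective i
      rw [Finsupp.mapDomain_apply e.injective, scaleExp_apply, ht, scaleExp_apply]
    have hprod : ∏ v, ((Finsupp.mapDomain (permVar e) s (Sum.inl v)).factorial : ℂ) =
        ∏ v, ((s (Sum.inl v)).factorial : ℂ) := by
      rw [← (Equiv.prodCongr e (Equiv.refl κ)).prod_comp]
      refine Finset.prod_congr rfl fun v _ => ?_
      rw [← hl v]
      rfl
    rw [rename_monomial, wick_monomial, wick_monomial, hexp, hprod]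
    have hiff : (∀ v : ι × κ, Finsupp.mapDomain (permVar e) s (Sum.inl v) =
        Finsupp.mapDomain (permVar e) s (Sum.inr (Sum.inl v))) ↔
        ∀ v : ι × κ, s (Sum.inl v) = s (Sum.inr (Sum.inl v)) := by
      rw [hsurj.forall]
      refine forall_congr' fun v => ?_
      rw [hl, hr]
    rw [if_congr hiff rfl rfl]
    split_ifs
    · rw [rename_monomial]
    · simp

/-- The rows are exchangeable, so the moment is symmetric in the scales. -/
lemma rename_detMoment (e : Equiv.Perm ι) (α : ℕ) :
    rename e (detMoment ι κ α) = detMoment ι κ α := by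
  rw [detMoment, ← wick_rename, map_pow, AlgHom.map_det]
  congr 3
  ext1 k l
  rw [AlgHom.mapMatrix_apply, Matrix.map_apply, gram_apply, map_sum]
  refine Eq.trans ?_ (Equiv.sum_comp e
    (fun i => (tvar i * (gvar (i, k) * hvar (i, l)) : MvPolynomial (GVar ι κ) ℂ)))
  refine Finset.sum_congr rfl fun i _ => ?_
  simp [tvar, gvar, hvar, permVar]

end DetMoment

/-! ### Alternating polynomials and the rectangular eigenfunction -/

section Alternating

variable {N : ℕ}

/-- The alternating polynomial `det (X_i ^ l_j)`. -/
def altPoly (l : Fin N → ℕ) : MvPolynomial (Fin N) ℂ :=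
  (Matrix.of fun i j => (X i : MvPolynomial (Fin N) ℂ) ^ l j).det

lemma altPoly_eq_sum (l : Fin N → ℕ) :
    altPoly l = ∑ σ : Equiv.Perm (Fin N), (Equiv.Perm.sign σ : ℤ) •
      rename σ (monomial (Finsupp.equivFunOnFinite.symm l) (1 : ℂ)) := by
  rw [altPoly, Matrix.det_apply]
  refine Finset.sum_congr rfl fun σ _ => ?_
  rw [Units.smul_def]
  congr 1
  rw [monomial_eq, C_1, one_mul, Finsupp.prod_fintype _ _ (by simp), map_prod]
  refine Finset.prod_congr rfl fun i _ => ?_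
  simp

lemma rename_altPoly (l : Fin N → ℕ) (σ : Equiv.Perm (Fin N)) :
    rename σ (altPoly l) = (Equiv.Perm.sign σ : ℤ) • altPoly l := by
  rw [altPoly, AlgHom.map_det]
  have : (rename σ : MvPolynomial (Fin N) ℂ →ₐ[ℂ] MvPolynomial (Fin N) ℂ).mapMatrix
      (Matrix.of fun i j => X i ^ l j) =
      (Matrix.of fun i j => (X i : MvPolynomial (Fin N) ℂ) ^ l j).submatrix σ id := by
    ext1 i j
    simp
  rw [this, Matrix.det_permute, zsmul_eq_mul]

lemma altPoly_comp (l : Fin N → ℕ) (σ : Equiv.Perm (Fin N)) :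
    altPoly (l ∘ σ) = (Equiv.Perm.sign σ : ℤ) • altPoly l := by
  have : (Matrix.of fun i j => (X i : MvPolynomial (Fin N) ℂ) ^ (l ∘ σ) j) =
      (Matrix.of fun i j => (X i : MvPolynomial (Fin N) ℂ) ^ l j).submatrix id σ := rfl
  rw [altPoly, this, Matrix.det_permute', zsmul_eq_mul, altPoly]

lemma altPoly_eq_zero {l : Fin N → ℕ} (h : ¬ Function.Injective l) : altPoly l = 0 := by
  simp only [Function.Injective, not_forall] at h
  obtain ⟨i, j, hij, hne⟩ := h
  exact Matrix.det_zero_of_column_eq hne fun k => by simp [hij]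

/-- An alternating polynomial is the alternation of its own monomials. -/
lemma factorial_smul_eq_sum_altPoly (P : MvPolynomial (Fin N) ℂ)
    (hP : ∀ σ : Equiv.Perm (Fin N), rename σ P = (Equiv.Perm.sign σ : ℤ) • P) :
    (N.factorial : ℂ) • P = ∑ m ∈ P.support, coeff m P • altPoly m := by
  have h1 : ∑ σ : Equiv.Perm (Fin N), (Equiv.Perm.sign σ : ℤ) • rename σ P =
      (N.factorial : ℂ) • P := by
    have : ∀ σ : Equiv.Perm (Fin N), (Equiv.Perm.sign σ : ℤ) • rename σ P = P := by
      intro σ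
      rw [hP, smul_smul, ← Units.val_mul, Int.units_mul_self, Units.val_one, one_smul]
    simp only [this, Finset.sum_const, Finset.card_univ, Fintype.card_perm, Fintype.card_fin]
    rw [Nat.cast_smul_eq_nsmul]
  rw [← h1]
  have h2 : ∀ m : Fin N →₀ ℕ, altPoly m = ∑ σ : Equiv.Perm (Fin N), (Equiv.Perm.sign σ : ℤ) •
      rename σ (monomial m (1 : ℂ)) := by
    intro m
    convert altPoly_eq_sum (m : Fin N → ℕ)
    ext i
    simp
  simp only [h2, Finset.smul_sum]
  rw [Finset.sum_comm]
  refine Finset.sum_congr rfl fun σ _ => ?_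
  conv_lhs => rw [P.as_sum, map_sum, Finset.smul_sum]
  refine Finset.sum_congr rfl fun m _ => ?_
  rw [smul_comm (coeff m P)]
  congr 1
  rw [← map_smul, smul_monomial, smul_eq_mul, mul_one]

/-- The Euler operator of a single variable. -/
def euler (i : Fin N) : Derivation ℂ (MvPolynomial (Fin N) ℂ) (MvPolynomial (Fin N) ℂ) :=
  (X i : MvPolynomial (Fin N) ℂ) • pderiv i

lemma euler_apply (i : Fin N) (p : MvPolynomial (Fin N) ℂ) : euler i p = X i * pderiv i p := rfl

lemma euler_monomial (i : Fin N) (m : Fin N →₀ ℕ) (c : ℂ) :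
    euler i (monomial m c) = (m i : ℂ) • monomial m c := by
  rw [euler_apply, X_mul_pderiv_monomial, Nat.cast_smul_eq_nsmul]

lemma coeff_euler (i : Fin N) (p : MvPolynomial (Fin N) ℂ) (m : Fin N →₀ ℕ) :
    coeff m (euler i p) = m i * coeff m p := by
  induction p using MvPolynomial.induction_on' with
  | add p q hp hq => rw [map_add, coeff_add, hp, hq, coeff_add, mul_add]
  | monomial s c =>
    rw [euler_monomial, coeff_smul, smul_eq_mul, coeff_monomial]
    split_ifs with h
    · rw [h]
    · simp

lemma rename_monomial_apply (σ : Equiv.Perm (Fin N)) (m : Fin N →₀ ℕ) (i : Fin N) :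
    (Finsupp.mapDomain σ m) i = m (σ.symm i) := by
  conv_lhs => rw [← σ.apply_symm_apply i]
  rw [Finsupp.mapDomain_apply σ.injective]

lemma sum_euler_altPoly (l : Fin N → ℕ) :
    ∑ i, euler i (altPoly l) = (∑ i, (l i : ℂ)) • altPoly l := by
  rw [altPoly_eq_sum]
  simp only [map_sum, map_zsmul, rename_monomial, euler_monomial]
  rw [Finset.sum_comm, Finset.smul_sum]
  refine Finset.sum_congr rfl fun σ _ => ?_
  rw [← Finset.smul_sum, ← Finset.sum_smul, smul_comm]
  congr 1
  rw [← Equiv.sum_comp σ]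
  simp

lemma sum_euler_euler_altPoly (l : Fin N → ℕ) :
    ∑ i, euler i (euler i (altPoly l)) = (∑ i, (l i : ℂ) ^ 2) • altPoly l := by
  rw [altPoly_eq_sum]
  simp only [map_sum, map_zsmul, rename_monomial, euler_monomial, Derivation.map_smul, smul_smul]
  rw [Finset.sum_comm, Finset.smul_sum]
  refine Finset.sum_congr rfl fun σ _ => ?_
  rw [← Finset.smul_sum, ← Finset.sum_smul, smul_comm]
  congr 1
  rw [← Equiv.sum_comp σ]
  simp [sq]

lemma degreeOf_altPoly_le (l : Fin N → ℕ) (b : ℕ) (hl : ∀ i, l i ≤ b) (i : Fin N) :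
    degreeOf i (altPoly l) ≤ b := by
  rw [altPoly_eq_sum]
  refine degreeOf_le_iff.mpr fun m hm => ?_
  obtain ⟨σ, -, hσ⟩ := Finset.mem_biUnion.mp (support_sum hm)
  have h := support_smul hσ
  rw [rename_monomial] at h
  have h2 := support_monomial_subset h
  rw [Finset.mem_singleton] at h2
  rw [h2, rename_monomial_apply]
  exact hl _

/-- The Vandermonde product. -/
def vdm (N : ℕ) : MvPolynomial (Fin N) ℂ := altPoly fun i => (i : ℕ)

/-- The pairs of increasing indices. -/
def incPairs (N : ℕ) : Finset (Fin N × Fin N) := Finset.univ.filter fun p => p.1 < p.2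

lemma vdm_eq_prod : vdm N = ∏ p ∈ incPairs N, (X p.2 - X p.1) := by
  have h : vdm N = (Matrix.vandermonde (X : Fin N → MvPolynomial (Fin N) ℂ)).det := rfl
  rw [h, Matrix.det_vandermonde, incPairs, Finset.prod_filter, Fintype.prod_prod_type]
  refine Finset.prod_congr rfl fun i _ => ?_
  rw [← Finset.prod_filter]
  refine Finset.prod_congr ?_ fun _ _ => rfl
  ext j
  simp

lemma vdm_ne_zero : vdm N ≠ 0 := by
  rw [vdm_eq_prod, Finset.prod_ne_zero_iff]
  intro p hp
  have : p.2 ≠ p.1 := (Finset.mem_filter.mp hp).2.ne'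
  rw [sub_ne_zero]
  exact fun h => this (X_injective h)

lemma sum_sum_eq_diag_add {A : Type*} [AddCommMonoid A] (f : Fin N → Fin N → A) :
    ∑ i, ∑ j, f i j = ∑ i, f i i + ∑ p ∈ incPairs N, (f p.1 p.2 + f p.2 p.1) := by
  have h1 : ∀ i, ∑ j, f i j =
      f i i + ((∑ j, if i < j then f i j else 0) + ∑ j, if j < i then f i j else 0) := by
    intro i
    have : ∀ j, f i j = (if j = i then f i i else 0) +
        ((if i < j then f i j else 0) + if j < i then f i j else 0) := by
      intro j
      rcases lt_trichotomy i j with h | h | h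
      · simp [h, h.ne', h.not_gt]
      · simp [h]
      · simp [h, h.ne, h.not_gt]
    rw [Finset.sum_congr rfl fun j _ => this j, Finset.sum_add_distrib, Finset.sum_add_distrib]
    simp
  rw [Finset.sum_congr rfl fun i _ => h1 i, Finset.sum_add_distrib, Finset.sum_add_distrib,
    Finset.sum_comm (f := fun i j => if j < i then f i j else 0), ← Finset.sum_add_distrib,
    incPairs, Finset.sum_filter, Fintype.sum_prod_type]
  congr 1
  refine Finset.sum_congr rfl fun i _ => ?_
  rw [← Finset.sum_add_distrib]
  refine Finset.sum_congr rfl fun j _ => ?_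
  split_ifs <;> simp

/-- If `F` satisfies the second order equation below, then the Vandermonde multiple of `F` is an
eigenfunction of the sum of the squares of the Euler operators. -/
lemma sum_euler_euler_vdm_mul {F : MvPolynomial (Fin N) ℂ} {c k : ℂ}
    {R : Fin N → Fin N → MvPolynomial (Fin N) ℂ}
    (hdiag : ∀ i, R i i = pderiv i (pderiv i F))
    (hdiff : ∀ i j, (X i - X j) * R i j = pderiv i F - pderiv j F)
    (hsum : ∑ i, ∑ j, X i * (X j * R i j) = C c * F)
    (heuler : ∑ i, X i * pderiv i F = C k * F) :
    ∑ i, euler i (euler i (vdm N * F)) =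
      ((∑ i : Fin N, ((i : ℕ) : ℂ) ^ 2) + c + (2 * N - 1) * k) • (vdm N * F) := by
  -- `Q p` is the Vandermonde product without the factor of `p`, which avoids dividing by
  -- differences of variables.
  obtain ⟨Q, hQ⟩ : ∃ Q : Fin N × Fin N → MvPolynomial (Fin N) ℂ,
      ∀ p, Q p = ∏ q ∈ (incPairs N).erase p, (X q.2 - X q.1) := ⟨_, fun _ => rfl⟩
  have hQmul : ∀ p ∈ incPairs N, Q p * (X p.2 - X p.1) = vdm N := by
    intro p hp
    rw [vdm_eq_prod, hQ]
    exact Finset.prod_erase_mul _ (fun q : Fin N × Fin N => (X q.2 - X q.1)) hp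
  have hcross : ∑ i, X i * pderiv i (vdm N) * (X i * pderiv i F) =
      ∑ p ∈ incPairs N, Q p * (X p.2 ^ 2 * pderiv p.2 F - X p.1 ^ 2 * pderiv p.1 F) := by
    have h1 : ∀ i, X i * pderiv i (vdm N) * (X i * pderiv i F) = ∑ p ∈ incPairs N,
        Q p * ((if p.2 = i then X i ^ 2 * pderiv i F else 0) -
          (if p.1 = i then X i ^ 2 * pderiv i F else 0)) := by
      intro i
      rw [vdm_eq_prod, derivation_prod, Finset.mul_sum, Finset.sum_mul]
      refine Finset.sum_congr rfl fun p _ => ?_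
      rw [map_sub, pderiv_X, pderiv_X, Pi.single_apply, Pi.single_apply, ← hQ]
      split_ifs <;> ring
    rw [Finset.sum_congr rfl fun i _ => h1 i, Finset.sum_comm]
    refine Finset.sum_congr rfl fun p _ => ?_
    rw [← Finset.mul_sum, Finset.sum_sub_distrib]
    simp
  have hR : vdm N * (C c * F) = vdm N * ∑ i, X i ^ 2 * pderiv i (pderiv i F) +
      2 * ∑ p ∈ incPairs N, Q p * (X p.1 * X p.2 * (pderiv p.2 F - pderiv p.1 F)) := by
    rw [← hsum, sum_sum_eq_diag_add, mul_add]
    refine congrArg₂ (· + ·) (congrArg (vdm N * ·) ?_) ?_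
    · refine Finset.sum_congr rfl fun i _ => ?_
      rw [hdiag]
      ring
    · rw [Finset.mul_sum, Finset.mul_sum]
      refine Finset.sum_congr rfl fun p hp => ?_
      rw [← hQmul p hp]
      linear_combination (Q p * X p.1 * X p.2) * hdiff p.2 p.1 -
        (Q p * X p.1 * X p.2) * hdiff p.1 p.2
  have hpair : ∑ p ∈ incPairs N, (X p.1 * pderiv p.1 F + X p.2 * pderiv p.2 F) =
      (N - 1 : MvPolynomial (Fin N) ℂ) * (C k * F) := by
    have h1 := sum_sum_eq_diag_add fun i _ : Fin N => X i * pderiv i F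
    simp only [Finset.sum_const, Finset.card_univ, Fintype.card_fin, nsmul_eq_mul,
      ← Finset.mul_sum, heuler] at h1
    linear_combination -h1
  -- From `y²∂_y - x²∂_x = xy(∂_y - ∂_x) + (y - x)(x∂_x + y∂_y)`: the first part is the off-diagonal
  -- part of the differential equation, the second is Euler's identity.
  have hcomb : ∑ p ∈ incPairs N, Q p * (X p.2 ^ 2 * pderiv p.2 F - X p.1 ^ 2 * pderiv p.1 F) =
      ∑ p ∈ incPairs N, Q p * (X p.1 * X p.2 * (pderiv p.2 F - pderiv p.1 F)) +
        vdm N * ((N - 1 : MvPolynomial (Fin N) ℂ) * (C k * F)) := by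
    rw [← hpair, Finset.mul_sum, ← Finset.sum_add_distrib]
    refine Finset.sum_congr rfl fun p hp => ?_
    rw [← hQmul p hp]
    ring
  have hLF : ∑ i, euler i (euler i F) = C k * F + ∑ i, X i ^ 2 * pderiv i (pderiv i F) := by
    rw [← heuler, ← Finset.sum_add_distrib]
    refine Finset.sum_congr rfl fun i _ => ?_
    rw [euler_apply, euler_apply, pderiv_mul, pderiv_X_self]
    ring
  have hprod : ∑ i, euler i (euler i (vdm N * F)) =
      (∑ i, euler i (euler i (vdm N))) * F +
        2 * ∑ i, X i * pderiv i (vdm N) * (X i * pderiv i F) +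
        vdm N * ∑ i, euler i (euler i F) := by
    rw [Finset.sum_mul, Finset.mul_sum, Finset.mul_sum, ← Finset.sum_add_distrib,
      ← Finset.sum_add_distrib]
    refine Finset.sum_congr rfl fun i _ => ?_
    simp only [Derivation.leibniz, map_add, smul_eq_mul, ← euler_apply]
    ring
  have hvdm : ∑ i, euler i (euler i (vdm N)) = C (∑ i : Fin N, ((i : ℕ) : ℂ) ^ 2) * vdm N := by
    rw [vdm, sum_euler_euler_altPoly, smul_eq_C_mul]
  rw [hprod, hcross, hcomb, hLF, hvdm, smul_eq_C_mul]
  simp only [map_add, map_mul, map_sub, map_natCast, map_one, map_ofNat]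
  linear_combination -hR

end Alternating

/-! ### The moments of the determinant as a Toeplitz determinant -/

section Rect

/-- The exponents of the alternating polynomial attached to a rectangular partition. -/
def rectExp (p n α : ℕ) (j : Fin (p + n)) : ℕ := if (j : ℕ) < p then j else j + α

lemma sum_rectExp {A : Type*} [AddCommMonoid A] (p n α : ℕ) (f : ℕ → A) :
    ∑ j, f (rectExp p n α j) = ∑ j ∈ Finset.range p, f j + ∑ j ∈ Finset.range n, f (p + j + α) := by
  rw [Fin.sum_univ_add, ← Fin.sum_univ_eq_sum_range, ← Fin.sum_univ_eq_sum_range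
    (fun j => f (p + j + α))]
  congr 1
  · refine Finset.sum_congr rfl fun j _ => ?_
    simp [rectExp]
  · refine Finset.sum_congr rfl fun j _ => ?_
    simp [rectExp]

lemma sum_rectExp_cast (p n α : ℕ) :
    ∑ j, (rectExp p n α j : ℤ) = ∑ j : Fin (p + n), ((j : ℕ) : ℤ) + α * n := by
  rw [sum_rectExp p n α (fun j => (j : ℤ)), Fin.sum_univ_eq_sum_range (fun j => (j : ℤ)) (p + n),
    Finset.sum_range_add, add_assoc]
  congr 1
  push_cast
  rw [Finset.sum_add_distrib]
  simp [mul_comm]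

/-- The right side is the eigenvalue in `sum_euler_euler_vdm_mul` for `N = p + n`, `c = αn(α - n)`
and `k = αn`. -/
lemma sum_rectExp_sq (p n α : ℕ) :
    ∑ j, (rectExp p n α j : ℤ) ^ 2 = ∑ j : Fin (p + n), ((j : ℕ) : ℤ) ^ 2 +
      α * (n * (α - n)) + (2 * (p + n) - 1) * (α * n) := by
  rw [sum_rectExp p n α (fun j => (j : ℤ) ^ 2),
    Fin.sum_univ_eq_sum_range (fun j => (j : ℤ) ^ 2) (p + n), Finset.sum_range_add, add_assoc,
    add_assoc]
  congr 1
  induction n with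
  | zero => simp
  | succ n ih =>
    rw [Finset.sum_range_succ, ih, Finset.sum_range_succ]
    push_cast
    ring

lemma rectExp_injective (p n α : ℕ) : Function.Injective (rectExp p n α) := by
  intro i j h
  simp only [rectExp] at h
  ext
  split_ifs at h <;> omega

/-- Among the families of distinct exponents below `p + n + α`, the rectangular one is determined
up to order by its sum and its sum of squares. -/
lemma exists_perm_rectExp {p n α : ℕ} {m : Fin (p + n) → ℕ} (hm : Function.Injective m)
    (hlt : ∀ i, m i < p + n + α) (h1 : ∑ i, (m i : ℤ) = ∑ i, (rectExp p n α i : ℤ))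
    (h2 : ∑ i, (m i : ℤ) ^ 2 = ∑ i, (rectExp p n α i : ℤ) ^ 2) :
    ∃ τ : Equiv.Perm (Fin (p + n)), m = rectExp p n α ∘ τ := by
  classical
  -- A quadratic with roots `p - 1/2` and `p + α - 1/2`: positive at the exponents of the rectangle,
  -- negative in the gap `p ≤ x < p + α`. Its sum over the exponents is fixed by the hypotheses, so
  -- no exponent can have moved into the gap.
  set g : ℕ → ℤ := fun x => (2 * x - 2 * p + 1) * (2 * x - 2 * p - 2 * α + 1) with hg
  have hgsum : ∀ l : Fin (p + n) → ℕ, ∑ i, g (l i) = 4 * ∑ i, (l i : ℤ) ^ 2 +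
      (-8 * p - 4 * α + 4) * ∑ i, (l i : ℤ) + (p + n) * ((1 - 2 * p) * (1 - 2 * p - 2 * α)) := by
    intro l
    have : ∀ i, g (l i) = 4 * (l i : ℤ) ^ 2 + (-8 * p - 4 * α + 4) * (l i : ℤ) +
        (1 - 2 * p) * (1 - 2 * p - 2 * α) := by
      intro i
      simp only [hg]
      ring
    rw [Finset.sum_congr rfl fun i _ => this i, Finset.sum_add_distrib, Finset.sum_add_distrib,
      Finset.mul_sum, Finset.mul_sum]
    simp
  set S := Finset.univ.image m
  set S₀ := Finset.univ.image (rectExp p n α)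
  have hS : ∑ x ∈ S, g x = ∑ x ∈ S₀, g x := by
    rw [Finset.sum_image (fun i _ j _ h => hm h),
      Finset.sum_image (fun i _ j _ h => rectExp_injective p n α h), hgsum, hgsum, h1, h2]
  have hmem : ∀ x, x ∈ S₀ ↔ x < p ∨ (p + α ≤ x ∧ x < p + n + α) := by
    intro x
    simp only [S₀, Finset.mem_image, Finset.mem_univ, true_and, rectExp]
    constructor
    · rintro ⟨j, rfl⟩
      have := j.isLt
      split_ifs <;> omega
    · rintro (h | ⟨h, h'⟩)
      · exact ⟨⟨x, by omega⟩, by simp [h]⟩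
      · refine ⟨⟨x - α, by omega⟩, ?_⟩
        simp only
        rw [if_neg (by omega)]
        omega
  have hcard : S.card = S₀.card := by
    rw [Finset.card_image_of_injective _ hm,
      Finset.card_image_of_injective _ (rectExp_injective p n α)]
  have hpos : ∀ x ∈ S₀ \ S, 0 < g x := by
    intro x hx
    rw [Finset.mem_sdiff, hmem] at hx
    rcases hx.1 with h | ⟨h, -⟩
    · apply mul_pos_of_neg_of_neg <;> omega
    · apply mul_pos <;> omega
  have hneg : ∀ x ∈ S \ S₀, g x ≤ 0 := by
    intro x hx
    rw [Finset.mem_sdiff, hmem] at hx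
    obtain ⟨i, -, rfl⟩ := Finset.mem_image.mp hx.1
    have := hlt i
    apply mul_nonpos_of_nonneg_of_nonpos <;> omega
  have hempty : S₀ \ S = ∅ := by
    by_contra hne
    have hlt' : 0 < ∑ x ∈ S₀ \ S, g x :=
      Finset.sum_pos hpos (Finset.nonempty_iff_ne_empty.mpr hne)
    have hle : ∑ x ∈ S \ S₀, g x ≤ 0 := Finset.sum_nonpos hneg
    have e1 := Finset.sum_sdiff (f := g) (Finset.inter_subset_left (s₁ := S) (s₂ := S₀))
    have e2 := Finset.sum_sdiff (f := g) (Finset.inter_subset_left (s₁ := S₀) (s₂ := S))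
    rw [Finset.sdiff_inter_self_left] at e1 e2
    rw [Finset.inter_comm] at e2
    omega
  have hsub : S₀ ⊆ S := Finset.sdiff_eq_empty_iff_subset.mp hempty
  have heq : S₀ = S := Finset.eq_of_subset_of_card_le hsub hcard.le
  have hex : ∀ i, ∃ j, rectExp p n α j = m i := by
    intro i
    have : m i ∈ S₀ := heq ▸ Finset.mem_image_of_mem m (Finset.mem_univ i)
    obtain ⟨j, -, hj⟩ := Finset.mem_image.mp this
    exact ⟨j, hj⟩
  choose τ hτ using hex
  have hinj : Function.Injective τ := fun i j h => hm (by rw [← hτ, ← hτ, h])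
  exact ⟨Equiv.ofBijective τ (Finite.injective_iff_bijective.mp hinj), funext fun i => (hτ i).symm⟩

/-- The moments of the determinant times the Vandermonde product are a multiple of the
alternating polynomial of a rectangular partition. -/
lemma exists_vdm_mul_detMoment (p n α : ℕ) :
    ∃ c : ℂ, vdm (p + n) * detMoment (Fin (p + n)) (Fin n) α = c • altPoly (rectExp p n α) := by
  have hd : (gram (Fin (p + n)) (Fin n)).det ≠ 0 :=
    det_gram_ne_zero ⟨Fin.natAdd p, Fin.natAdd_injective n p⟩
  set F := detMoment (Fin (p + n)) (Fin n) α with hF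
  obtain ⟨R, hR1, hR2, hR3⟩ := detMoment_pde hd α
  have heul := sum_X_mul_pderiv_detMoment (ι := Fin (p + n)) (κ := Fin n) α
  rw [← hF] at hR1 hR2 hR3 heul
  have hcas := sum_euler_euler_vdm_mul hR1 hR2 hR3 heul
  have heul2 : ∑ i, euler i (vdm (p + n) * F) =
      ((∑ i : Fin (p + n), ((i : ℕ) : ℂ)) + α * n) • (vdm (p + n) * F) := by
    simp only [Derivation.leibniz, smul_eq_mul, Finset.sum_add_distrib, ← Finset.mul_sum]
    rw [vdm, sum_euler_altPoly, add_smul]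
    simp only [euler_apply]
    rw [heul]
    simp only [Fintype.card_fin, smul_eq_C_mul]
    ring
  set Ψ := vdm (p + n) * F with hΨ
  have halt : ∀ σ : Equiv.Perm (Fin (p + n)), rename σ Ψ = (Equiv.Perm.sign σ : ℤ) • Ψ := by
    intro σ
    rw [hΨ, map_mul, hF, rename_detMoment, vdm, rename_altPoly, smul_mul_assoc]
  have hm : ∀ m ∈ Ψ.support, ∃ c : ℂ, altPoly m = c • altPoly (rectExp p n α) := by
    intro m hm
    by_cases hinj : Function.Injective m
    swap
    · exact ⟨0, by rw [altPoly_eq_zero hinj, zero_smul]⟩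
    have hne := mem_support_iff.mp hm
    -- Euler operators are diagonal on monomials, so each monomial in the support carries the
    -- eigenvalue itself.
    have e1 : ∑ i, (m i : ℂ) = (∑ i : Fin (p + n), ((i : ℕ) : ℂ)) + α * n := by
      have := congrArg (coeff m) heul2
      rw [coeff_sum, coeff_smul, smul_eq_mul] at this
      simp only [coeff_euler] at this
      rw [← Finset.sum_mul] at this
      exact mul_right_cancel₀ hne this
    have e2 := congrArg (coeff m) hcas
    rw [coeff_sum, coeff_smul, smul_eq_mul] at e2
    simp only [coeff_euler, ← mul_assoc] at e2
    rw [← Finset.sum_mul] at e2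
    have e2 := mul_right_cancel₀ hne e2
    have hlt : ∀ i, m i < p + n + α := by
      intro i
      -- Degree `p + n - 1` comes from the Vandermonde product and `α` from the moment.
      have h1 : degreeOf i Ψ ≤ (p + n - 1) + α := by
        refine (degreeOf_mul_le _ _ _).trans (add_le_add ?_ (degreeOf_detMoment_le hd α i))
        exact degreeOf_altPoly_le _ _ (fun j => by have := j.isLt; omega) i
      have h2 := degreeOf_le_iff.mp h1 m hm
      have := i.isLt
      omega
    obtain ⟨τ, hτ⟩ := exists_perm_rectExp hinj hlt (by
        rw [sum_rectExp_cast]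
        exact_mod_cast e1) (by
        rw [sum_rectExp_sq]
        simp only [← sq, Fintype.card_fin] at e2
        have e3 : ((∑ i, (m i : ℤ) ^ 2 : ℤ) : ℂ) = ((∑ j : Fin (p + n), ((j : ℕ) : ℤ) ^ 2 +
            α * (n * (α - n)) + (2 * (p + n) - 1) * (α * n) : ℤ) : ℂ) := by
          push_cast at e2 ⊢
          rw [e2]
          ring
        exact_mod_cast e3)
    refine ⟨((Equiv.Perm.sign τ : ℤ) : ℂ), ?_⟩
    rw [hτ, altPoly_comp, Int.cast_smul_eq_zsmul]
  have hsum := factorial_smul_eq_sum_altPoly Ψ halt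
  choose! c hc using hm
  have hfac : ((p + n).factorial : ℂ) ≠ 0 := by exact_mod_cast (p + n).factorial_ne_zero
  refine ⟨((p + n).factorial : ℂ)⁻¹ * ∑ m ∈ Ψ.support, coeff m Ψ * c m, ?_⟩
  rw [mul_smul, eq_inv_smul_iff₀ hfac, hsum, Finset.sum_smul]
  refine Finset.sum_congr rfl fun m hm => ?_
  rw [hc m hm, smul_smul]

end Rect

/-! ### The bialternant formula for rectangular partitions -/

section Bialternant

open Polynomial in
/-- The Toeplitz matrix of the coefficients of a polynomial. -/
def toeplitz {A : Type*} [CommRing A] (q : Polynomial A) (p α : ℕ) : Matrix (Fin α) (Fin α) A :=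
  Matrix.of fun a b => (Polynomial.X ^ (b : ℕ) * q).coeff (p + a)

/-- The splitting of the columns into the exponents of the rectangle and the remaining ones. -/
def rectEquiv (p n α : ℕ) : Fin (p + n) ⊕ Fin α ≃ Fin (p + n + α) :=
  Equiv.ofBijective (Sum.elim (fun j => ⟨rectExp p n α j, by
      have := j.isLt; rw [rectExp]; split_ifs <;> omega⟩) fun a => ⟨p + a, by
      have := a.isLt; omega⟩) (by
    rw [Fintype.bijective_iff_injective_and_card]
    refine ⟨?_, by simp⟩
    rintro (i | a) (j | b) h
    · simp only [Sum.elim_inl, Fin.mk.injEq] at h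
      rw [rectExp_injective p n α h]
    · simp only [Sum.elim_inl, Sum.elim_inr, Fin.mk.injEq, rectExp] at h
      split_ifs at h <;> omega
    · simp only [Sum.elim_inl, Sum.elim_inr, Fin.mk.injEq, rectExp] at h
      split_ifs at h <;> omega
    · simp only [Sum.elim_inr, Fin.mk.injEq, add_right_inj] at h
      rw [Fin.ext h])

/-- Dual Jacobi–Trudi for a rectangle. `A₁` is the Vandermonde matrix widened to `p + n + α`
columns, with rows added that select columns `p, …, p + α - 1`. Eliminating those columns leaves the
alternant up to a permutation sign; multiplying by the unimodular matrix `B` of coefficients of `X^b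
q` leaves Vandermonde times Toeplitz. -/
lemma exists_sign_bialternant {A : Type*} [CommRing A] (p n α : ℕ) (y : Fin (p + n) → A) :
    ∃ s : ℤˣ, (Matrix.of fun i j => y i ^ rectExp p n α j).det = ((s : ℤ) : A) *
      ((Matrix.vandermonde y).det *
        (toeplitz (∏ i, (Polynomial.X - Polynomial.C (y i))) p α).det) := by
  classical
  set q : Polynomial A := ∏ i, (Polynomial.X - Polynomial.C (y i)) with hq
  have hmonic : q.Monic := Polynomial.monic_prod_of_monic _ _ fun i _ => Polynomial.monic_X_sub_C _
  rcases subsingleton_or_nontrivial A with hA | hA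
  · exact ⟨1, Subsingleton.elim _ _⟩
  have hdeg : q.natDegree = p + n := by
    rw [hq, Polynomial.natDegree_prod_of_monic _ _ fun i _ => Polynomial.monic_X_sub_C _]
    simp
  let A₁ : Matrix (Fin (p + n) ⊕ Fin α) (Fin (p + n + α)) A :=
    Matrix.of fun r c => Sum.elim (fun i => y i ^ (c : ℕ))
      (fun a : Fin α => if (c : ℕ) = p + a then 1 else 0) r
  let B : Matrix (Fin (p + n + α)) (Fin (p + n) ⊕ Fin α) A :=
    Matrix.of fun c r => Sum.elim (fun j : Fin (p + n) => if (c : ℕ) = j then 1 else 0)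
      (fun b : Fin α => (Polynomial.X ^ (b : ℕ) * q).coeff c) r
  have hprod : A₁ * B = Matrix.fromBlocks (Matrix.vandermonde y) 0
      (Matrix.of fun (a : Fin α) (j : Fin (p + n)) => if (j : ℕ) = p + (a : ℕ) then 1 else 0)
      (toeplitz q p α) := by
    ext (i | a) (j | b)
    · rw [Matrix.mul_apply, Finset.sum_eq_single ⟨j, by omega⟩]
      · simp [A₁, B, Matrix.vandermonde]
      · intro c _ hc
        have : (c : ℕ) ≠ j := fun h => hc (Fin.ext h)
        simp [B, this]
      · simp
    · have hle : (Polynomial.X ^ (b : ℕ) * q).natDegree < p + n + α := by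
        rw [(Polynomial.monic_X_pow (b : ℕ)).natDegree_mul hmonic, Polynomial.natDegree_X_pow, hdeg]
        omega
      -- Multiples of `q` vanish at every `y i`; this is the zero block of the product.
      have h0 : (Polynomial.X ^ (b : ℕ) * q).eval (y i) = 0 := by
        rw [Polynomial.eval_mul, hq, Polynomial.eval_prod,
          Finset.prod_eq_zero (Finset.mem_univ i) (by simp), mul_zero]
      rw [Polynomial.eval_eq_sum_range' hle] at h0
      have h0 := (Fin.sum_univ_eq_sum_range
        (fun c : ℕ => (Polynomial.X ^ (b : ℕ) * q).coeff c * y i ^ c) _).trans h0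
      rw [Matrix.mul_apply, Matrix.fromBlocks_apply₁₂, Matrix.zero_apply, ← h0]
      refine Finset.sum_congr rfl fun c _ => ?_
      simp [A₁, B, mul_comm]
    · rw [Matrix.mul_apply, Finset.sum_eq_single ⟨j, by omega⟩]
      · simp [A₁, B]
      · intro c _ hc
        have : (c : ℕ) ≠ j := fun h => hc (Fin.ext h)
        simp [B, this]
      · simp
    · rw [Matrix.mul_apply, Finset.sum_eq_single ⟨p + a, by omega⟩]
      · simp [A₁, B, toeplitz]
      · intro c _ hc
        have : (c : ℕ) ≠ p + a := fun h => hc (Fin.ext h)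
        simp [A₁, this]
      · simp
  have hA₁ : A₁.submatrix id (rectEquiv p n α) = Matrix.fromBlocks
      (Matrix.of fun i j => y i ^ rectExp p n α j) (Matrix.of fun i (a : Fin α) => y i ^ (p + (a : ℕ)))
      0 1 := by
    ext (i | a) (j | b)
    · simp [A₁, rectEquiv]
    · simp [A₁, rectEquiv]
    · have : rectExp p n α j ≠ p + a := by
        rw [rectExp]
        split_ifs <;> omega
      simp [A₁, rectEquiv, this]
    · simp [A₁, rectEquiv, Matrix.one_apply, Fin.ext_iff, eq_comm]
  have hB : (B.submatrix finSumFinEquiv id).det = 1 := by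
    have : B.submatrix finSumFinEquiv id = Matrix.fromBlocks 1
        (Matrix.of fun (i : Fin (p + n)) (b : Fin α) => (Polynomial.X ^ (b : ℕ) * q).coeff i) 0
        (Matrix.of fun (a b : Fin α) => (Polynomial.X ^ (b : ℕ) * q).coeff (p + n + a)) := by
      ext (i | a) (j | b)
      · simp [B, Matrix.one_apply, Fin.ext_iff]
      · simp [B]
      · have : p + n + (a : ℕ) ≠ j := by omega
        simp [B, this]
      · simp [B]
    rw [this, Matrix.det_fromBlocks_zero₂₁, Matrix.det_one, one_mul, Matrix.det_of_isUpperTriangular]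
    · refine Finset.prod_eq_one fun a _ => ?_
      rw [Matrix.of_apply, Polynomial.coeff_X_pow_mul, ← hdeg]
      exact hmonic
    · intro a b hab
      have hab : (b : ℕ) < a := hab
      have hlt : (Polynomial.X ^ (b : ℕ) * q).natDegree < p + n + a := by
        rw [(Polynomial.monic_X_pow (b : ℕ)).natDegree_mul hmonic, Polynomial.natDegree_X_pow, hdeg]
        omega
      exact Polynomial.coeff_eq_zero_of_natDegree_lt hlt
  have hdet : (A₁.submatrix id finSumFinEquiv).det =
      (Matrix.vandermonde y).det * (toeplitz q p α).det := by
    have h := congrArg Matrix.det hprod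
    rw [Matrix.det_fromBlocks_zero₁₂, ← Matrix.submatrix_id_id (A₁ * B),
      ← Matrix.submatrix_mul_equiv A₁ B id finSumFinEquiv id, Matrix.det_mul, hB, mul_one] at h
    exact h
  have hperm : A₁.submatrix id (rectEquiv p n α) = (A₁.submatrix id finSumFinEquiv).submatrix id
      ((rectEquiv p n α).trans finSumFinEquiv.symm) := by
    ext r c
    simp
  refine ⟨Equiv.Perm.sign ((rectEquiv p n α).trans finSumFinEquiv.symm), ?_⟩
  rw [← hdet, ← Matrix.det_permute', ← hperm, hA₁, Matrix.det_fromBlocks_zero₂₁, Matrix.det_one,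
    mul_one]

/-- The moments of the determinant, up to a constant factor, are a Toeplitz determinant in the
elementary symmetric functions of the scales. -/
theorem exists_detMoment_eq (p n α : ℕ) :
    ∃ c : ℂ, detMoment (Fin (p + n)) (Fin n) α =
      c • (toeplitz (∏ i, (Polynomial.X + Polynomial.C (X i))) p α).det := by
  obtain ⟨c, hc⟩ := exists_vdm_mul_detMoment p n α
  -- The points are `-X i`, so that the coefficients of `q` are elementary symmetric functions
  -- without signs.
  obtain ⟨s, hs⟩ := exists_sign_bialternant p n α fun i => (-X i : MvPolynomial (Fin (p + n)) ℂ)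
  have hneg : ∀ l : Fin (p + n) → ℕ,
      (Matrix.of fun i j => (-X i : MvPolynomial (Fin (p + n)) ℂ) ^ l j).det =
        (∏ j, (-1) ^ l j) * altPoly l := by
    intro l
    rw [altPoly, ← Matrix.det_mul_row]
    congr 1
    ext1 i j
    simp only [Matrix.of_apply]
    rw [neg_pow]
  have hv : (Matrix.vandermonde fun i => (-X i : MvPolynomial (Fin (p + n)) ℂ)).det =
      (∏ j : Fin (p + n), (-1) ^ (j : ℕ)) * vdm (p + n) := hneg fun j => (j : ℕ)
  rw [hneg, hv] at hs
  have hsq : ∀ l : Fin (p + n) → ℕ, (∏ j, (-1 : MvPolynomial (Fin (p + n)) ℂ) ^ l j) *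
      ∏ j, (-1) ^ l j = 1 := by
    intro l
    rw [← Finset.prod_mul_distrib]
    refine Finset.prod_eq_one fun j _ => ?_
    rw [← mul_pow]
    simp
  have hcast : ∀ l : Fin (p + n) → ℕ, (∏ j, (-1 : MvPolynomial (Fin (p + n)) ℂ) ^ l j) =
      C (∏ j, (-1 : ℂ) ^ l j) := by
    intro l
    simp
  have hq : (∏ i, (Polynomial.X - Polynomial.C (-X i : MvPolynomial (Fin (p + n)) ℂ))) =
      ∏ i, (Polynomial.X + Polynomial.C (X i)) := by
    refine Finset.prod_congr rfl fun i _ => ?_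
    rw [map_neg, sub_neg_eq_add]
  rw [hq] at hs
  set T := (toeplitz (∏ i, (Polynomial.X + Polynomial.C (X i : MvPolynomial (Fin (p + n)) ℂ))) p
    α).det
  refine ⟨c * ((∏ j, (-1 : ℂ) ^ rectExp p n α j) * ((s : ℤ) : ℂ) *
    ∏ j : Fin (p + n), (-1 : ℂ) ^ (j : ℕ)), ?_⟩
  apply mul_left_cancel₀ vdm_ne_zero
  rw [hc]
  have h1 := congrArg ((∏ j, (-1 : MvPolynomial (Fin (p + n)) ℂ) ^ rectExp p n α j) * ·) hs
  simp only [← mul_assoc, hsq, one_mul] at h1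
  rw [h1, hcast, hcast, smul_eq_C_mul, smul_eq_C_mul]
  simp only [map_mul, map_intCast]
  ring

end Bialternant

/-! ### The standard complex Gaussian distribution -/

section Gaussian

/-- The standard complex Gaussian distribution on `ℂ`. -/
def stdGaussian : Measure ℂ :=
  volume.withDensity fun z => ENNReal.ofReal (Real.pi⁻¹ * Real.exp (-‖z‖ ^ 2))

lemma measurable_stdGaussian_density :
    Measurable fun z : ℂ => ENNReal.ofReal (Real.pi⁻¹ * Real.exp (-‖z‖ ^ 2)) := by
  fun_prop

lemma integrable_exp_neg_mul_norm_sq {b : ℝ} (hb : 0 < b) :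
    Integrable fun z : ℂ => Real.exp (-b * ‖z‖ ^ 2) := by
  have h := (GaussianFourier.integrable_cexp_neg_mul_sq_norm_add (V := ℂ) (b := (b : ℂ))
    (by simpa using hb) 0 0).norm
  refine h.congr (Eventually.of_forall fun z => ?_)
  simp [Complex.norm_exp, ← Complex.ofReal_pow]

/-- Half of the Gaussian decay absorbs the power, through one term of the exponential series at `r²
/ 2`. -/
lemma pow_mul_exp_le (k : ℕ) {r : ℝ} (hr : 0 ≤ r) :
    r ^ k * Real.exp (-r ^ 2) ≤ (1 + k.factorial * 2 ^ k) * Real.exp (-(1 / 2) * r ^ 2) := by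
  have h1 : r ^ k ≤ 1 + r ^ (2 * k) := by
    rcases le_total r 1 with h | h
    · have := pow_le_one₀ hr h (n := k)
      have := pow_nonneg hr (2 * k)
      linarith
    · have := pow_le_pow_right₀ h (show k ≤ 2 * k by omega)
      linarith
  have h2 : r ^ (2 * k) ≤ k.factorial * 2 ^ k * Real.exp (r ^ 2 / 2) := by
    have := Real.pow_div_factorial_le_exp (r ^ 2 / 2) (by positivity) k
    rw [div_le_iff₀ (by positivity), div_pow, div_le_iff₀ (by positivity)] at this
    rw [pow_mul]
    linarith
  have h3 : (1 : ℝ) ≤ Real.exp (r ^ 2 / 2) := Real.one_le_exp (by positivity)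
  have h4 : Real.exp (-(1 / 2) * r ^ 2) = Real.exp (r ^ 2 / 2) * Real.exp (-r ^ 2) := by
    rw [← Real.exp_add]
    congr 1
    ring
  rw [h4, ← mul_assoc]
  refine mul_le_mul_of_nonneg_right ?_ (Real.exp_pos _).le
  linarith

lemma integrable_pow_mul_exp (k : ℕ) : Integrable fun z : ℂ => ‖z‖ ^ k * Real.exp (-‖z‖ ^ 2) := by
  refine ((integrable_exp_neg_mul_norm_sq (b := 1 / 2) (by norm_num)).const_mul
    (1 + (k.factorial : ℝ) * 2 ^ k)).mono' (by fun_prop) (Eventually.of_forall fun z => ?_)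
  rw [Real.norm_of_nonneg (by positivity)]
  exact pow_mul_exp_le k (norm_nonneg z)

lemma integral_pow_mul_exp (a : ℕ) :
    ∫ z : ℂ, ‖z‖ ^ (2 * a) * Real.exp (-‖z‖ ^ 2) = Real.pi * a.factorial := by
  have h := Complex.integral_rpow_mul_exp_neg_rpow (p := 2) (q := 2 * a) (by norm_num) (by
    have : (0 : ℝ) ≤ a := a.cast_nonneg
    linarith)
  rw [show ((2 * a + 2 : ℝ) / 2) = a + 1 by ring, Real.Gamma_nat_eq_factorial] at h
  rw [show 2 * Real.pi / 2 = Real.pi by ring] at h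
  rw [← h]
  congr 1
  ext z
  norm_cast

instance : IsProbabilityMeasure stdGaussian := by
  refine ⟨?_⟩
  rw [stdGaussian, withDensity_apply _ MeasurableSet.univ, Measure.restrict_univ,
    ← ofReal_integral_eq_lintegral_ofReal]
  · rw [integral_const_mul]
    have := integral_pow_mul_exp 0
    simp only [mul_zero, pow_zero, one_mul, Nat.factorial_zero, Nat.cast_one, mul_one] at this
    rw [this, inv_mul_cancel₀ Real.pi_ne_zero, ENNReal.ofReal_one]
  · have := integrable_pow_mul_exp 0
    simp only [pow_zero, one_mul] at this
    exact this.const_mul _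
  · exact Eventually.of_forall fun z => by positivity

lemma integrable_stdGaussian_iff {f : ℂ → ℂ} :
    Integrable f stdGaussian ↔
      Integrable fun z => (Real.pi⁻¹ * Real.exp (-‖z‖ ^ 2)) • f z := by
  rw [stdGaussian, integrable_withDensity_iff_integrable_smul' measurable_stdGaussian_density
    (Eventually.of_forall fun z => ENNReal.ofReal_lt_top)]
  refine integrable_congr (Eventually.of_forall fun z => ?_)
  simp only
  rw [ENNReal.toReal_ofReal (by positivity)]

lemma integral_stdGaussian (f : ℂ → ℂ) :
    ∫ z, f z ∂stdGaussian = ∫ z, (Real.pi⁻¹ * Real.exp (-‖z‖ ^ 2)) • f z := by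
  rw [stdGaussian, integral_withDensity_eq_integral_toReal_smul measurable_stdGaussian_density
    (Eventually.of_forall fun z => ENNReal.ofReal_lt_top)]
  refine integral_congr_ae (Eventually.of_forall fun z => ?_)
  simp only
  rw [ENNReal.toReal_ofReal (by positivity)]

lemma integrable_stdGaussian_monomial (a b : ℕ) :
    Integrable (fun z : ℂ => z ^ a * conj z ^ b) stdGaussian := by
  rw [integrable_stdGaussian_iff]
  refine ((integrable_pow_mul_exp (a + b)).const_mul Real.pi⁻¹).mono' (by fun_prop)
    (Eventually.of_forall fun z => ?_)
  rw [norm_smul, Real.norm_of_nonneg (by positivity)]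
  simp only [norm_mul, norm_pow, RCLike.norm_conj]
  rw [← pow_add]
  apply le_of_eq
  ring

/-- For `a ≠ b` the rotation by `π / (a - b)` preserves the measure and changes the sign of the
integrand. For `a = b` the integral is radial, a Gamma value. -/
lemma integral_stdGaussian_monomial (a b : ℕ) :
    ∫ z, z ^ a * conj z ^ b ∂stdGaussian = if a = b then (a.factorial : ℂ) else 0 := by
  rw [integral_stdGaussian]
  split_ifs with h
  · subst h
    have h1 : ∀ z : ℂ, (Real.pi⁻¹ * Real.exp (-‖z‖ ^ 2)) • (z ^ a * conj z ^ a) =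
        ((Real.pi⁻¹ * (‖z‖ ^ (2 * a) * Real.exp (-‖z‖ ^ 2)) : ℝ) : ℂ) := by
      intro z
      rw [← mul_pow, Complex.mul_conj', Complex.real_smul]
      push_cast
      ring
    simp only [h1]
    rw [integral_complex_ofReal, integral_const_mul, integral_pow_mul_exp, ← mul_assoc,
      inv_mul_cancel₀ Real.pi_ne_zero, one_mul]
    simp
  · set f : ℂ → ℂ := fun z => (Real.pi⁻¹ * Real.exp (-‖z‖ ^ 2)) • (z ^ a * conj z ^ b) with hf
    have hne : ((a : ℝ) - b) ≠ 0 := by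
      rw [sub_ne_zero]
      exact_mod_cast h
    set θ : ℝ := Real.pi / (a - b) with hθ
    have hrot := ((rotation (Circle.exp θ)).measurePreserving).integral_comp
      (rotation (Circle.exp θ)).toHomeomorph.measurableEmbedding f
    have hneg : ∀ z, f (rotation (Circle.exp θ) z) = -f z := by
      intro z
      have hc : (Circle.exp θ : ℂ) ^ a * conj (Circle.exp θ : ℂ) ^ b = -1 := by
        rw [Circle.coe_exp, ← Complex.exp_conj, ← Complex.exp_nat_mul, ← Complex.exp_nat_mul,
          ← Complex.exp_add, ← Complex.exp_pi_mul_I]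
        congr 1
        simp only [map_mul, Complex.conj_ofReal, Complex.conj_I]
        have hne' : ((a : ℂ) - b) ≠ 0 := by exact_mod_cast hne
        rw [hθ]
        push_cast
        field_simp
        ring
      simp only [hf, rotation_apply, norm_mul, Circle.norm_coe, one_mul, map_mul, mul_pow]
      rw [show (Circle.exp θ : ℂ) ^ a * z ^ a * (conj (Circle.exp θ : ℂ) ^ b * conj z ^ b) =
        ((Circle.exp θ : ℂ) ^ a * conj (Circle.exp θ : ℂ) ^ b) * (z ^ a * conj z ^ b) by ring, hc,
        neg_one_mul, smul_neg]
    simp only [hneg, integral_neg] at hrot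
    linear_combination (-1 / 2 : ℂ) * hrot

end Gaussian

/-! ### Polynomial expectations -/

section PolyExpectation

variable {ι κ : Type*} [Fintype ι] [Fintype κ] [DecidableEq ι] [DecidableEq κ]

/-- The law of a matrix with independent standard complex Gaussian entries. -/
def gaussianMatrix (ι κ : Type*) [Fintype ι] [Fintype κ] : Measure (ι → κ → ℂ) :=
  Measure.pi fun _ => Measure.pi fun _ => stdGaussian

instance : IsProbabilityMeasure (gaussianMatrix ι κ) := by
  unfold gaussianMatrix; infer_instance

/-- The evaluation point attached to a matrix and a family of scales. -/
def evalPoint (z : ι → κ → ℂ) (t : ι → ℂ) : GVar ι κ → ℂ :=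
  Sum.elim (fun v => z v.1 v.2) (Sum.elim (fun v => conj (z v.1 v.2)) t)

lemma eval_monomial_evalPoint (z : ι → κ → ℂ) (t : ι → ℂ) (s : GVar ι κ →₀ ℕ) (c : ℂ) :
    eval (evalPoint z t) (monomial s c) = c * (∏ i, t i ^ s (Sum.inr (Sum.inr i))) *
      ∏ i, ∏ k, (z i k ^ s (Sum.inl (i, k)) * conj (z i k) ^ s (Sum.inr (Sum.inl (i, k)))) := by
  rw [eval_monomial, Finsupp.prod_fintype _ _ (by simp), Fintype.prod_sum_type,
    Fintype.prod_sum_type, Fintype.prod_prod_type, Fintype.prod_prod_type]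
  simp only [evalPoint, Sum.elim_inl, Sum.elim_inr, Finset.prod_mul_distrib]
  ring

lemma integrable_eval_evalPoint (t : ι → ℂ) (p : MvPolynomial (GVar ι κ) ℂ) :
    Integrable (fun z => eval (evalPoint z t) p) (gaussianMatrix ι κ) := by
  induction p using MvPolynomial.induction_on' with
  | add p q hp hq =>
    simp only [map_add]
    exact hp.add hq
  | monomial s c =>
    simp only [eval_monomial_evalPoint]
    refine Integrable.const_mul ?_ _
    exact Integrable.fintype_prod (f := fun (i : ι) (w : κ → ℂ) => ∏ k, (w k ^ s (Sum.inl (i, k)) *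
      conj (w k) ^ s (Sum.inr (Sum.inl (i, k))))) fun i =>
        Integrable.fintype_prod (f := fun (k : κ) (w : ℂ) => w ^ s (Sum.inl (i, k)) *
          conj w ^ s (Sum.inr (Sum.inl (i, k)))) fun k => integrable_stdGaussian_monomial _ _

/-- The Gaussian expectation of a polynomial is given by `wick`. -/
lemma integral_eval_evalPoint (t : ι → ℂ) (p : MvPolynomial (GVar ι κ) ℂ) :
    ∫ z, eval (evalPoint z t) p ∂gaussianMatrix ι κ = eval t (wick p) := by
  induction p using MvPolynomial.induction_on' with
  | add p q hp hq =>
    simp only [map_add]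
    rw [integral_add (integrable_eval_evalPoint t p) (integrable_eval_evalPoint t q), hp, hq]
  | monomial s c =>
    simp only [eval_monomial_evalPoint]
    rw [integral_const_mul, gaussianMatrix, integral_fintype_prod_eq_prod (𝕜 := ℂ)
      (f := fun (i : ι) (w : κ → ℂ) => ∏ k, (w k ^ s (Sum.inl (i, k)) *
      conj (w k) ^ s (Sum.inr (Sum.inl (i, k)))))]
    have h1 : ∀ i : ι, ∫ w : κ → ℂ, ∏ k, (w k ^ s (Sum.inl (i, k)) *
        conj (w k) ^ s (Sum.inr (Sum.inl (i, k)))) ∂(Measure.pi fun _ => stdGaussian) =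
        ∏ k, if s (Sum.inl (i, k)) = s (Sum.inr (Sum.inl (i, k))) then
          ((s (Sum.inl (i, k))).factorial : ℂ) else 0 := by
      intro i
      rw [integral_fintype_prod_eq_prod (𝕜 := ℂ) (f := fun (k : κ) (w : ℂ) =>
        w ^ s (Sum.inl (i, k)) * conj w ^ s (Sum.inr (Sum.inl (i, k))))]
      simp only [integral_stdGaussian_monomial]
    simp only [h1]
    rw [wick_monomial]
    split_ifs with h
    · rw [eval_monomial, Finsupp.prod_fintype _ _ (by simp), Fintype.prod_prod_type]
      simp only [h, if_true, scaleExp_apply]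
      ring
    · push Not at h
      obtain ⟨⟨i, k⟩, hv⟩ := h
      rw [map_zero]
      refine mul_eq_zero_of_right _ (Finset.prod_eq_zero (Finset.mem_univ i) ?_)
      exact Finset.prod_eq_zero (Finset.mem_univ k) (if_neg hv)

/-- The matrix `∑ᵢ tᵢ zᵢ zᵢ†`. -/
def scaledWishart (t : ι → ℂ) (z : ι → κ → ℂ) : Matrix κ κ ℂ :=
  ∑ i, t i • Matrix.vecMulVec (z i) (star (z i))

lemma eval_evalPoint_det_gram (z : ι → κ → ℂ) (t : ι → ℂ) :
    eval (evalPoint z t) (gram ι κ).det = (scaledWishart t z).det := by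
  rw [RingHom.map_det]
  congr 1
  ext k l
  rw [RingHom.mapMatrix_apply, Matrix.map_apply, gram_apply, map_sum, scaledWishart,
    Matrix.sum_apply]
  refine Finset.sum_congr rfl fun i _ => ?_
  simp [tvar, gvar, hvar, evalPoint, Matrix.vecMulVec_apply]

lemma integral_det_scaledWishart_pow (t : ι → ℂ) (α : ℕ) :
    ∫ z, (scaledWishart t z).det ^ α ∂gaussianMatrix ι κ = eval t (detMoment ι κ α) := by
  rw [detMoment, ← integral_eval_evalPoint]
  simp only [map_pow, eval_evalPoint_det_gram]

lemma integrable_det_scaledWishart_pow (t : ι → ℂ) (α : ℕ) :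
    Integrable (fun z => (scaledWishart t z).det ^ α) (gaussianMatrix ι κ) := by
  have h := integrable_eval_evalPoint t ((gram ι κ).det ^ α)
  simpa only [map_pow, eval_evalPoint_det_gram] using h

end PolyExpectation

end Moments

/-! ### Gaussian integrals on `ℂⁿ` -/

section GaussianVector

open Matrix

variable {κ : Type*} [Fintype κ] [DecidableEq κ]

lemma pi_withDensity_ofReal {E : Type*} [MeasurableSpace E] (ν : Measure E) [SigmaFinite ν]
    {g : E → ℝ} (hg : Integrable g ν) (h0 : ∀ x, 0 ≤ g x) :
    (Measure.pi fun _ : κ => ν.withDensity fun x => ENNReal.ofReal (g x)) =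
      (Measure.pi fun _ => ν).withDensity fun x => ENNReal.ofReal (∏ k, g (x k)) := by
  have := isFiniteMeasure_withDensity_ofReal hg.2
  refine Measure.pi_eq fun s hs => ?_
  have hgs : ∀ k, Integrable ((s k).indicator g) ν := fun k => hg.indicator (hs k)
  have hpos : ∀ k z, 0 ≤ (s k).indicator g z := fun k z => Set.indicator_nonneg (fun z _ => h0 z) z
  have h1 : ∀ k, ν.withDensity (fun x => ENNReal.ofReal (g x)) (s k) =
      ENNReal.ofReal (∫ z, (s k).indicator g z ∂ν) := by
    intro k
    rw [ofReal_integral_eq_lintegral_ofReal (hgs k) (Eventually.of_forall (hpos k)),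
      withDensity_apply _ (hs k), ← lintegral_indicator (hs k)]
    congr 1
    ext z
    by_cases hz : z ∈ s k <;> simp [hz]
  simp only [h1]
  rw [← ENNReal.ofReal_prod_of_nonneg fun k _ => integral_nonneg (hpos k),
    ← integral_fintype_prod_eq_prod, ofReal_integral_eq_lintegral_ofReal
      (Integrable.fintype_prod hgs)
      (Eventually.of_forall fun z => Finset.prod_nonneg fun k _ => hpos k _),
    withDensity_apply _ (MeasurableSet.univ_pi hs), ← lintegral_indicator (MeasurableSet.univ_pi hs)]
  congr 1
  ext z
  by_cases hz : z ∈ Set.univ.pi s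
  · rw [Set.indicator_of_mem hz]
    congr 1
    exact Finset.prod_congr rfl fun k _ => (Set.indicator_of_mem (hz k (Set.mem_univ k)) _).symm
  · rw [Set.indicator_of_notMem hz]
    obtain ⟨k, hk⟩ : ∃ k, z k ∉ s k := by simpa [Set.mem_pi] using hz
    rw [Finset.prod_eq_zero (Finset.mem_univ k) (Set.indicator_of_notMem hk _), ENNReal.ofReal_zero]

lemma integrable_stdGaussian_density :
    Integrable fun z : ℂ => Real.pi⁻¹ * Real.exp (-‖z‖ ^ 2) :=
  (by simpa using integrable_pow_mul_exp 0 :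
    Integrable fun z : ℂ => Real.exp (-‖z‖ ^ 2)).const_mul _

lemma pi_stdGaussian : (Measure.pi fun _ : κ => stdGaussian) =
    volume.withDensity fun z : κ → ℂ =>
      ENNReal.ofReal ((Real.pi ^ Fintype.card κ)⁻¹ * Real.exp (-∑ k, ‖z k‖ ^ 2)) := by
  unfold stdGaussian
  rw [pi_withDensity_ofReal volume integrable_stdGaussian_density fun z => by positivity,
    ← volume_pi]
  congr 1
  ext z
  rw [Finset.prod_mul_distrib, Finset.prod_const, ← Real.exp_sum, Finset.card_univ, inv_pow,
    Finset.sum_neg_distrib]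

lemma gaussianMatrix_eq_withDensity (ι : Type*) [Fintype ι] [DecidableEq ι] : gaussianMatrix ι κ =
    volume.withDensity fun z : ι → κ → ℂ => ENNReal.ofReal
      ((Real.pi ^ (Fintype.card ι * Fintype.card κ))⁻¹ * Real.exp (-∑ i, ∑ k, ‖z i k‖ ^ 2)) := by
  have hint : Integrable fun z : κ → ℂ =>
      (Real.pi ^ Fintype.card κ)⁻¹ * Real.exp (-∑ k, ‖z k‖ ^ 2) := by
    have h := Integrable.fintype_prod (ι := κ)
      (f := fun _ z => Real.pi⁻¹ * Real.exp (-‖z‖ ^ 2)) fun _ => integrable_stdGaussian_density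
    refine h.congr (Eventually.of_forall fun z => ?_)
    simp only
    rw [Finset.prod_mul_distrib, Finset.prod_const, ← Real.exp_sum, Finset.card_univ, inv_pow,
      Finset.sum_neg_distrib]
  unfold gaussianMatrix
  rw [pi_stdGaussian, pi_withDensity_ofReal volume hint fun z => by positivity, ← volume_pi]
  congr 1
  ext z
  rw [Finset.prod_mul_distrib, Finset.prod_const, ← Real.exp_sum, Finset.card_univ, inv_pow,
    Finset.sum_neg_distrib, ← pow_mul, mul_comm (Fintype.card κ)]

/-- The real determinant of a complex linear map is the squared modulus of its complex determinant.
-/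
lemma lintegral_comp_mulVec {B : Matrix κ κ ℂ} (hB : B.det ≠ 0) {f : (κ → ℂ) → ENNReal}
    (hf : Measurable f) :
    ∫⁻ z, f (B *ᵥ z) = ENNReal.ofReal ((‖B.det‖ ^ 2)⁻¹) * ∫⁻ z, f z := by
  set F : (κ → ℂ) →ₗ[ℝ] (κ → ℂ) := (Matrix.toLin' B).restrictScalars ℝ with hF
  have hdet : LinearMap.det F = ‖B.det‖ ^ 2 := by
    rw [hF, LinearMap.det_restrictScalars, LinearMap.det_toLin', Algebra.norm_complex_eq]
    exact Complex.normSq_eq_norm_sq _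
  have hne : LinearMap.det F ≠ 0 := by rw [hdet]; positivity
  have h := Measure.map_linearMap_addHaar_eq_smul_addHaar (volume : Measure (κ → ℂ)) hne
  have hFm : Measurable F := F.continuous_of_finiteDimensional.measurable
  have h2 : ∫⁻ z, f (B *ᵥ z) = ∫⁻ z, f z ∂(volume.map F) := by
    rw [lintegral_map hf hFm]
    simp [hF]
  rw [h2, h, lintegral_smul_measure, hdet, abs_of_nonneg (by positivity), smul_eq_mul]

/-- The matrix is `Q^(-1/2)`, kept in diagonalised form because the Jacobian of its congruence
action is read off from `U` and `d`. -/
lemma exists_normalizing_matrix {Q : Matrix κ κ ℂ} (hQ : Q.PosDef) :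
    ∃ (U : Matrix κ κ ℂ) (d : κ → ℝ), Uᴴ * U = 1 ∧ U * Uᴴ = 1 ∧ (∀ k, 0 < d k) ∧
      (U * diagonal (fun k => (d k : ℂ)) * Uᴴ)ᴴ * Q * (U * diagonal (fun k => (d k : ℂ)) * Uᴴ) = 1 ∧
      (∏ k, d k) ^ 2 = (Q.det.re)⁻¹ := by
  set V := hQ.1.eigenvectorUnitary
  set e := hQ.1.eigenvalues
  have he : ∀ k, 0 < e k := hQ.eigenvalues_pos
  have hV1 : (V : Matrix κ κ ℂ)ᴴ * V = 1 := Unitary.coe_star_mul_self V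
  have hV2 : (V : Matrix κ κ ℂ) * (V : Matrix κ κ ℂ)ᴴ = 1 := Unitary.coe_mul_star_self V
  refine ⟨V, fun k => (Real.sqrt (e k))⁻¹, hV1, hV2, fun k => by have := he k; positivity, ?_, ?_⟩
  · have hs : Q = (V : Matrix κ κ ℂ) * diagonal (fun k => (e k : ℂ)) * (V : Matrix κ κ ℂ)ᴴ := by
      have := hQ.1.spectral_theorem
      rwa [Unitary.conjStarAlgAut_apply] at this
    have hd : (diagonal fun k => (((Real.sqrt (e k))⁻¹ : ℝ) : ℂ)) * diagonal (fun k => (e k : ℂ)) *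
        diagonal (fun k => (((Real.sqrt (e k))⁻¹ : ℝ) : ℂ)) = 1 := by
      rw [diagonal_mul_diagonal, diagonal_mul_diagonal, ← diagonal_one]
      congr 1
      ext k
      rw [← Complex.ofReal_mul, ← Complex.ofReal_mul, ← Complex.ofReal_one]
      congr 1
      have h0 := Real.sqrt_pos.2 (he k)
      have h1 := Real.mul_self_sqrt (he k).le
      field_simp
      nlinarith
    have hdH : (diagonal fun k => (((Real.sqrt (e k))⁻¹ : ℝ) : ℂ))ᴴ =
        diagonal fun k => (((Real.sqrt (e k))⁻¹ : ℝ) : ℂ) := by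
      rw [diagonal_conjTranspose]
      congr 1
      ext k
      simp
    set D := diagonal fun k => (((Real.sqrt (e k))⁻¹ : ℝ) : ℂ)
    set E := diagonal fun k => (e k : ℂ)
    rw [hs]
    rw [conjTranspose_mul, conjTranspose_mul, conjTranspose_conjTranspose, hdH]
    calc _ = (V : Matrix κ κ ℂ) * (D * ((V : Matrix κ κ ℂ)ᴴ * V) * E * ((V : Matrix κ κ ℂ)ᴴ * V) * D) *
          (V : Matrix κ κ ℂ)ᴴ := by noncomm_ring
      _ = 1 := by rw [hV1, mul_one, mul_one, hd, mul_one, hV2]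
  · have : Q.det.re = ∏ k, e k := by
      rw [hQ.1.det_eq_prod_eigenvalues]
      norm_cast
    rw [this, ← Finset.prod_pow, ← Finset.prod_inv_distrib]
    refine Finset.prod_congr rfl fun k _ => ?_
    rw [inv_pow, Real.sq_sqrt (he k).le]

lemma norm_det_sq_of_conjTranspose_mul_mul {Q B : Matrix κ κ ℂ} (hQ : Q.PosDef)
    (h : Bᴴ * Q * B = 1) : ‖B.det‖ ^ 2 = (Q.det.re)⁻¹ := by
  have h1 := congrArg det h
  have hp := hQ.det_pos
  rw [det_mul, det_mul, det_conjTranspose, det_one] at h1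
  have h2 : Q.det = (Q.det.re : ℂ) := by
    rw [Complex.pos_iff] at hp
    exact Complex.ext rfl (by simpa using hp.2.symm)
  have h3 : star B.det * B.det = ((‖B.det‖ ^ 2 : ℝ) : ℂ) := by
    rw [Complex.star_def, ← Complex.normSq_eq_conj_mul_self, Complex.normSq_eq_norm_sq]
  have h4 : ((‖B.det‖ ^ 2 * Q.det.re : ℝ) : ℂ) = ((1 : ℝ) : ℂ) := by
    rw [Complex.ofReal_mul, ← h3, ← h2, Complex.ofReal_one, ← h1]
    ring
  exact eq_inv_of_mul_eq_one_left (Complex.ofReal_injective h4)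

lemma exists_conjTranspose_mul_mul_eq_one {Q : Matrix κ κ ℂ} (hQ : Q.PosDef) :
    ∃ B : Matrix κ κ ℂ, Bᴴ * Q * B = 1 ∧ B.det ≠ 0 := by
  obtain ⟨U, d, -, -, -, h, -⟩ := exists_normalizing_matrix hQ
  refine ⟨_, h, fun h0 => ?_⟩
  have := congrArg det h
  rw [det_mul, h0] at this
  simp at this

lemma re_star_dotProduct_self (z : κ → ℂ) : (star z ⬝ᵥ z).re = ∑ k, ‖z k‖ ^ 2 := by
  simp only [dotProduct, Complex.re_sum]
  refine Finset.sum_congr rfl fun k _ => ?_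
  rw [Pi.star_apply, Complex.star_def, ← Complex.normSq_eq_conj_mul_self, Complex.ofReal_re,
    Complex.normSq_eq_norm_sq]

lemma star_mulVec_dotProduct {Q B : Matrix κ κ ℂ} (h : Bᴴ * Q * B = 1) (z : κ → ℂ) :
    star (B *ᵥ z) ⬝ᵥ (Q *ᵥ (B *ᵥ z)) = star z ⬝ᵥ z := by
  rw [star_mulVec, ← dotProduct_mulVec, mulVec_mulVec, mulVec_mulVec, h,
    one_mulVec]

lemma measurable_quadForm (Q : Matrix κ κ ℂ) :
    Measurable fun z : κ → ℂ => (star z ⬝ᵥ Q *ᵥ z).re := by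
  refine Continuous.measurable ?_
  fun_prop

lemma lintegral_exp_neg_quadForm {Q : Matrix κ κ ℂ} (hQ : Q.PosDef) :
    ∫⁻ z : κ → ℂ, ENNReal.ofReal (Real.exp (-(star z ⬝ᵥ Q *ᵥ z).re)) =
      ENNReal.ofReal (Real.pi ^ Fintype.card κ * (Q.det.re)⁻¹) := by
  obtain ⟨B, hB, hdet⟩ := exists_conjTranspose_mul_mul_eq_one hQ
  have h := lintegral_comp_mulVec hdet
    (f := fun z => ENNReal.ofReal (Real.exp (-(star z ⬝ᵥ Q *ᵥ z).re)))
    (Real.measurable_exp.comp (measurable_quadForm Q).neg).ennreal_ofReal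
  simp only [star_mulVec_dotProduct hB, re_star_dotProduct_self,
    norm_det_sq_of_conjTranspose_mul_mul hQ hB, inv_inv] at h
  have h1 : ∫⁻ z : κ → ℂ, ENNReal.ofReal (Real.exp (-∑ k, ‖z k‖ ^ 2)) =
      ENNReal.ofReal (Real.pi ^ Fintype.card κ) := by
    have h2 : (Measure.pi fun _ : κ => stdGaussian) Set.univ = 1 := measure_univ
    rw [pi_stdGaussian, withDensity_apply _ MeasurableSet.univ, Measure.restrict_univ] at h2
    simp only [ENNReal.ofReal_mul (inv_nonneg.2 (pow_nonneg Real.pi_pos.le (Fintype.card κ)))] at h2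
    rw [lintegral_const_mul _ (by fun_prop)] at h2
    rw [← one_mul (lintegral _ _), ← ENNReal.ofReal_one,
      ← mul_inv_cancel₀ (pow_pos Real.pi_pos (Fintype.card κ)).ne',
      ENNReal.ofReal_mul (by positivity), mul_assoc, h2, mul_one]
  have hp : 0 < Q.det.re := (Complex.pos_iff.1 hQ.det_pos).1
  rw [h1] at h
  rw [← one_mul (lintegral _ _), ← ENNReal.ofReal_one, ← inv_mul_cancel₀ hp.ne',
      ENNReal.ofReal_mul (by positivity), mul_assoc, ← h, ← ENNReal.ofReal_mul (by positivity),
      mul_comm]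

/-- Choose `B` with `B† S⁻¹ B = 1`: the quadratic form becomes the squared norm, and `|det B|² = det
S` matches the normalising constants. -/
lemma complexGaussian_eq_map {n : ℕ} {S : Matrix (Fin n) (Fin n) ℂ} (hS : S.PosDef) :
    ∃ B : Matrix (Fin n) (Fin n) ℂ, B.det ≠ 0 ∧
      complexGaussian S = (Measure.pi fun _ => stdGaussian).map (B *ᵥ ·) := by
  obtain ⟨B, hB, hdet⟩ := exists_conjTranspose_mul_mul_eq_one hS.inv
  have hBm : Measurable fun z => B *ᵥ z := Continuous.measurable (by fun_prop)
  refine ⟨B, hdet, ?_⟩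
  ext s hs
  rw [Measure.map_apply hBm hs, pi_stdGaussian, complexGaussian, withDensity_apply _ hs,
    withDensity_apply _ (hBm hs), ← lintegral_indicator hs, ← lintegral_indicator (hBm hs)]
  have hm : Measurable fun z : Fin n → ℂ => ENNReal.ofReal
      ((Real.pi ^ n)⁻¹ * Real.exp (-(star z ⬝ᵥ S⁻¹ *ᵥ z).re)) :=
    ((Real.measurable_exp.comp (measurable_quadForm S⁻¹).neg).const_mul _).ennreal_ofReal
  have h := lintegral_comp_mulVec hdet (hm.indicator hs)
  have hdS : 0 < S.det.re := (Complex.pos_iff.1 hS.det_pos).1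
  have hinv : (S⁻¹).det.re = (S.det.re)⁻¹ := by
    have h2 : S.det = (S.det.re : ℂ) := by
      have hp := Complex.pos_iff.1 hS.det_pos
      exact Complex.ext rfl (by simpa using hp.2.symm)
    rw [det_nonsing_inv, Ring.inverse_eq_inv', h2, ← Complex.ofReal_inv, Complex.ofReal_re,
      Complex.ofReal_re]
  rw [norm_det_sq_of_conjTranspose_mul_mul hS.inv hB, hinv, inv_inv,
    ← lintegral_const_mul _ (hm.indicator hs)] at h
  refine Eq.trans (lintegral_congr fun z => ?_) (h.symm.trans (lintegral_congr fun z => ?_))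
  · by_cases hz : z ∈ s
    · simp only [Set.indicator_of_mem hz]
      rw [← ENNReal.ofReal_mul (by positivity), mul_inv]
      congr 1
      ring
    · simp [Set.indicator_of_notMem hz]
  · by_cases hz : B *ᵥ z ∈ s
    · rw [Set.indicator_of_mem hz, Set.indicator_of_mem (a := z) hz, star_mulVec_dotProduct hB,
        re_star_dotProduct_self, Fintype.card_fin]
    · rw [Set.indicator_of_notMem hz, Set.indicator_of_notMem (a := z) hz]

end GaussianVector

/-! ### Real coordinates on Hermitian matrices -/

section Hermitian

open Matrix

variable {κ : Type*}

/-- The Hermitian matrix with coordinates `x`. -/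
def herm (x : κ → κ → ℝ) : Matrix κ κ ℂ :=
  of fun i j => (((x i j + x j i) / 2 : ℝ) : ℂ) + (((x i j - x j i) / 2 : ℝ) : ℂ) * Complex.I

/-- The coordinates of a Hermitian matrix. -/
def hermCoord (A : Matrix κ κ ℂ) : κ → κ → ℝ := fun i j => (A i j).re + (A i j).im

lemma herm_re (x : κ → κ → ℝ) (i j : κ) : (herm x i j).re = (x i j + x j i) / 2 := by
  simp [herm]

lemma herm_im (x : κ → κ → ℝ) (i j : κ) : (herm x i j).im = (x i j - x j i) / 2 := by
  simp [herm]

lemma isHermitian_herm (x : κ → κ → ℝ) : (herm x).IsHermitian := by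
  ext i j
  rw [conjTranspose_apply]
  apply Complex.ext
  · simp only [Complex.star_def, Complex.conj_re, herm_re]; ring
  · simp only [Complex.star_def, Complex.conj_im, herm_im]; ring

lemma hermCoord_herm (x : κ → κ → ℝ) : hermCoord (herm x) = x := by
  ext i j
  rw [hermCoord, herm_re, herm_im]
  ring

lemma herm_hermCoord {A : Matrix κ κ ℂ} (hA : A.IsHermitian) : herm (hermCoord A) = A := by
  ext i j
  have h := hA.apply j i
  rw [Complex.star_def] at h
  apply Complex.ext
  · rw [herm_re, hermCoord, hermCoord, ← h, Complex.conj_re, Complex.conj_im]; ring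
  · rw [herm_im, hermCoord, hermCoord, ← h, Complex.conj_re, Complex.conj_im]; ring

lemma herm_add (x y : κ → κ → ℝ) : herm (x + y) = herm x + herm y := by
  ext i j
  apply Complex.ext <;> simp only [Matrix.add_apply, Complex.add_re, Complex.add_im, herm_re,
    herm_im, Pi.add_apply] <;> ring

lemma herm_smul (c : ℝ) (x : κ → κ → ℝ) : herm (c • x) = (c : ℂ) • herm x := by
  ext i j
  apply Complex.ext <;> simp [herm_re, herm_im] <;> ring

lemma hermCoord_add (A B : Matrix κ κ ℂ) : hermCoord (A + B) = hermCoord A + hermCoord B := by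
  ext i j
  simp only [hermCoord, Matrix.add_apply, Complex.add_re, Complex.add_im, Pi.add_apply]
  ring

lemma hermCoord_smul (c : ℝ) (A : Matrix κ κ ℂ) : hermCoord ((c : ℂ) • A) = c • hermCoord A := by
  ext i j
  simp [hermCoord]
  ring

lemma continuous_herm : Continuous (herm : (κ → κ → ℝ) → Matrix κ κ ℂ) := by
  unfold herm
  fun_prop

lemma continuous_hermCoord : Continuous (hermCoord : Matrix κ κ ℂ → (κ → κ → ℝ)) := by
  unfold hermCoord
  refine continuous_pi fun i => continuous_pi fun j => ?_
  have : Continuous fun A : Matrix κ κ ℂ => A i j := by fun_prop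
  fun_prop

variable [Fintype κ]

/-- Purpose of the coordinates: the trace pairing becomes the standard inner product, so every
linear functional is a trace against a Hermitian matrix and Laplace transforms can be written with
traces. -/
lemma re_trace_herm_mul_herm (x y : κ → κ → ℝ) :
    (herm x * herm y).trace.re = ∑ i, ∑ j, x i j * y i j := by
  have h1 : (herm x * herm y).trace.re =
      ∑ i, ∑ j, (x i j * y i j + x j i * y j i) / 2 := by
    rw [trace, Complex.re_sum]
    refine Finset.sum_congr rfl fun i _ => ?_
    rw [diag_apply, mul_apply, Complex.re_sum]
    refine Finset.sum_congr rfl fun j _ => ?_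
    rw [Complex.mul_re, herm_re, herm_re, herm_im, herm_im]
    ring
  have h2 : ∑ i, ∑ j, x j i * y j i = ∑ i, ∑ j, x i j * y i j := Finset.sum_comm
  rw [h1]
  simp only [add_div, Finset.sum_add_distrib, ← Finset.sum_div]
  rw [h2]
  ring

/-- The congruence action `X ↦ B X B†` in coordinates. -/
def hermCongr (B : Matrix κ κ ℂ) : (κ → κ → ℝ) →ₗ[ℝ] (κ → κ → ℝ) where
  toFun x := hermCoord (B * herm x * Bᴴ)
  map_add' x y := by rw [herm_add, Matrix.mul_add, Matrix.add_mul, hermCoord_add]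
  map_smul' c x := by
    rw [herm_smul, Matrix.mul_smul, Matrix.smul_mul, hermCoord_smul, RingHom.id_apply]

lemma herm_hermCongr (B : Matrix κ κ ℂ) (x : κ → κ → ℝ) :
    herm (hermCongr B x) = B * herm x * Bᴴ := by
  refine herm_hermCoord ?_
  rw [IsHermitian, conjTranspose_mul, conjTranspose_mul, conjTranspose_conjTranspose,
    (isHermitian_herm x).eq, Matrix.mul_assoc]

lemma hermCongr_mul (B C : Matrix κ κ ℂ) : hermCongr (B * C) = hermCongr B ∘ₗ hermCongr C := by
  ext1 x
  rw [LinearMap.comp_apply, ← hermCoord_herm (hermCongr (B * C) x),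
    ← hermCoord_herm (hermCongr B (hermCongr C x))]
  simp only [herm_hermCongr, conjTranspose_mul, Matrix.mul_assoc]

variable [DecidableEq κ]

lemma hermCongr_one : hermCongr (1 : Matrix κ κ ℂ) = LinearMap.id := by
  refine LinearMap.ext fun x => ?_
  rw [← hermCoord_herm (hermCongr 1 x), herm_hermCongr]
  simp [hermCoord_herm]

/-- The congruence multiplies coordinate `(i, j)` by `dᵢ dⱼ`, so each `dₖ` occurs `2n` times in the
product. -/
lemma det_hermCongr_diagonal (d : κ → ℝ) :
    LinearMap.det (hermCongr (diagonal fun k => (d k : ℂ))) =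
      (∏ k, d k) ^ (2 * Fintype.card κ) := by
  have h : hermCongr (diagonal fun k => (d k : ℂ)) =
      LinearMap.pi fun i => (LinearMap.pi fun j => ((d i * d j) • LinearMap.id :
        ℝ →ₗ[ℝ] ℝ).comp (LinearMap.proj j)).comp (LinearMap.proj i) := by
    refine LinearMap.ext fun x => ?_
    ext i j
    have : hermCongr (diagonal fun k => (d k : ℂ)) x i j =
        (((diagonal fun k => (d k : ℂ)) * herm x * (diagonal fun k => (d k : ℂ))ᴴ) i j).re +
        (((diagonal fun k => (d k : ℂ)) * herm x * (diagonal fun k => (d k : ℂ))ᴴ) i j).im := rfl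
    rw [this, diagonal_conjTranspose, mul_diagonal, diagonal_mul]
    simp only [Pi.star_apply, Complex.star_def, Complex.conj_ofReal, Complex.mul_re, Complex.mul_im,
      Complex.ofReal_re, Complex.ofReal_im, herm_re, herm_im, LinearMap.pi_apply,
      LinearMap.comp_apply, LinearMap.proj_apply, LinearMap.smul_apply, LinearMap.id_apply,
      smul_eq_mul]
    ring
  rw [h, LinearMap.det_pi]
  simp only [LinearMap.det_pi, LinearMap.det_smul, Module.finrank_self, LinearMap.det_id, pow_one,
    mul_one]
  simp only [Finset.prod_mul_distrib, Finset.prod_const, Finset.card_univ, Finset.prod_pow]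
  ring

lemma det_hermCongr_conj {U D : Matrix κ κ ℂ} (hU : U * Uᴴ = 1) :
    LinearMap.det (hermCongr (U * D * Uᴴ)) = LinearMap.det (hermCongr D) := by
  rw [hermCongr_mul, hermCongr_mul, LinearMap.det_comp, LinearMap.det_comp, mul_right_comm,
    ← LinearMap.det_comp, ← hermCongr_mul, hU, hermCongr_one, LinearMap.det_id, one_mul]

/-! ### Integrals over the cone of positive definite matrices. -/

lemma lintegral_comp_linearMap {E : Type*} [NormedAddCommGroup E] [NormedSpace ℝ E]
    [FiniteDimensional ℝ E] [MeasurableSpace E] [BorelSpace E] (ν : Measure E)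
    [ν.IsAddHaarMeasure] {F : E →ₗ[ℝ] E} (hF : LinearMap.det F ≠ 0) {f : E → ENNReal}
    (hf : Measurable f) :
    ∫⁻ x, f (F x) ∂ν = ENNReal.ofReal |(LinearMap.det F)⁻¹| * ∫⁻ x, f x ∂ν := by
  rw [← lintegral_map hf F.continuous_of_finiteDimensional.measurable,
    Measure.map_linearMap_addHaar_eq_smul_addHaar ν hF, lintegral_smul_measure, smul_eq_mul]

/-- The cone of positive definite matrices, in coordinates. -/
def pdCone (κ : Type*) [Fintype κ] : Set (κ → κ → ℝ) := {x | (herm x).PosDef}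

lemma measurableSet_pdCone : MeasurableSet (pdCone κ) := by
  have h : pdCone κ = {x | (herm x).PosSemidef} ∩ {x | (herm x).det ≠ 0} := by
    ext x
    exact ⟨fun h => ⟨h.posSemidef, h.det_pos.ne'⟩,
      fun h => h.1.posDef_iff_det_ne_zero.2 h.2⟩
  rw [h]
  refine MeasurableSet.inter (IsClosed.measurableSet ?_) (IsOpen.measurableSet ?_)
  · have h2 : {x : κ → κ → ℝ | (herm x).PosSemidef} =
        ⋂ z : κ → ℂ, {x | 0 ≤ star z ⬝ᵥ (herm x *ᵥ z)} := by
      ext x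
      simp only [Set.mem_ofPred_eq, Set.mem_iInter]
      exact ⟨fun h z => h.dotProduct_mulVec_nonneg z,
        fun h => PosSemidef.of_dotProduct_mulVec_nonneg (isHermitian_herm x) h⟩
    rw [h2]
    refine isClosed_iInter fun z => isClosed_le continuous_const ?_
    have := continuous_herm (κ := κ)
    fun_prop
  · exact isOpen_ne_fun (continuous_herm.matrix_det) continuous_const

/-- The density `det(X)^α exp(-tr(X A))` on the cone of positive definite matrices. -/
def coneDensity (α : ℕ) (A : Matrix κ κ ℂ) : (κ → κ → ℝ) → ENNReal :=
  (pdCone κ).indicator fun x =>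
    ENNReal.ofReal ((herm x).det.re ^ α * Real.exp (-(herm x * A).trace.re))

lemma measurable_coneDensity (α : ℕ) (A : Matrix κ κ ℂ) : Measurable (coneDensity α A) := by
  refine Measurable.indicator ?_ measurableSet_pdCone
  have h1 : Continuous fun x : κ → κ → ℝ => (herm x).det := continuous_herm.matrix_det
  have h2 : Continuous fun x : κ → κ → ℝ => (herm x * A).trace :=
    (continuous_herm.matrix_mul continuous_const).matrix_trace
  refine Measurable.ennreal_ofReal (Continuous.measurable ?_)
  exact ((Complex.continuous_re.comp h1).pow α).mul
    (Real.continuous_exp.comp (Complex.continuous_re.comp h2).neg)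

lemma re_det_pos {A : Matrix κ κ ℂ} (hA : A.PosDef) : 0 < A.det.re :=
  (Complex.pos_iff.1 hA.det_pos).1

lemma ofReal_re_det {A : Matrix κ κ ℂ} (hA : A.IsHermitian) : (A.det.re : ℂ) = A.det := by
  rw [hA.det_eq_prod_eigenvalues]
  norm_cast

/-- Substitute `X ↦ B X B†` with `B† A B = 1`: the Jacobian gives `det(A)^(-n)` and the factor
`det(X)^α` gives `det(A)^(-α)`. -/
lemma lintegral_coneDensity (α : ℕ) {A : Matrix κ κ ℂ} (hA : A.PosDef) :
    ∫⁻ x, coneDensity α A x =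
      ENNReal.ofReal ((A.det.re ^ (Fintype.card κ + α))⁻¹) * ∫⁻ x, coneDensity (κ := κ) α 1 x := by
  obtain ⟨U, d, -, hU, hd, hB, hprod⟩ := exists_normalizing_matrix hA
  set B := U * diagonal (fun k => (d k : ℂ)) * Uᴴ with hBdef
  have hdA := re_det_pos hA
  have hdet : LinearMap.det (hermCongr B) = (A.det.re ^ Fintype.card κ)⁻¹ := by
    rw [hBdef, det_hermCongr_conj hU, det_hermCongr_diagonal, pow_mul, hprod, inv_pow]
  have hne : LinearMap.det (hermCongr B) ≠ 0 := by rw [hdet]; positivity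
  have h := lintegral_comp_linearMap (volume : Measure (κ → κ → ℝ)) hne (measurable_coneDensity α A)
  have hBu : IsUnit B := by
    rw [isUnit_iff_isUnit_det, isUnit_iff_ne_zero]
    intro h0
    have := congrArg det hB
    rw [det_mul, h0] at this
    simp at this
  have hnorm := norm_det_sq_of_conjTranspose_mul_mul hA hB
  have key : ∀ x, coneDensity α A (hermCongr B x) =
      ENNReal.ofReal ((A.det.re ^ α)⁻¹) * coneDensity α 1 x := by
    intro x
    have hpd : hermCongr B x ∈ pdCone κ ↔ x ∈ pdCone κ := by
      rw [pdCone, Set.mem_ofPred_eq, herm_hermCongr]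
      exact hBu.posDef_star_right_conjugate_iff
    by_cases hx : x ∈ pdCone κ
    · rw [coneDensity, coneDensity, Set.indicator_of_mem (hpd.2 hx), Set.indicator_of_mem hx,
        ← ENNReal.ofReal_mul (by positivity), herm_hermCongr]
      congr 1
      have h1 : (B * herm x * Bᴴ).det = (((A.det.re)⁻¹ * (herm x).det.re : ℝ) : ℂ) := by
        rw [det_mul, det_mul, det_conjTranspose, Complex.ofReal_mul,
          ofReal_re_det (isHermitian_herm x), ← hnorm, ← Complex.normSq_eq_norm_sq,
          Complex.normSq_eq_conj_mul_self, Complex.star_def]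
        ring
      have h2 : (B * herm x * Bᴴ * A).trace = (herm x * 1).trace := by
        rw [Matrix.mul_assoc, Matrix.mul_assoc, trace_mul_comm, Matrix.mul_assoc, ← hB]
      rw [h1, h2, Complex.ofReal_re, mul_pow, inv_pow, mul_assoc]
    · rw [coneDensity, coneDensity, Set.indicator_of_notMem (mt hpd.1 hx),
        Set.indicator_of_notMem hx, mul_zero]
  simp only [key] at h
  rw [lintegral_const_mul _ (measurable_coneDensity α 1), hdet, inv_inv,
    abs_of_pos (by positivity)] at h
  rw [← one_mul (∫⁻ x, coneDensity α A x), ← ENNReal.ofReal_one,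
    ← inv_mul_cancel₀ (pow_pos hdA (Fintype.card κ)).ne', ENNReal.ofReal_mul (by positivity),
    mul_assoc, ← h, ← mul_assoc, ← ENNReal.ofReal_mul (by positivity), pow_add, mul_inv]

/-- The `2 × 2` principal minor on `i, j` bounds `|A i j|²` by a product of diagonal entries, each
at most the trace. -/
lemma norm_apply_le_re_trace {A : Matrix κ κ ℂ} (hA : A.PosSemidef) (i j : κ) :
    ‖A i j‖ ≤ A.trace.re := by
  have h := (hA.submatrix ![i, j]).det_nonneg
  rw [det_fin_two] at h
  simp only [submatrix_apply, cons_val_zero, cons_val_one] at h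
  have hd : ∀ k, 0 ≤ (A k k).re ∧ (A k k).re ≤ A.trace.re ∧ (A k k).im = 0 := by
    have h0 : ∀ k, 0 ≤ (A k k).re := fun k => (Complex.nonneg_iff.1 hA.diag_nonneg).1
    refine fun k => ⟨h0 k, ?_, (Complex.nonneg_iff.1 hA.diag_nonneg).2.symm⟩
    rw [trace, Complex.re_sum]
    exact Finset.single_le_sum (f := fun k => (A k k).re) (fun k _ => h0 k) (Finset.mem_univ k)
  have hij : A i j * A j i = ((‖A i j‖ ^ 2 : ℝ) : ℂ) := by
    rw [← hA.1.apply j i, Complex.star_def, Complex.mul_conj, Complex.normSq_eq_norm_sq]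
  rw [hij] at h
  have h1 := (Complex.nonneg_iff.1 h).1
  rw [Complex.sub_re, Complex.mul_re, Complex.ofReal_re, (hd i).2.2, zero_mul, sub_zero] at h1
  have h2 : (A i i).re * (A j j).re ≤ A.trace.re * A.trace.re :=
    mul_le_mul (hd i).2.1 (hd j).2.1 (hd j).1 ((hd i).1.trans (hd i).2.1)
  refine le_of_sq_le_sq ?_ ((hd i).1.trans (hd i).2.1)
  nlinarith

lemma integrable_exp_neg_mul_abs {c : ℝ} (hc : 0 < c) :
    Integrable fun x : ℝ => Real.exp (-c * |x|) := by
  rw [← integrableOn_univ, ← Set.Iic_union_Ioi (a := (0 : ℝ))]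
  refine IntegrableOn.union ?_ ?_
  · refine (integrableOn_exp_mul_Iic hc 0).congr_fun (fun x hx => ?_) measurableSet_Iic
    simp only [abs_of_nonpos (Set.mem_Iic.1 hx)]
    congr 1
    ring
  · refine (integrableOn_exp_mul_Ioi (neg_neg_of_pos hc) 0).congr_fun (fun x hx => ?_)
      measurableSet_Ioi
    simp only [abs_of_pos (Set.mem_Ioi.1 hx)]

lemma lintegral_coneDensity_zero_ne_top : ∫⁻ x, coneDensity (κ := κ) 0 1 x ≠ ⊤ := by
  -- On the cone `|x i j| ≤ 2 tr`, so the `n²` coordinates sum to at most `2n² tr`; the `+ 1` keeps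
  -- `c` positive for an empty index type.
  set c : ℝ := (2 * (Fintype.card κ : ℝ) ^ 2 + 1)⁻¹
  have hc : 0 < c := by positivity
  have hint : Integrable fun x : κ → κ → ℝ => ∏ i, ∏ j, Real.exp (-c * |x i j|) := by
    have h1 : Integrable fun x : ℝ => Real.exp (-c * |x|) :=
      integrable_exp_neg_mul_abs hc
    exact Integrable.fintype_prod (f := fun (_ : κ) (y : κ → ℝ) => ∏ j, Real.exp (-c * |y j|))
      fun i => Integrable.fintype_prod (f := fun (_ : κ) (y : ℝ) => Real.exp (-c * |y|)) fun j => h1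
  refine ((lintegral_mono fun x => ?_).trans_lt hint.lintegral_lt_top).ne
  by_cases hx : x ∈ pdCone κ
  · rw [coneDensity, Set.indicator_of_mem hx]
    refine ENNReal.ofReal_le_ofReal ?_
    rw [pow_zero, one_mul, mul_one]
    simp only [← Real.exp_sum]
    refine Real.exp_le_exp.2 ?_
    have hx' : (herm x).PosSemidef := PosDef.posSemidef hx
    have ht : 0 ≤ (herm x).trace.re := (Complex.nonneg_iff.1 hx'.trace_nonneg).1
    have hb : ∀ i j, |x i j| ≤ 2 * (herm x).trace.re := by
      intro i j
      have h1 : x i j = (herm x i j).re + (herm x i j).im := by rw [herm_re, herm_im]; ring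
      have h2 := norm_apply_le_re_trace hx' i j
      have h3 := Complex.abs_re_le_norm (herm x i j)
      have h4 := Complex.abs_im_le_norm (herm x i j)
      rw [h1]
      have := abs_add_le (herm x i j).re (herm x i j).im
      linarith
    have hs : ∑ i, ∑ j, |x i j| ≤ (2 * (Fintype.card κ : ℝ) ^ 2 + 1) * (herm x).trace.re := by
      refine (Finset.sum_le_sum fun i _ => Finset.sum_le_sum fun j _ => hb i j).trans ?_
      simp only [Finset.sum_const, Finset.card_univ, nsmul_eq_mul]
      nlinarith
    have hs2 : c * ∑ i, ∑ j, |x i j| ≤ (herm x).trace.re := by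
      rw [inv_mul_le_iff₀ (by positivity)]
      exact hs
    simp only [← Finset.mul_sum]
    linarith
  · rw [coneDensity, Set.indicator_of_notMem hx]
    exact zero_le

lemma posDef_smul_one_add {H : Matrix κ κ ℂ} (hH : H.IsHermitian) {k : ℝ}
    (hk : ∑ i, ∑ j, ‖H i j‖ < k) : ((k : ℂ) • (1 : Matrix κ κ ℂ) + H).PosDef := by
  have hherm : ((k : ℂ) • (1 : Matrix κ κ ℂ) + H).IsHermitian := by
    rw [IsHermitian, conjTranspose_add, conjTranspose_smul, conjTranspose_one, hH.eq]
    simp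
  refine PosDef.of_dotProduct_mulVec_pos hherm fun z hz => ?_
  have hreal : (star z ⬝ᵥ ((k : ℂ) • (1 : Matrix κ κ ℂ) + H) *ᵥ z).im = 0 :=
    hherm.im_star_dotProduct_mulVec_self z
  rw [Complex.pos_iff]
  refine ⟨?_, hreal.symm⟩
  rw [add_mulVec, dotProduct_add, smul_mulVec, one_mulVec, dotProduct_smul, smul_eq_mul,
    Complex.add_re, Complex.re_ofReal_mul, re_star_dotProduct_self]
  set N := ∑ k, ‖z k‖ ^ 2
  have hN : 0 < N := by
    obtain ⟨i, hi⟩ := Function.ne_iff.1 hz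
    exact Finset.sum_pos' (fun _ _ => by positivity) ⟨i, Finset.mem_univ i, by
      have : 0 < ‖z i‖ := norm_pos_iff.2 hi
      positivity⟩
  have hb : ‖star z ⬝ᵥ H *ᵥ z‖ ≤ (∑ i, ∑ j, ‖H i j‖) * N := by
    simp only [dotProduct, mulVec, Finset.mul_sum, Finset.sum_mul]
    refine (norm_sum_le _ _).trans (Finset.sum_le_sum fun i _ => (norm_sum_le _ _).trans
      (Finset.sum_le_sum fun j _ => ?_))
    rw [norm_mul, norm_mul, Pi.star_apply, norm_star]
    have h1 : ‖z i‖ ^ 2 ≤ N :=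
      Finset.single_le_sum (f := fun k => ‖z k‖ ^ 2) (fun _ _ => by positivity) (Finset.mem_univ i)
    have h2 : ‖z j‖ ^ 2 ≤ N :=
      Finset.single_le_sum (f := fun k => ‖z k‖ ^ 2) (fun _ _ => by positivity) (Finset.mem_univ j)
    have h3 : ‖z i‖ * ‖z j‖ ≤ N := by nlinarith [sq_nonneg (‖z i‖ - ‖z j‖)]
    calc ‖z i‖ * (‖H i j‖ * ‖z j‖) = ‖H i j‖ * (‖z i‖ * ‖z j‖) := by ring
      _ ≤ ‖H i j‖ * N := mul_le_mul_of_nonneg_left h3 (norm_nonneg _)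
  have h4 := Complex.abs_re_le_norm (star z ⬝ᵥ H *ᵥ z)
  have h5 := neg_abs_le (star z ⬝ᵥ H *ᵥ z).re
  nlinarith

/-- The translates of the cone by multiples of the identity cover the whole space, so a null cone
would make Lebesgue measure vanish. -/
lemma volume_pdCone_ne_zero : volume (pdCone κ) ≠ 0 := by
  intro h0
  set e : κ → κ → ℝ := hermCoord 1
  have he : herm e = 1 := herm_hermCoord isHermitian_one
  have hcov : (Set.univ : Set (κ → κ → ℝ)) ⊆ ⋃ k : ℕ, (fun x => (k : ℝ) • e + x) ⁻¹' pdCone κ := by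
    intro x _
    obtain ⟨k, hk⟩ := exists_nat_gt (∑ i, ∑ j, ‖herm x i j‖)
    refine Set.mem_iUnion.2 ⟨k, ?_⟩
    rw [Set.mem_preimage, pdCone, Set.mem_ofPred_eq, herm_add, herm_smul, he]
    exact posDef_smul_one_add (isHermitian_herm x) hk
  have h1 : volume (Set.univ : Set (κ → κ → ℝ)) = 0 := by
    refine measure_mono_null hcov (measure_iUnion_null fun k => ?_)
    rw [measure_preimage_add]
    exact h0
  exact (NeZero.ne (volume : Measure (κ → κ → ℝ))) (Measure.measure_univ_eq_zero.1 h1)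

lemma lintegral_coneDensity_ne_zero (α : ℕ) (A : Matrix κ κ ℂ) :
    ∫⁻ x, coneDensity α A x ≠ 0 := by
  intro h
  rw [lintegral_eq_zero_iff (measurable_coneDensity α A)] at h
  refine volume_pdCone_ne_zero (κ := κ) (measure_mono_null (fun x hx => ?_) h)
  rw [Set.mem_compl_iff, Set.mem_ofPred_eq, coneDensity, Set.indicator_of_mem hx]
  have := re_det_pos (A := herm x) hx
  simp only [Pi.zero_apply, ENNReal.ofReal_eq_zero, not_le]
  positivity

end Hermitian

/-! ### Determining a measure by its Laplace transform near the origin -/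

section Laplace

/-- Both transforms are analytic on the strip `|Re z| < ε` and agree on the real axis near `0`,
hence at `I`, where they are values of the characteristic functions. -/
lemma complexMGF_I_eq_of_mgf_eqOn {Ω Ω' : Type*} [MeasurableSpace Ω] [MeasurableSpace Ω']
    {μ : Measure Ω} {ν : Measure Ω'} {X : Ω → ℝ} {Y : Ω' → ℝ} {ε : ℝ} (hε : 0 < ε)
    (hX : Set.Ioo (-ε) ε ⊆ integrableExpSet X μ) (hY : Set.Ioo (-ε) ε ⊆ integrableExpSet Y ν)
    (h : Set.EqOn (mgf X μ) (mgf Y ν) (Set.Ioo (-ε) ε)) :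
    complexMGF X μ Complex.I = complexMGF Y ν Complex.I := by
  set strip : Set ℂ := {z | z.re ∈ Set.Ioo (-ε) ε} with hstrip
  have hXa : AnalyticOnNhd ℂ (complexMGF X μ) strip := analyticOnNhd_complexMGF.mono
    fun z hz => interior_maximal hX isOpen_Ioo hz
  have hYa : AnalyticOnNhd ℂ (complexMGF Y ν) strip := analyticOnNhd_complexMGF.mono
    fun z hz => interior_maximal hY isOpen_Ioo hz
  have hpre : IsPreconnected strip :=
    ((convex_Ioo (-ε) ε).linear_preimage Complex.reLm).isPreconnected
  refine AnalyticOnNhd.eqOn_of_preconnected_of_frequently_eq hXa hYa hpre (z₀ := ((0 : ℝ) : ℂ))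
    (by simp [hstrip, hε]) ?_ (by simp [hstrip, hε])
  have h_real : ∃ᶠ x : ℝ in 𝓝[≠] 0, complexMGF X μ x = complexMGF Y ν x := by
    refine Eventually.frequently ?_
    filter_upwards [nhdsWithin_le_nhds (Ioo_mem_nhds (neg_lt_zero.2 hε) hε)] with y hy
    rw [complexMGF_ofReal, complexMGF_ofReal, h hy]
  rw [frequently_iff_seq_forall] at h_real ⊢
  obtain ⟨xs, hx_tendsto, hx_eq⟩ := h_real
  refine ⟨fun n => xs n, ?_, fun n => hx_eq n⟩
  rw [tendsto_nhdsWithin_iff] at hx_tendsto ⊢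
  constructor
  · exact (Complex.continuous_ofReal.tendsto 0).comp hx_tendsto.1
  · simpa using hx_tendsto.2

theorem ext_of_lintegral_exp {E : Type*} [NormedAddCommGroup E] [NormedSpace ℝ E] [CompleteSpace E]
    [SecondCountableTopology E] [MeasurableSpace E] [BorelSpace E] {μ ν : Measure E}
    [IsFiniteMeasure μ] [IsFiniteMeasure ν]
    (h : ∀ L : StrongDual ℝ E, ∃ ε > 0, ∀ s : ℝ, |s| < ε →
      ∫⁻ x, ENNReal.ofReal (Real.exp (s * L x)) ∂μ ≠ ⊤ ∧
      ∫⁻ x, ENNReal.ofReal (Real.exp (s * L x)) ∂μ =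
        ∫⁻ x, ENNReal.ofReal (Real.exp (s * L x)) ∂ν) : μ = ν := by
  refine Measure.ext_of_charFunDual (funext fun L => ?_)
  obtain ⟨ε, hε, hL⟩ := h L
  have hint : ∀ (ρ : Measure E) (s : ℝ), ∫⁻ x, ENNReal.ofReal (Real.exp (s * L x)) ∂ρ ≠ ⊤ →
      Integrable (fun x => Real.exp (s * L x)) ρ := fun ρ s hs =>
    (lintegral_ofReal_ne_top_iff_integrable (Measurable.aestronglyMeasurable (by fun_prop))
      (Eventually.of_forall fun x => (Real.exp_pos _).le)).1 hs
  have habs : ∀ s ∈ Set.Ioo (-ε) ε, |s| < ε := fun s hs => abs_lt.2 hs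
  have hμ : Set.Ioo (-ε) ε ⊆ integrableExpSet L μ := fun s hs => hint μ s (hL s (habs s hs)).1
  have hν : Set.Ioo (-ε) ε ⊆ integrableExpSet L ν := fun s hs =>
    hint ν s ((hL s (habs s hs)).2 ▸ (hL s (habs s hs)).1)
  have hI := complexMGF_I_eq_of_mgf_eqOn hε hμ hν fun s hs => by
    rw [mgf, mgf, integral_eq_lintegral_of_nonneg_ae
        (Eventually.of_forall fun x => (Real.exp_pos _).le)
        (Measurable.aestronglyMeasurable (by fun_prop)),
      integral_eq_lintegral_of_nonneg_ae (Eventually.of_forall fun x => (Real.exp_pos _).le)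
        (Measurable.aestronglyMeasurable (by fun_prop)), (hL s (habs s hs)).2]
  rw [charFunDual_apply, charFunDual_apply]
  simp only [complexMGF] at hI
  simpa only [mul_comm] using hI

end Laplace

/-! ### The density of the complex Wishart distribution -/

section WishartLaw

open Matrix

variable {ι κ : Type*} [Fintype ι] [Fintype κ] [DecidableEq ι] [DecidableEq κ]

/-- The matrix `∑ᵢ zᵢ zᵢ†`. -/
def outerSum (z : ι → κ → ℂ) : Matrix κ κ ℂ := ∑ i, vecMulVec (z i) (star (z i))

lemma posSemidef_outerSum (z : ι → κ → ℂ) : (outerSum z).PosSemidef :=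
  posSemidef_sum _ fun i _ => posSemidef_vecMulVec_self_star (z i)

lemma continuous_outerSum : Continuous (outerSum : (ι → κ → ℂ) → Matrix κ κ ℂ) := by
  unfold outerSum
  fun_prop

lemma trace_outerSum_mul (z : ι → κ → ℂ) (C : Matrix κ κ ℂ) :
    (outerSum z * C).trace = ∑ i, star (z i) ⬝ᵥ (C *ᵥ z i) := by
  rw [outerSum, Finset.sum_mul, trace_sum]
  refine Finset.sum_congr rfl fun i _ => ?_
  rw [trace_mul_comm, trace_mul_vecMulVec, dotProduct_comm]

lemma lintegral_exp_quadForm_stdGaussian {C : Matrix κ κ ℂ} (hC : (1 - C).PosDef) :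
    ∫⁻ z, ENNReal.ofReal (Real.exp (star z ⬝ᵥ (C *ᵥ z)).re) ∂(Measure.pi fun _ : κ => stdGaussian) =
      ENNReal.ofReal (((1 - C).det.re)⁻¹) := by
  have hm : Measurable fun z : κ → ℂ => ENNReal.ofReal (Real.exp (star z ⬝ᵥ (C *ᵥ z)).re) :=
    (Real.measurable_exp.comp (measurable_quadForm C)).ennreal_ofReal
  rw [pi_stdGaussian, lintegral_withDensity_eq_lintegral_mul _ (by fun_prop) hm]
  have h : ∀ z : κ → ℂ, ((fun z : κ → ℂ => ENNReal.ofReal ((Real.pi ^ Fintype.card κ)⁻¹ *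
      Real.exp (-∑ k, ‖z k‖ ^ 2))) * fun z => ENNReal.ofReal (Real.exp (star z ⬝ᵥ (C *ᵥ z)).re)) z =
      ENNReal.ofReal ((Real.pi ^ Fintype.card κ)⁻¹) *
        ENNReal.ofReal (Real.exp (-(star z ⬝ᵥ ((1 - C) *ᵥ z)).re)) := by
    intro z
    rw [Pi.mul_apply, ENNReal.ofReal_mul (by positivity), mul_assoc,
      ← ENNReal.ofReal_mul (Real.exp_pos _).le, ← Real.exp_add]
    congr 3
    rw [sub_mulVec, one_mulVec, dotProduct_sub, Complex.sub_re, re_star_dotProduct_self]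
    ring
  simp only [h]
  rw [lintegral_const_mul' _ _ ENNReal.ofReal_ne_top,
    lintegral_exp_neg_quadForm hC, ← ENNReal.ofReal_mul (by positivity), ← mul_assoc,
    inv_mul_cancel₀ (by positivity), one_mul]

lemma lintegral_exp_trace_outerSum {C : Matrix κ κ ℂ} (hC : (1 - C).PosDef) :
    ∫⁻ z, ENNReal.ofReal (Real.exp (outerSum z * C).trace.re) ∂gaussianMatrix ι κ =
      ENNReal.ofReal (((1 - C).det.re ^ Fintype.card ι)⁻¹) := by
  have hm : Measurable fun z : κ → ℂ => ENNReal.ofReal (Real.exp (star z ⬝ᵥ (C *ᵥ z)).re) :=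
    (Real.measurable_exp.comp (measurable_quadForm C)).ennreal_ofReal
  simp only [trace_outerSum_mul, Complex.re_sum, Real.exp_sum]
  simp only [ENNReal.ofReal_prod_of_nonneg fun i (_ : i ∈ Finset.univ) => (Real.exp_pos _).le]
  have hi : iIndepFun (fun (i : ι) (z : ι → κ → ℂ) =>
      ENNReal.ofReal (Real.exp (star (z i) ⬝ᵥ (C *ᵥ z i)).re)) (gaussianMatrix ι κ) :=
    iIndepFun_pi (X := fun _ w => ENNReal.ofReal (Real.exp (star w ⬝ᵥ (C *ᵥ w)).re))
      fun i => hm.aemeasurable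
  rw [lintegral_prod_eq_prod_lintegral_of_indepFun _ _ hi fun i => hm.comp (measurable_pi_apply i)]
  have h1 : ∀ i : ι, ∫⁻ z : ι → κ → ℂ, ENNReal.ofReal (Real.exp (star (z i) ⬝ᵥ (C *ᵥ z i)).re)
      ∂gaussianMatrix ι κ = ENNReal.ofReal (((1 - C).det.re)⁻¹) := by
    intro i
    rw [← lintegral_exp_quadForm_stdGaussian hC]
    exact (measurePreserving_eval (fun _ : ι => Measure.pi fun _ : κ => stdGaussian) i).lintegral_comp
      hm
  simp only [h1]
  rw [Finset.prod_const, Finset.card_univ, ← inv_pow, ENNReal.ofReal_pow]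
  exact inv_nonneg.2 (re_det_pos hC).le

lemma exists_coeff_strongDual (L : StrongDual ℝ (κ → κ → ℝ)) :
    ∃ c : κ → κ → ℝ, ∀ x, L x = ∑ i, ∑ j, x i j * c i j := by
  refine ⟨fun i j => L (Pi.single i (Pi.single j 1)), fun x => ?_⟩
  have hx : x = ∑ i, ∑ j, x i j • (Pi.single i (Pi.single j 1) : κ → κ → ℝ) := by
    ext i j
    simp [Finset.sum_apply, Pi.single_apply, apply_ite, ite_apply]
  conv_lhs => rw [hx]
  simp [map_sum]

lemma exists_posDef_one_sub_smul {H : Matrix κ κ ℂ} (hH : H.IsHermitian) :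
    ∃ ε > 0, ∀ s : ℝ, |s| < ε → (1 - (s : ℂ) • H).PosDef := by
  set N := ∑ i, ∑ j, ‖H i j‖
  have hN : 0 ≤ N := Finset.sum_nonneg fun i _ => Finset.sum_nonneg fun j _ => norm_nonneg _
  refine ⟨(N + 1)⁻¹, by positivity, fun s hs => ?_⟩
  have h1 : |s| * (N + 1) < 1 := by
    rwa [← lt_inv_mul_iff₀' (by positivity), mul_one]
  have hherm : (-((s : ℂ) • H)).IsHermitian := by
    rw [IsHermitian, conjTranspose_neg, conjTranspose_smul, hH.eq]
    simp
  have h := posDef_smul_one_add hherm (k := 1) (by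
    simp only [Matrix.neg_apply, norm_neg, Matrix.smul_apply, smul_eq_mul, norm_mul,
      Complex.norm_real, Real.norm_eq_abs, ← Finset.mul_sum]
    nlinarith [abs_nonneg s])
  rwa [Complex.ofReal_one, one_smul, ← sub_eq_add_neg] at h

/-- The total mass of `coneDensity α 1`. -/
def coneMass (κ : Type*) [Fintype κ] [DecidableEq κ] (α : ℕ) : ENNReal :=
  ∫⁻ x, coneDensity (κ := κ) α 1 x

/-- Both measures have Laplace transform `det(1 - C)^(-(n + α))` for small Hermitian `C`. Finiteness
of the mass is a hypothesis because the case `α = 0` is used to prove it for all `α`. -/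
lemma map_outerSum_of_coneMass_ne_top {α : ℕ} (hι : Fintype.card ι = Fintype.card κ + α)
    (hZ : coneMass κ α ≠ ⊤) :
    (gaussianMatrix ι κ).map (fun z => hermCoord (outerSum z)) =
      (coneMass κ α)⁻¹ • volume.withDensity (coneDensity α 1) := by
  have hZ0 : coneMass κ α ≠ 0 := lintegral_coneDensity_ne_zero α 1
  have hm : Measurable fun z : ι → κ → ℂ => hermCoord (outerSum z) :=
    (continuous_hermCoord.comp continuous_outerSum).measurable
  have : IsProbabilityMeasure ((gaussianMatrix ι κ).map fun z => hermCoord (outerSum z)) :=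
    Measure.isProbabilityMeasure_map hm.aemeasurable
  have : IsProbabilityMeasure ((coneMass κ α)⁻¹ • volume.withDensity (coneDensity (κ := κ) α 1)) := by
    refine ⟨?_⟩
    rw [Measure.smul_apply, withDensity_apply _ MeasurableSet.univ, Measure.restrict_univ,
      smul_eq_mul]
    exact ENNReal.inv_mul_cancel hZ0 hZ
  refine ext_of_lintegral_exp fun L => ?_
  obtain ⟨c, hc⟩ := exists_coeff_strongDual L
  obtain ⟨ε, hε, hpd⟩ := exists_posDef_one_sub_smul (isHermitian_herm c)
  refine ⟨ε, hε, fun s hs => ?_⟩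
  have hL : ∀ x, s * L x = (herm x * ((s : ℂ) • herm c)).trace.re := by
    intro x
    rw [Matrix.mul_smul, trace_smul, smul_eq_mul, Complex.re_ofReal_mul, re_trace_herm_mul_herm, hc]
  have hml : Measurable fun x => ENNReal.ofReal (Real.exp (s * L x)) := by fun_prop
  have h1 : ∫⁻ x, ENNReal.ofReal (Real.exp (s * L x))
      ∂((gaussianMatrix ι κ).map fun z => hermCoord (outerSum z)) =
      ENNReal.ofReal (((1 - (s : ℂ) • herm c).det.re ^ Fintype.card ι)⁻¹) := by
    rw [lintegral_map hml hm, ← lintegral_exp_trace_outerSum (hpd s hs)]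
    simp only [hL, herm_hermCoord (posSemidef_outerSum _).1]
  have h2 : ∫⁻ x, ENNReal.ofReal (Real.exp (s * L x))
      ∂((coneMass κ α)⁻¹ • volume.withDensity (coneDensity (κ := κ) α 1)) =
      ENNReal.ofReal (((1 - (s : ℂ) • herm c).det.re ^ Fintype.card ι)⁻¹) := by
    rw [lintegral_smul_measure, lintegral_withDensity_eq_lintegral_mul _
      (measurable_coneDensity α 1) hml]
    have h3 : ∀ x, (coneDensity α (1 : Matrix κ κ ℂ) * fun x => ENNReal.ofReal (Real.exp (s * L x))) x =
        coneDensity α (1 - (s : ℂ) • herm c) x := by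
      intro x
      rw [Pi.mul_apply]
      by_cases hx : x ∈ pdCone κ
      · rw [coneDensity, coneDensity, Set.indicator_of_mem hx, Set.indicator_of_mem hx,
          ← ENNReal.ofReal_mul, mul_assoc, ← Real.exp_add]
        · congr 3
          rw [hL, Matrix.mul_sub, trace_sub, Complex.sub_re]
          ring
        · have := re_det_pos (A := herm x) hx
          positivity
      · rw [coneDensity, coneDensity, Set.indicator_of_notMem hx, Set.indicator_of_notMem hx,
          zero_mul]
    simp only [h3]
    rw [lintegral_coneDensity α (hpd s hs), smul_eq_mul, mul_left_comm, ← coneMass,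
      ENNReal.inv_mul_cancel hZ0 hZ, mul_one, hι]
  rw [h1, h2]
  exact ⟨ENNReal.ofReal_ne_top, rfl⟩

lemma coneMass_ne_zero (α : ℕ) : coneMass κ α ≠ 0 := lintegral_coneDensity_ne_zero α 1

lemma coneMass_zero_ne_top : coneMass κ 0 ≠ ⊤ := lintegral_coneDensity_zero_ne_top

/-- The moment of order `α` of the determinant of a shifted square Wishart matrix. -/
def shiftedMoment (α : ℕ) (B : Matrix κ κ ℂ) : ENNReal :=
  ∫⁻ z, ENNReal.ofReal ((outerSum z + B).det.re ^ α) ∂gaussianMatrix κ κ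

/-- The weight `exp(-tr X)` on the cone is the unnormalised law of a square Wishart matrix, so cone
integrals become determinant moments. -/
lemma lintegral_pdCone_eq_shiftedMoment (α : ℕ) (B : Matrix κ κ ℂ) :
    ∫⁻ x, (pdCone κ).indicator (fun x => ENNReal.ofReal ((herm x + B).det.re ^ α) *
      ENNReal.ofReal (Real.exp (-(herm x).trace.re))) x = coneMass κ 0 * shiftedMoment α B := by
  have hm : Measurable fun z : κ → κ → ℂ => hermCoord (outerSum z) :=
    (continuous_hermCoord.comp continuous_outerSum).measurable
  have hg : Measurable fun x : κ → κ → ℝ => ENNReal.ofReal ((herm x + B).det.re ^ α) :=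
    (((Complex.continuous_re.comp ((continuous_herm.add continuous_const).matrix_det)).pow
      α).measurable).ennreal_ofReal
  have h : shiftedMoment α B = ∫⁻ x, ENNReal.ofReal ((herm x + B).det.re ^ α)
      ∂((gaussianMatrix κ κ).map fun z => hermCoord (outerSum z)) := by
    rw [lintegral_map hg hm]
    simp only [herm_hermCoord (posSemidef_outerSum _).1, shiftedMoment]
  rw [h, map_outerSum_of_coneMass_ne_top (add_zero _).symm coneMass_zero_ne_top,
    lintegral_smul_measure, smul_eq_mul, ← mul_assoc,
    ENNReal.mul_inv_cancel (coneMass_ne_zero 0) coneMass_zero_ne_top, one_mul,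
    lintegral_withDensity_eq_lintegral_mul _ (measurable_coneDensity 0 1) hg]
  refine lintegral_congr fun x => ?_
  rw [Pi.mul_apply, coneDensity]
  by_cases hx : x ∈ pdCone κ
  · rw [Set.indicator_of_mem hx, Set.indicator_of_mem hx, pow_zero, one_mul, mul_one, mul_comm]
  · rw [Set.indicator_of_notMem hx, Set.indicator_of_notMem hx, zero_mul]

lemma coneMass_eq (α : ℕ) : coneMass κ α = coneMass κ 0 * shiftedMoment (κ := κ) α 0 := by
  rw [← lintegral_pdCone_eq_shiftedMoment α 0, coneMass]
  refine lintegral_congr fun x => ?_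
  rw [coneDensity]
  by_cases hx : x ∈ pdCone κ
  · have := re_det_pos (A := herm x) hx
    rw [Set.indicator_of_mem hx, Set.indicator_of_mem hx, ENNReal.ofReal_mul (by positivity),
      mul_one, add_zero]
  · rw [Set.indicator_of_notMem hx, Set.indicator_of_notMem hx]

/-- A moment of a polynomial in Gaussian entries is finite; with `coneMass_eq` this settles the mass
for every `α`. -/
lemma shiftedMoment_zero_ne_top (α : ℕ) : shiftedMoment (κ := κ) α 0 ≠ ⊤ := by
  have h := (integrable_det_scaledWishart_pow (ι := κ) (κ := κ) (fun _ => 1) α).norm.lintegral_lt_top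
  refine ((lintegral_mono fun z => ENNReal.ofReal_le_ofReal ?_).trans_lt h).ne
  simp only [scaledWishart, one_smul, add_zero, norm_pow]
  refine pow_le_pow_left₀ ?_ (Complex.re_le_norm _) α
  exact (Complex.nonneg_iff.1 (posSemidef_outerSum z).det_nonneg).1

lemma coneMass_ne_top (α : ℕ) : coneMass κ α ≠ ⊤ := by
  rw [coneMass_eq]
  exact ENNReal.mul_ne_top coneMass_zero_ne_top (shiftedMoment_zero_ne_top α)

lemma shiftedMoment_zero_ne_zero (α : ℕ) : shiftedMoment (κ := κ) α 0 ≠ 0 := by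
  intro h
  have := coneMass_eq (κ := κ) α
  rw [h, mul_zero] at this
  exact coneMass_ne_zero α this

/-- The upper tail of the complex Wishart distribution in the Loewner order. -/
theorem measure_posDef_outerSum_sub {α : ℕ} (hι : Fintype.card ι = Fintype.card κ + α)
    {B : Matrix κ κ ℂ} (hB : B.PosSemidef) :
    shiftedMoment (κ := κ) α 0 * gaussianMatrix ι κ {z | (outerSum z - B).PosDef} =
      ENNReal.ofReal (Real.exp (-B.trace.re)) * shiftedMoment α B := by
  set b := hermCoord B with hb
  have hbB : herm b = B := herm_hermCoord hB.1
  have hm : Measurable fun z : ι → κ → ℂ => hermCoord (outerSum z) :=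
    (continuous_hermCoord.comp continuous_outerSum).measurable
  have hherm : ∀ x : κ → κ → ℝ, herm (x - b) = herm x - B := by
    intro x
    rw [eq_sub_iff_add_eq, ← hbB, ← herm_add, sub_add_cancel]
  have hms : MeasurableSet ((fun x => x - b) ⁻¹' pdCone κ) :=
    (measurable_sub_const b) measurableSet_pdCone
  have hset : {z : ι → κ → ℂ | (outerSum z - B).PosDef} =
      (fun z => hermCoord (outerSum z)) ⁻¹' ((fun x => x - b) ⁻¹' pdCone κ) := by
    ext z
    rw [Set.mem_preimage, Set.mem_preimage, pdCone, Set.mem_ofPred_eq, Set.mem_ofPred_eq, hherm,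
      herm_hermCoord (posSemidef_outerSum z).1]
  have h1 : gaussianMatrix ι κ {z | (outerSum z - B).PosDef} =
      (coneMass κ α)⁻¹ * ∫⁻ x, (pdCone κ).indicator (fun x => coneDensity α 1 (x + b)) x := by
    rw [hset, ← Measure.map_apply hm hms, map_outerSum_of_coneMass_ne_top hι (coneMass_ne_top α),
      Measure.smul_apply, smul_eq_mul, withDensity_apply _ hms, ← lintegral_indicator hms,
      ← lintegral_add_right_eq_self _ b]
    congr 1
    refine lintegral_congr fun x => ?_
    have : x + b ∈ (fun x => x - b) ⁻¹' pdCone κ ↔ x ∈ pdCone κ := by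
      rw [Set.mem_preimage, add_sub_cancel_right]
    by_cases hx : x ∈ pdCone κ
    · rw [Set.indicator_of_mem hx, Set.indicator_of_mem (this.2 hx)]
    · rw [Set.indicator_of_notMem hx, Set.indicator_of_notMem (mt this.1 hx)]
  -- The cone is stable under adding `B`, so after the translation no cutoff remains besides `X > 0`
  -- and the exponential splits off `exp(-tr B)`.
  have h2 : ∫⁻ x, (pdCone κ).indicator (fun x => coneDensity α 1 (x + b)) x =
      ENNReal.ofReal (Real.exp (-B.trace.re)) * (coneMass κ 0 * shiftedMoment α B) := by
    rw [← lintegral_pdCone_eq_shiftedMoment α B, ← lintegral_const_mul']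
    · refine lintegral_congr fun x => ?_
      by_cases hx : x ∈ pdCone κ
      · have hxb : (herm x + B).PosDef := PosDef.add_posSemidef hx hB
        have hmem : x + b ∈ pdCone κ := by
          rw [pdCone, Set.mem_ofPred_eq, herm_add, hbB]
          exact hxb
        have hpos := re_det_pos hxb
        rw [Set.indicator_of_mem hx, Set.indicator_of_mem hx, coneDensity,
          Set.indicator_of_mem hmem, herm_add, hbB, mul_one, trace_add, Complex.add_re, neg_add,
          Real.exp_add, ENNReal.ofReal_mul (by positivity), ENNReal.ofReal_mul (by positivity)]
        ring
      · rw [Set.indicator_of_notMem hx, Set.indicator_of_notMem hx, mul_zero]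
    · exact ENNReal.ofReal_ne_top
  have hZ := coneMass_ne_top (κ := κ) α
  rw [h1, h2]
  calc _ = (coneMass κ α)⁻¹ * (coneMass κ 0 * shiftedMoment (κ := κ) α 0) *
        (ENNReal.ofReal (Real.exp (-B.trace.re)) * shiftedMoment α B) := by ring
    _ = _ := by rw [← coneMass_eq, ENNReal.inv_mul_cancel (coneMass_ne_zero α) hZ, one_mul]

end WishartLaw

/-! ### The exact tail probability -/

section ExactTail

open Matrix

variable {ι κ : Type*} [Fintype ι] [Fintype κ] [DecidableEq ι] [DecidableEq κ]

lemma outerSum_smul (c : ℝ) (z : ι → κ → ℂ) :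
    outerSum (c • z) = ((c ^ 2 : ℝ) : ℂ) • outerSum z := by
  rw [outerSum, outerSum, Finset.smul_sum]
  refine Finset.sum_congr rfl fun i _ => ?_
  ext k l
  simp only [vecMulVec_apply, Pi.smul_apply, Pi.star_apply, Matrix.smul_apply, Complex.real_smul,
    star_mul', Complex.star_def, Complex.conj_ofReal, smul_eq_mul, Complex.ofReal_pow]
  ring

lemma re_trace_outerSum (z : ι → κ → ℂ) :
    (outerSum z).trace.re = ∑ i, ∑ k, ‖z i k‖ ^ 2 := by
  have h := trace_outerSum_mul z 1
  rw [mul_one] at h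
  simp only [h, one_mulVec, Complex.re_sum, re_star_dotProduct_self]

/-- The tilt turns `exp(-‖z‖²)` into `exp(-(1 + s)‖z‖²)`, and rescaling by `√(1 + s)` in real
dimension `2 |ι| |κ|` restores the Gaussian. -/
lemma lintegral_exp_neg_trace_mul {s : ℝ} (hs : 0 ≤ s) {f : (ι → κ → ℂ) → ENNReal}
    (hf : Measurable f) :
    ∫⁻ z, ENNReal.ofReal (Real.exp (-(s * (outerSum z).trace.re))) * f z ∂gaussianMatrix ι κ =
      ENNReal.ofReal (((1 + s) ^ (Fintype.card ι * Fintype.card κ))⁻¹) *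
        ∫⁻ z, f ((Real.sqrt (1 + s))⁻¹ • z) ∂gaussianMatrix ι κ := by
  set c := Real.sqrt (1 + s)
  have hc : 0 < c := Real.sqrt_pos.2 (by linarith)
  have hc2 : c ^ 2 = 1 + s := Real.sq_sqrt (by linarith)
  have hfc : Measurable fun z => f (c⁻¹ • z) := hf.comp (measurable_const_smul c⁻¹)
  have hd : Measurable fun z : ι → κ → ℂ => ENNReal.ofReal
      ((Real.pi ^ (Fintype.card ι * Fintype.card κ))⁻¹ * Real.exp (-∑ i, ∑ k, ‖z i k‖ ^ 2)) := by
    fun_prop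
  have hF : LinearMap.det (c • LinearMap.id : (ι → κ → ℂ) →ₗ[ℝ] (ι → κ → ℂ)) =
      (1 + s) ^ (Fintype.card ι * Fintype.card κ) := by
    rw [LinearMap.det_smul, LinearMap.det_id, mul_one, ← hc2, ← pow_mul]
    congr 1
    simp only [Module.finrank_pi_fintype, Complex.finrank_real_complex, Finset.sum_const,
      Finset.card_univ, smul_eq_mul]
    ring
  have : (volume : Measure (ι → κ → ℂ)).IsAddHaarMeasure := Measure.pi.isAddHaarMeasure _
  have h := lintegral_comp_linearMap (volume : Measure (ι → κ → ℂ))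
    (F := c • LinearMap.id) (by rw [hF]; positivity) (hd.mul hfc)
  rw [hF, abs_of_pos (by positivity)] at h
  have hm : Measurable fun z : ι → κ → ℂ =>
      ENNReal.ofReal (Real.exp (-(s * (outerSum z).trace.re))) := by
    simp only [re_trace_outerSum]
    fun_prop
  rw [gaussianMatrix_eq_withDensity, lintegral_withDensity_eq_lintegral_mul _ hd
      (g := fun z => ENNReal.ofReal (Real.exp (-(s * (outerSum z).trace.re))) * f z) (hm.mul hf),
    lintegral_withDensity_eq_lintegral_mul _ hd hfc]
  refine Eq.trans (lintegral_congr fun z => ?_) h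
  simp only [Pi.mul_apply, LinearMap.smul_apply, LinearMap.id_apply]
  rw [smul_smul, inv_mul_cancel₀ hc.ne', one_smul, ← mul_assoc, ← ENNReal.ofReal_mul (by positivity),
    mul_assoc, ← Real.exp_add, re_trace_outerSum]
  congr 4
  simp only [Pi.smul_apply, norm_smul, mul_pow, Real.norm_eq_abs, sq_abs, hc2, ← Finset.mul_sum]
  ring

lemma measurePreserving_append {E : Type*} [MeasurableSpace E] (ν : Measure E) [SigmaFinite ν]
    (m n : ℕ) :
    MeasurePreserving (fun p : (Fin m → E) × (Fin n → E) => Fin.append p.1 p.2)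
      ((Measure.pi fun _ => ν).prod (Measure.pi fun _ => ν)) (Measure.pi fun _ => ν) := by
  have hm : Measurable fun p : (Fin m → E) × (Fin n → E) => Fin.append p.1 p.2 := by
    refine measurable_pi_iff.2 fun i => ?_
    refine Fin.addCases (fun i => ?_) (fun i => ?_) i
    · simp only [Fin.append_left]
      fun_prop
    · simp only [Fin.append_right]
      fun_prop
  refine ⟨hm, (Measure.pi_eq fun s hs => ?_).symm⟩
  have hpre : (fun p : (Fin m → E) × (Fin n → E) => Fin.append p.1 p.2) ⁻¹' Set.univ.pi s =
      (Set.univ.pi fun i => s (Fin.castAdd n i)) ×ˢ (Set.univ.pi fun i => s (Fin.natAdd m i)) := by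
    ext p
    simp only [Set.mem_preimage, Set.mem_univ_pi, Set.mem_prod]
    constructor
    · intro h
      exact ⟨fun i => by simpa using h (Fin.castAdd n i), fun i => by simpa using h (Fin.natAdd m i)⟩
    · rintro ⟨h1, h2⟩ i
      refine Fin.addCases (fun i => ?_) (fun i => ?_) i
      · simpa using h1 i
      · simpa using h2 i
  rw [Measure.map_apply hm (MeasurableSet.univ_pi hs), hpre, Measure.prod_prod, Measure.pi_pi,
    Measure.pi_pi, Fin.prod_univ_add]

/-- The scales `t` on the first `m` rows and `1` on the remaining ones. -/
def blockScale (m n : ℕ) (t : ℂ) : Fin (m + n) → ℂ := Fin.append (fun _ => t) (fun _ => 1)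

lemma scaledWishart_blockScale {m n : ℕ} (t : ℂ) (z : Fin m → κ → ℂ) (w : Fin n → κ → ℂ) :
    scaledWishart (blockScale m n t) (Fin.append z w) = outerSum w + t • outerSum z := by
  rw [scaledWishart, Fin.sum_univ_add]
  simp only [blockScale, Fin.append_left, Fin.append_right, one_smul, ← Finset.smul_sum]
  rw [add_comm]
  rfl

/-- The Toeplitz determinant in the exact tail probability. -/
def tailDet (m n α : ℕ) (t : ℝ) : ℝ :=
  (toeplitz ((Polynomial.X + Polynomial.C t) ^ m * (Polynomial.X + 1) ^ n) m α).det

lemma eval_detMoment_blockScale (m n α : ℕ) :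
    ∃ c : ℂ, ∀ t : ℝ, MvPolynomial.eval (blockScale m n t) (detMoment (Fin (m + n)) (Fin n) α) =
      c * (tailDet m n α t : ℂ) := by
  obtain ⟨c, hc⟩ := exists_detMoment_eq m n α
  refine ⟨c, fun t => ?_⟩
  rw [hc, MvPolynomial.smul_eval]
  congr 1
  have hmap : ∀ {A B : Type} [CommRing A] [CommRing B] (φ : A →+* B) (q : Polynomial A) (p α : ℕ),
      φ (toeplitz q p α).det = (toeplitz (q.map φ) p α).det := by
    intro A B _ _ φ q p α
    rw [RingHom.map_det]
    congr 1
    ext a b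
    rw [RingHom.mapMatrix_apply, Matrix.map_apply, toeplitz, toeplitz, of_apply, of_apply,
      ← Polynomial.coeff_map, Polynomial.map_mul, Polynomial.map_pow, Polynomial.map_X]
  rw [hmap, show (tailDet m n α t : ℂ) = Complex.ofRealHom (tailDet m n α t) from rfl, tailDet, hmap]
  congr 2
  rw [Polynomial.map_prod]
  simp only [Polynomial.map_add, Polynomial.map_X, Polynomial.map_C, MvPolynomial.eval_X,
    Polynomial.map_mul, Polynomial.map_pow, Polynomial.map_one]
  rw [Fin.prod_univ_add]
  simp [blockScale]

/-- At `t = 0` the polynomial is `X^m (X + 1)^n` and the Toeplitz matrix is unit lower triangular.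
This normalisation makes it unnecessary to compute the constant in the moment formula. -/
lemma tailDet_zero (m n α : ℕ) : tailDet m n α 0 = 1 := by
  have hentry : ∀ a b : Fin α, toeplitz (((Polynomial.X : Polynomial ℝ) + Polynomial.C 0) ^ m *
      (Polynomial.X + 1) ^ n) m α a b = if (a : ℕ) < b then 0 else (n.choose (a - b) : ℝ) := by
    intro a b
    rw [toeplitz, of_apply, Polynomial.C_0, add_zero, ← mul_assoc, ← pow_add, mul_comm,
      Polynomial.coeff_mul_X_pow']
    split_ifs with h1 h2 h2
    · omega
    · rw [Polynomial.coeff_X_add_one_pow]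
      congr 2
      omega
    · rfl
    · omega
  rw [tailDet, det_of_isLowerTriangular]
  · simp only [hentry, lt_irrefl, if_false, Nat.sub_self, Nat.choose_zero_right, Nat.cast_one,
      Finset.prod_const_one]
  · intro a b hab
    rw [hentry, if_pos]
    exact hab

lemma ofReal_re_scaledWishart_pow {n m : ℕ} {t : ℝ} (ht : 0 ≤ t) (α : ℕ)
    (z : Fin (m + n) → Fin n → ℂ) :
    0 ≤ (scaledWishart (blockScale m n t) z).det.re ∧
      (((scaledWishart (blockScale m n t) z).det.re ^ α : ℝ) : ℂ) =
        (scaledWishart (blockScale m n t) z).det ^ α := by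
  have hps : (scaledWishart (blockScale m n t) z).PosSemidef := by
    refine posSemidef_sum _ fun i _ => (posSemidef_vecMulVec_self_star (z i)).smul ?_
    refine Fin.addCases (fun i => ?_) (fun i => ?_) i
    · simpa [blockScale] using ht
    · simp [blockScale]
  refine ⟨(Complex.nonneg_iff.1 hps.det_nonneg).1, ?_⟩
  rw [Complex.ofReal_pow, ofReal_re_det hps.1]

/-- Stacking `m` rows of scale `t` on `n` rows of scale `1` makes `W₀ + tW₂` a scaled Gram matrix,
so the moment formula applies. At `t = 0` the moment is nonzero, which makes `c` positive and the
determinant nonnegative. -/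
lemma lintegral_shiftedMoment_smul (m n α : ℕ) :
    ∃ c : ℝ, 0 < c ∧ ∀ t : ℝ, 0 ≤ t →
      ∫⁻ z, shiftedMoment α ((t : ℂ) • outerSum z) ∂gaussianMatrix (Fin m) (Fin n) =
        ENNReal.ofReal (c * tailDet m n α t) ∧ 0 ≤ tailDet m n α t := by
  obtain ⟨c, hc⟩ := eval_detMoment_blockScale m n α
  have hmp : MeasurePreserving (fun p : (Fin m → Fin n → ℂ) × (Fin n → Fin n → ℂ) =>
      Fin.append p.1 p.2) ((gaussianMatrix (Fin m) (Fin n)).prod (gaussianMatrix (Fin n) (Fin n)))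
      (gaussianMatrix (Fin (m + n)) (Fin n)) := measurePreserving_append _ m n
  have key : ∀ t : ℝ, 0 ≤ t →
      ∫⁻ z, shiftedMoment α ((t : ℂ) • outerSum z) ∂gaussianMatrix (Fin m) (Fin n) =
        ENNReal.ofReal (c * (tailDet m n α t : ℂ)).re ∧ 0 ≤ (c * (tailDet m n α t : ℂ)).re := by
    intro t ht
    have hmeas : Measurable fun z : Fin (m + n) → Fin n → ℂ =>
        ENNReal.ofReal ((scaledWishart (blockScale m n t) z).det.re ^ α) := by
      refine Measurable.ennreal_ofReal (Continuous.measurable ?_)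
      refine (Complex.continuous_re.comp (Continuous.matrix_det ?_)).pow α
      unfold scaledWishart
      fun_prop
    have h1 : ∫⁻ z, shiftedMoment α ((t : ℂ) • outerSum z) ∂gaussianMatrix (Fin m) (Fin n) =
        ∫⁻ z, ENNReal.ofReal ((scaledWishart (blockScale m n t) z).det.re ^ α)
          ∂gaussianMatrix (Fin (m + n)) (Fin n) := by
      rw [← hmp.lintegral_comp hmeas, lintegral_prod (fun p : (Fin m → Fin n → ℂ) × (Fin n → Fin n → ℂ) => ENNReal.ofReal
          ((scaledWishart (blockScale m n t) (Fin.append p.1 p.2)).det.re ^ α))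
          (hmeas.comp hmp.measurable).aemeasurable]
      simp only [scaledWishart_blockScale, shiftedMoment]
    have hint : Integrable (fun z => (scaledWishart (blockScale m n t) z).det.re ^ α)
        (gaussianMatrix (Fin (m + n)) (Fin n)) := by
      refine (integrable_det_scaledWishart_pow (blockScale m n t) α).re.congr
        (Eventually.of_forall fun z => ?_)
      simp only [← (ofReal_re_scaledWishart_pow ht α z).2]
      exact Complex.ofReal_re _
    have hre : (c * (tailDet m n α t : ℂ)).re =
        ∫ z, (scaledWishart (blockScale m n t) z).det.re ^ α
          ∂gaussianMatrix (Fin (m + n)) (Fin n) := by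
      rw [← hc t, ← integral_det_scaledWishart_pow]
      simp only [← (ofReal_re_scaledWishart_pow ht α _).2]
      rw [integral_complex_ofReal, Complex.ofReal_re]
    have hnn : ∀ z, 0 ≤ (scaledWishart (blockScale m n t) z).det.re ^ α := fun z =>
      pow_nonneg (ofReal_re_scaledWishart_pow ht α z).1 α
    rw [h1, ← ofReal_integral_eq_lintegral_ofReal hint (Eventually.of_forall hnn), hre]
    exact ⟨rfl, integral_nonneg hnn⟩
  have h0 := (key 0 le_rfl).1
  simp only [Complex.ofReal_zero, zero_smul, lintegral_const, measure_univ, mul_one, tailDet_zero,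
    Complex.ofReal_one] at h0
  have hcpos : 0 < c.re := by
    by_contra hneg
    rw [ENNReal.ofReal_of_nonpos (not_lt.1 hneg)] at h0
    exact shiftedMoment_zero_ne_zero α h0
  have hmul : ∀ t, (c * (tailDet m n α t : ℂ)).re = c.re * tailDet m n α t := fun t => by
    rw [mul_comm, Complex.re_ofReal_mul, mul_comm]
  refine ⟨c.re, hcpos, fun t ht => ?_⟩
  have h := key t ht
  rw [hmul] at h
  exact ⟨h.1, nonneg_of_mul_nonneg_right h.2 hcpos⟩

lemma tailDet_nonneg (m n α : ℕ) {t : ℝ} (ht : 0 ≤ t) : 0 ≤ tailDet m n α t := by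
  obtain ⟨_, _, h⟩ := lintegral_shiftedMoment_smul m n α
  exact (h t ht).2

lemma isHermitian_real_smul {A : Matrix κ κ ℂ} (hA : A.IsHermitian) (a : ℝ) :
    ((a : ℂ) • A).IsHermitian := by
  rw [IsHermitian, conjTranspose_smul, hA.eq, Complex.star_def, Complex.conj_ofReal]

lemma measurableSet_posDef_outerSum_add {ι' : Type*} [Fintype ι'] (a b : ℝ) :
    MeasurableSet {p : (ι → κ → ℂ) × (ι' → κ → ℂ) |
      ((a : ℂ) • outerSum p.1 + (b : ℂ) • outerSum p.2).PosDef} := by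
  classical
  have hc : Continuous fun p : (ι → κ → ℂ) × (ι' → κ → ℂ) =>
      hermCoord ((a : ℂ) • outerSum p.1 + (b : ℂ) • outerSum p.2) := by
    have h1 := continuous_outerSum (ι := ι) (κ := κ)
    have h2 := continuous_outerSum (ι := ι') (κ := κ)
    refine continuous_hermCoord.comp ?_
    fun_prop
  have h : {p : (ι → κ → ℂ) × (ι' → κ → ℂ) |
        ((a : ℂ) • outerSum p.1 + (b : ℂ) • outerSum p.2).PosDef} =
      (fun p => hermCoord ((a : ℂ) • outerSum p.1 + (b : ℂ) • outerSum p.2)) ⁻¹' pdCone κ := by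
    ext p
    rw [Set.mem_preimage, pdCone, Set.mem_ofPred_eq, Set.mem_ofPred_eq, herm_hermCoord
      ((isHermitian_real_smul (posSemidef_outerSum _).1 a).add
        (isHermitian_real_smul (posSemidef_outerSum _).1 b))]
  rw [h]
  exact hc.measurable measurableSet_pdCone

lemma measurableSet_posDef_outerSum_sub {ι' : Type*} [Fintype ι'] (s : ℝ) :
    MeasurableSet {p : (ι → κ → ℂ) × (ι' → κ → ℂ) |
      (outerSum p.1 - (s : ℂ) • outerSum p.2).PosDef} := by
  simpa [sub_eq_add_neg] using measurableSet_posDef_outerSum_add (ι := ι) (ι' := ι') (κ := κ) 1 (-s)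

/-- Condition on the second matrix and use the Loewner tail with `B = sW₂`. The tilt `exp(-s tr W₂)`
rescales `W₂` by `1/(1 + s) = 1 - t`, and `s(1 - t) = t`; the constant `c` cancels. -/
theorem measure_posDef_outerSum_sub_smul (m n α : ℕ) {t : ℝ} (ht : 0 ≤ t) (ht1 : t < 1) :
    ((gaussianMatrix (Fin (n + α)) (Fin n)).prod (gaussianMatrix (Fin m) (Fin n)))
        {p | (outerSum p.1 - ((t / (1 - t) : ℝ) : ℂ) • outerSum p.2).PosDef} =
      ENNReal.ofReal ((1 - t) ^ (n * m) * tailDet m n α t) := by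
  obtain ⟨c, hc, hmom⟩ := lintegral_shiftedMoment_smul m n α
  set s := t / (1 - t) with hs
  have h1t : 0 < 1 - t := by linarith
  have hs0 : 0 ≤ s := div_nonneg ht h1t.le
  have h1s : 1 + s = (1 - t)⁻¹ := by rw [hs]; field_simp; ring
  have h0 : shiftedMoment (κ := Fin n) α 0 = ENNReal.ofReal c := by
    have h := (hmom 0 le_rfl).1
    simpa [tailDet_zero] using h
  have hf : Measurable fun z : Fin m → Fin n → ℂ => shiftedMoment α ((s : ℂ) • outerSum z) := by
    unfold shiftedMoment
    refine Measurable.lintegral_prod_right' (f := fun p : (Fin m → Fin n → ℂ) × (Fin n → Fin n → ℂ) =>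
      ENNReal.ofReal ((outerSum p.2 + (s : ℂ) • outerSum p.1).det.re ^ α)) ?_
    refine Measurable.ennreal_ofReal (Continuous.measurable ?_)
    have h1 := continuous_outerSum (ι := Fin m) (κ := Fin n)
    have h2 := continuous_outerSum (ι := Fin n) (κ := Fin n)
    refine (Complex.continuous_re.comp (Continuous.matrix_det ?_)).pow α
    fun_prop
  have hmul : ENNReal.ofReal c *
      ((gaussianMatrix (Fin (n + α)) (Fin n)).prod (gaussianMatrix (Fin m) (Fin n)))
        {p | (outerSum p.1 - (s : ℂ) • outerSum p.2).PosDef} =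
      ENNReal.ofReal c * ENNReal.ofReal ((1 - t) ^ (n * m) * tailDet m n α t) := by
    rw [Measure.prod_apply_symm (measurableSet_posDef_outerSum_sub (ι := Fin (n + α)) (ι' := Fin m) s), ← h0,
      ← lintegral_const_mul' _ _ (shiftedMoment_zero_ne_top α)]
    have hz : ∀ z : Fin m → Fin n → ℂ, shiftedMoment (κ := Fin n) α 0 *
        gaussianMatrix (Fin (n + α)) (Fin n) ((fun x => (x, z)) ⁻¹'
          {p | (outerSum p.1 - (s : ℂ) • outerSum p.2).PosDef}) =
        ENNReal.ofReal (Real.exp (-(s * (outerSum z).trace.re))) *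
          shiftedMoment α ((s : ℂ) • outerSum z) := by
      intro z
      have hps : ((s : ℂ) • outerSum z).PosSemidef :=
        (posSemidef_outerSum z).smul (by simpa using hs0)
      have h := measure_posDef_outerSum_sub (ι := Fin (n + α)) (κ := Fin n) (α := α) (by simp) hps
      rw [trace_smul, smul_eq_mul, Complex.re_ofReal_mul] at h
      exact h
    simp only [hz]
    rw [lintegral_exp_neg_trace_mul hs0 hf]
    have hscale : ∀ z : Fin m → Fin n → ℂ,
        (s : ℂ) • outerSum ((Real.sqrt (1 + s))⁻¹ • z) = (t : ℂ) • outerSum z := by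
      intro z
      rw [outerSum_smul, smul_smul, ← Complex.ofReal_mul, inv_pow, Real.sq_sqrt (by linarith), h1s,
        inv_inv, hs, div_mul_cancel₀ _ h1t.ne']
    simp only [hscale]
    rw [(hmom t ht).1, h0, h1s, inv_pow, inv_inv, ← ENNReal.ofReal_mul (by positivity),
      ← ENNReal.ofReal_mul hc.le, Fintype.card_fin, Fintype.card_fin, mul_comm m n]
    congr 1
    ring
  exact (ENNReal.mul_right_inj (by simpa using hc) ENNReal.ofReal_ne_top).1 hmul

end ExactTail

/-! ### Eigenvalues of the double Wishart matrix -/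

section Eigenvalues

open Matrix

variable {κ : Type*} [Fintype κ] [DecidableEq κ]

lemma posDef_smul_add_smul_one_iff {H : Matrix κ κ ℂ} (hH : H.IsHermitian) (a b : ℝ) :
    ((a : ℂ) • H + (b : ℂ) • (1 : Matrix κ κ ℂ)).PosDef ↔ ∀ i, 0 < a * hH.eigenvalues i + b := by
  set V := hH.eigenvectorUnitary
  have hV : (V : Matrix κ κ ℂ) * star (V : Matrix κ κ ℂ) = 1 := Unitary.coe_mul_star_self V
  have hs : H = (V : Matrix κ κ ℂ) * diagonal (fun k => (hH.eigenvalues k : ℂ)) *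
      star (V : Matrix κ κ ℂ) := by
    have := hH.spectral_theorem
    rwa [Unitary.conjStarAlgAut_apply] at this
  have hu : IsUnit (V : Matrix κ κ ℂ) := by
    rw [isUnit_iff_isUnit_det]
    exact isUnit_det_of_right_inverse hV
  have h : (a : ℂ) • H + (b : ℂ) • (1 : Matrix κ κ ℂ) = (V : Matrix κ κ ℂ) *
      diagonal (fun k => ((a * hH.eigenvalues k + b : ℝ) : ℂ)) * star (V : Matrix κ κ ℂ) := by
    have hd : diagonal (fun k => ((a * hH.eigenvalues k + b : ℝ) : ℂ)) =
        (a : ℂ) • diagonal (fun k => (hH.eigenvalues k : ℂ)) + (b : ℂ) • (1 : Matrix κ κ ℂ) := by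
      rw [← diagonal_one, ← diagonal_smul, ← diagonal_smul, diagonal_add]
      congr 1
      ext k
      simp
    rw [hd, Matrix.mul_add, Matrix.add_mul, Matrix.mul_smul, Matrix.smul_mul, ← hs, Matrix.mul_smul,
      Matrix.smul_mul, mul_one, hV]
  rw [h, hu.posDef_star_right_conjugate_iff, posDef_diagonal_iff]
  simp only [Complex.zero_lt_real]

/-- With `B† A B = 1`, `A⁻¹W` is similar to the Hermitian matrix `B†WB`, and congruence by `B` sends
`aW + bA` to `aB†WB + b`. Spectrum and definiteness are thus governed by the same eigenvalues. -/
lemma exists_range_eq_real_spectrum {A W : Matrix κ κ ℂ} (hA : A.PosDef) (hW : W.IsHermitian) :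
    ∃ e : κ → ℝ, {t : ℝ | (t : ℂ) ∈ spectrum ℂ (A⁻¹ * W)} = Set.range e ∧
      ∀ a b : ℝ, ((a : ℂ) • W + (b : ℂ) • A).PosDef ↔ ∀ i, 0 < a * e i + b := by
  obtain ⟨B, hB, hdet⟩ := exists_conjTranspose_mul_mul_eq_one hA
  have hBu : IsUnit B := by
    rw [isUnit_iff_isUnit_det, isUnit_iff_ne_zero]
    exact hdet
  have hAinv : A⁻¹ = B * Bᴴ := by
    refine inv_eq_left_inv ?_
    have h1 : B * (Bᴴ * A) = 1 := mul_eq_one_comm.1 hB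
    rw [Matrix.mul_assoc, h1]
  have hH : (Bᴴ * W * B).IsHermitian := isHermitian_conjTranspose_mul_mul B hW
  refine ⟨hH.eigenvalues, ?_, fun a b => ?_⟩
  · obtain ⟨u, hu⟩ := hBu
    have hsim : A⁻¹ * W = (u : Matrix κ κ ℂ) * (Bᴴ * W * B) * ((u⁻¹ : (Matrix κ κ ℂ)ˣ) : _) := by
      rw [hAinv, ← hu]
      simp only [Matrix.mul_assoc, Units.mul_inv, mul_one]
    rw [hsim, spectrum.units_conjugate, hH.spectrum_eq_image_range]
    ext t
    constructor
    · rintro ⟨y, ⟨i, rfl⟩, hy⟩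
      exact ⟨i, Complex.ofReal_injective hy⟩
    · rintro ⟨i, rfl⟩
      exact ⟨_, ⟨i, rfl⟩, rfl⟩
  · rw [← posDef_smul_add_smul_one_iff hH a b, ← hB, ← hBu.posDef_star_left_conjugate_iff]
    simp only [star_eq_conjTranspose, Matrix.mul_add, Matrix.add_mul, Matrix.mul_smul,
      Matrix.smul_mul]

/-- The matrix on the right is `W₁ - t(W₁ + W₂)`. Size zero is excluded because the infimum of the
empty spectrum defaults to `0`. -/
lemma lt_smallestEigenvalue_iff {n : ℕ} (hn : n ≠ 0) {W₁ W₂ : Matrix (Fin n) (Fin n) ℂ}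
    (h₁ : W₁.IsHermitian) (h : (W₁ + W₂).PosDef) (t : ℝ) :
    t < smallestEigenvalue ((W₁ + W₂)⁻¹ * W₁) ↔
      (((1 - t : ℝ) : ℂ) • W₁ + ((-t : ℝ) : ℂ) • W₂).PosDef := by
  have : Nonempty (Fin n) := Fin.pos_iff_nonempty.1 (Nat.pos_of_ne_zero hn)
  obtain ⟨e, he, hpd⟩ := exists_range_eq_real_spectrum h h₁
  have hm : ((1 - t : ℝ) : ℂ) • W₁ + ((-t : ℝ) : ℂ) • W₂ =
      ((1 : ℝ) : ℂ) • W₁ + ((-t : ℝ) : ℂ) • (W₁ + W₂) := by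
    push_cast
    module
  rw [smallestEigenvalue, he, hm, hpd, (Set.finite_range e).lt_csInf_iff (Set.range_nonempty e)]
  simp only [Set.forall_mem_range, one_mul, ← sub_eq_add_neg, sub_pos]

lemma largestEigenvalue_lt_iff {n : ℕ} (hn : n ≠ 0) {W₁ W₂ : Matrix (Fin n) (Fin n) ℂ}
    (h₁ : W₁.IsHermitian) (h : (W₁ + W₂).PosDef) (t : ℝ) :
    largestEigenvalue ((W₁ + W₂)⁻¹ * W₁) < t ↔
      (((t - 1 : ℝ) : ℂ) • W₁ + (t : ℂ) • W₂).PosDef := by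
  have : Nonempty (Fin n) := Fin.pos_iff_nonempty.1 (Nat.pos_of_ne_zero hn)
  obtain ⟨e, he, hpd⟩ := exists_range_eq_real_spectrum h h₁
  have hm : ((t - 1 : ℝ) : ℂ) • W₁ + (t : ℂ) • W₂ =
      ((-1 : ℝ) : ℂ) • W₁ + (t : ℂ) • (W₁ + W₂) := by
    push_cast
    module
  rw [largestEigenvalue, he, hm, hpd, (Set.finite_range e).csSup_lt_iff (Set.range_nonempty e)]
  refine Set.forall_mem_range.trans (forall_congr' fun i => ?_)
  rw [neg_one_mul, neg_add_eq_sub, sub_pos]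

lemma posDef_smul_iff_of_pos {A : Matrix κ κ ℂ} {c : ℝ} (hc : 0 < c) :
    ((c : ℂ) • A).PosDef ↔ A.PosDef := by
  refine ⟨fun h => ?_, fun h => h.smul (by simpa using hc)⟩
  have h2 := h.smul (α := ℂ) (a := ((c⁻¹ : ℝ) : ℂ)) (by rw [Complex.zero_lt_real]; positivity)
  rwa [smul_smul, ← Complex.ofReal_mul, inv_mul_cancel₀ hc.ne', Complex.ofReal_one, one_smul] at h2

lemma posDef_sub_div_smul_iff {A B : Matrix κ κ ℂ} {t : ℝ} (ht : t < 1) :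
    (A - ((t / (1 - t) : ℝ) : ℂ) • B).PosDef ↔
      (((1 - t : ℝ) : ℂ) • A + ((-t : ℝ) : ℂ) • B).PosDef := by
  have h : ((1 - t : ℝ) : ℂ) • A + ((-t : ℝ) : ℂ) • B =
      ((1 - t : ℝ) : ℂ) • (A - ((t / (1 - t) : ℝ) : ℂ) • B) := by
    rw [smul_sub, smul_smul, ← Complex.ofReal_mul, mul_div_cancel₀ _ (by linarith : 1 - t ≠ 0),
      Complex.ofReal_neg, neg_smul, ← sub_eq_add_neg]
  rw [h, posDef_smul_iff_of_pos (by linarith)]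

end Eigenvalues

/-! ### The distribution of the extreme eigenvalues -/

section Distribution

open Matrix

variable {Ω : Type*} [MeasurableSpace Ω] {μ : Measure Ω} {m n : ℕ}

/-- The columns of `X†`. -/
def conjRows (X : Matrix (Fin m) (Fin n) ℂ) : Fin m → Fin n → ℂ := fun k => Xᴴ.col k

lemma wishart_eq_outerSum (X : Matrix (Fin m) (Fin n) ℂ) : wishart X = outerSum (conjRows X) := by
  ext i j
  rw [wishart, mul_apply, outerSum, Matrix.sum_apply]
  refine Finset.sum_congr rfl fun k _ => ?_
  simp [vecMulVec_apply, conjRows]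

lemma posSemidef_wishart (X : Matrix (Fin m) (Fin n) ℂ) : (wishart X).PosSemidef := by
  rw [wishart_eq_outerSum]
  exact posSemidef_outerSum _

lemma outerSum_mulVec {ι κ : Type*} [Fintype ι] [Fintype κ] (B : Matrix κ κ ℂ) (z : ι → κ → ℂ) :
    outerSum (fun k => B *ᵥ z k) = B * outerSum z * Bᴴ := by
  rw [outerSum, outerSum, Matrix.mul_sum, Matrix.sum_mul]
  refine Finset.sum_congr rfl fun k _ => ?_
  rw [star_mulVec, Matrix.mul_vecMulVec, Matrix.vecMulVec_mul]

lemma IsComplexGaussianMatrix.aemeasurable_conjRows {X : Ω → Matrix (Fin m) (Fin n) ℂ}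
    {S : Matrix (Fin n) (Fin n) ℂ} (hX : IsComplexGaussianMatrix X S μ) :
    AEMeasurable (fun ω => conjRows (X ω)) μ :=
  aemeasurable_pi_lambda _ fun k => (hX.hasLaw_col k).aemeasurable

lemma IsComplexGaussianMatrix.map_conjRows [IsProbabilityMeasure μ]
    {X : Ω → Matrix (Fin m) (Fin n) ℂ}
    {S : Matrix (Fin n) (Fin n) ℂ} (hX : IsComplexGaussianMatrix X S μ) {B : Matrix (Fin n) (Fin n) ℂ}
    (hB : complexGaussian S = (Measure.pi fun _ => stdGaussian).map (B *ᵥ ·)) :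
    μ.map (fun ω => conjRows (X ω)) =
      (gaussianMatrix (Fin m) (Fin n)).map (fun z k => B *ᵥ z k) := by
  have hBm : Measurable fun z : Fin n → ℂ => B *ᵥ z := Continuous.measurable (by fun_prop)
  have h := (iIndepFun_iff_map_fun_eq_pi_map fun k => (hX.hasLaw_col k).aemeasurable).1 hX.indep_col
  simp only [fun k => (hX.hasLaw_col k).map_eq] at h
  have : IsProbabilityMeasure
      ((Measure.pi fun _ : Fin n => stdGaussian).map fun z => B *ᵥ z) :=
    Measure.isProbabilityMeasure_map hBm.aemeasurable
  rw [hB] at h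
  rw [gaussianMatrix, Measure.pi_map_pi (fun _ => hBm.aemeasurable)]
  exact h

/-- The covariance disappears: both Wishart matrices are congruent, by the same invertible `B`, to
standard ones, and definiteness of the difference is unaffected. -/
lemma measure_posDef_wishart_sub [IsProbabilityMeasure μ] {α : ℕ} {S : Matrix (Fin n) (Fin n) ℂ}
    (hS : S.PosDef) {X : Ω → Matrix (Fin (n + α)) (Fin n) ℂ} {Y : Ω → Matrix (Fin m) (Fin n) ℂ}
    (hX : IsComplexGaussianMatrix X S μ) (hY : IsComplexGaussianMatrix Y S μ)
    (hXY : IndepFun (fun ω i j => X ω i j) (fun ω i j => Y ω i j) μ) {t : ℝ} (ht : 0 ≤ t)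
    (ht1 : t < 1) :
    μ {ω | (wishart (X ω) - ((t / (1 - t) : ℝ) : ℂ) • wishart (Y ω)).PosDef} =
      ENNReal.ofReal ((1 - t) ^ (n * m) * tailDet m n α t) := by
  obtain ⟨B, hdet, hB⟩ := complexGaussian_eq_map hS
  have hBu : IsUnit B := by
    rw [isUnit_iff_isUnit_det, isUnit_iff_ne_zero]
    exact hdet
  set s := t / (1 - t) with hs
  have hms := measurableSet_posDef_outerSum_sub (ι := Fin (n + α)) (ι' := Fin m) (κ := Fin n) s
  have hstar : ∀ {k : ℕ}, Measurable fun (x : Fin k → Fin n → ℂ) i j => star (x i j) := by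
    intro k
    exact Continuous.measurable (by fun_prop)
  have hind : IndepFun (fun ω => conjRows (X ω)) (fun ω => conjRows (Y ω)) μ :=
    hXY.comp hstar hstar
  have hmap := (indepFun_iff_map_prod_eq_prod_map_map hX.aemeasurable_conjRows
    hY.aemeasurable_conjRows).1 hind
  have hBm : ∀ {k : ℕ}, Measurable fun (z : Fin k → Fin n → ℂ) i => B *ᵥ z i := by
    intro k
    exact Continuous.measurable (by fun_prop)
  rw [hX.map_conjRows hB, hY.map_conjRows hB, Measure.map_prod_map _ _ hBm hBm] at hmap
  have h1 : μ {ω | (wishart (X ω) - (s : ℂ) • wishart (Y ω)).PosDef} =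
      μ.map (fun ω => (conjRows (X ω), conjRows (Y ω)))
        {p | (outerSum p.1 - (s : ℂ) • outerSum p.2).PosDef} := by
    rw [Measure.map_apply_of_aemeasurable
      (hX.aemeasurable_conjRows.prodMk hY.aemeasurable_conjRows) hms]
    simp only [wishart_eq_outerSum]
    rfl
  rw [h1, hmap, Measure.map_apply (hBm.prodMap hBm) hms, ← measure_posDef_outerSum_sub_smul m n α ht ht1]
  congr 1
  ext p
  rw [Set.mem_preimage, Set.mem_ofPred_eq, Set.mem_ofPred_eq, Prod.map_fst, Prod.map_snd,
    outerSum_mulVec, outerSum_mulVec, ← hBu.posDef_star_right_conjugate_iff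
      (x := outerSum p.1 - (s : ℂ) • outerSum p.2)]
  simp only [star_eq_conjTranspose, Matrix.mul_sub, Matrix.sub_mul, Matrix.mul_smul,
    Matrix.smul_mul]

/-- The tail probability of the smallest eigenvalue. -/
def tailProb (m n α : ℕ) (t : ℝ) : ℝ := (1 - t) ^ (n * m) * tailDet m n α t

lemma tailProb_zero (m n α : ℕ) : tailProb m n α 0 = 1 := by
  rw [tailProb, tailDet_zero, sub_zero, one_pow, mul_one]

lemma tailProb_nonneg (m n α : ℕ) {t : ℝ} (ht : 0 ≤ t) (ht1 : t < 1) : 0 ≤ tailProb m n α t :=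
  mul_nonneg (pow_nonneg (by linarith) _) (tailDet_nonneg m n α ht)

/-- Rules out atoms of the largest eigenvalue where strict inequalities are replaced by weak ones.
-/
lemma continuous_tailProb (m n α : ℕ) : Continuous (tailProb m n α) := by
  have hent : ∀ a b : Fin α, Continuous fun t : ℝ =>
      toeplitz ((Polynomial.X + Polynomial.C t) ^ m * (Polynomial.X + 1) ^ n) m α a b := by
    intro a b
    have hc : ∀ k, Continuous fun t : ℝ => ((Polynomial.X + Polynomial.C t) ^ m).coeff k := by
      intro k
      simp only [Polynomial.coeff_X_add_C_pow]
      fun_prop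
    simp only [toeplitz, of_apply, Polynomial.coeff_mul, ← mul_assoc]
    refine continuous_finsetSum _ fun p _ => ?_
    refine Continuous.mul (continuous_finsetSum _ fun q _ => ?_) continuous_const
    exact continuous_const.mul (hc _)
  unfold tailProb tailDet
  refine Continuous.mul (by fun_prop) (Continuous.matrix_det ?_)
  exact continuous_matrix hent

variable {α : ℕ}

/-- The exact formula at `t = 0` says that the first Wishart matrix is positive definite with
probability one. -/
lemma ae_posDef_wishart [IsProbabilityMeasure μ] {S : Matrix (Fin n) (Fin n) ℂ}
    (hS : S.PosDef) {X : Ω → Matrix (Fin (n + α)) (Fin n) ℂ} {Y : Ω → Matrix (Fin m) (Fin n) ℂ}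
    (hX : IsComplexGaussianMatrix X S μ) (hY : IsComplexGaussianMatrix Y S μ)
    (hXY : IndepFun (fun ω i j => X ω i j) (fun ω i j => Y ω i j) μ) :
    ∀ᵐ ω ∂μ, (wishart (X ω) + wishart (Y ω)).PosDef := by
  have h := measure_posDef_wishart_sub hS hX hY hXY le_rfl zero_lt_one
  simp only [zero_div, Complex.ofReal_zero, zero_smul, sub_zero, one_pow, tailDet_zero, one_mul,
    ENNReal.ofReal_one] at h
  have hm : NullMeasurableSet {ω | (wishart (X ω)).PosDef} μ := by
    have := (hX.aemeasurable_conjRows.prodMk hY.aemeasurable_conjRows).nullMeasurableSet_preimage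
      (measurableSet_posDef_outerSum_sub (ι := Fin (n + α)) (ι' := Fin m) (κ := Fin n) 0)
    convert this using 1
    ext ω
    simp [wishart_eq_outerSum]
  have hae : ∀ᵐ ω ∂μ, (wishart (X ω)).PosDef := (prob_compl_eq_zero_iff₀ hm).2 h
  filter_upwards [hae] with ω hω
  exact hω.add_posSemidef (posSemidef_wishart _)

-- The extreme eigenvalues are shown measurable only where `W₁ + W₂` is positive definite, through
-- their definiteness criteria; replacing them by `0` elsewhere changes a null set.
open scoped Classical in
lemma aemeasurable_of_posDef [IsProbabilityMeasure μ] {S : Matrix (Fin n) (Fin n) ℂ}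
    (hS : S.PosDef) {X : Ω → Matrix (Fin (n + α)) (Fin n) ℂ} {Y : Ω → Matrix (Fin m) (Fin n) ℂ}
    (hX : IsComplexGaussianMatrix X S μ) (hY : IsComplexGaussianMatrix Y S μ)
    (hXY : IndepFun (fun ω i j => X ω i j) (fun ω i j => Y ω i j) μ)
    {g : Matrix (Fin n) (Fin n) ℂ → Matrix (Fin n) (Fin n) ℂ → ℝ}
    (hg : Measurable fun p : (Fin (n + α) → Fin n → ℂ) × (Fin m → Fin n → ℂ) =>
      if (outerSum p.1 + outerSum p.2).PosDef then g (outerSum p.1) (outerSum p.2) else 0) :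
    AEMeasurable (fun ω => g (wishart (X ω)) (wishart (Y ω))) μ := by
  have h := hg.comp_aemeasurable (hX.aemeasurable_conjRows.prodMk hY.aemeasurable_conjRows)
  refine h.congr ?_
  filter_upwards [ae_posDef_wishart hS hX hY hXY] with ω hω
  rw [wishart_eq_outerSum, wishart_eq_outerSum] at hω ⊢
  simp only [Function.comp_apply, hω, if_true]

lemma measurableSet_posDef_outerSum_add_outerSum {k : ℕ} : MeasurableSet
    {p : (Fin k → Fin n → ℂ) × (Fin m → Fin n → ℂ) | (outerSum p.1 + outerSum p.2).PosDef} := by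
  simpa using measurableSet_posDef_outerSum_add (ι := Fin k) (ι' := Fin m) (κ := Fin n) 1 1

open scoped Classical in
lemma measurable_smallestEigenvalue (hn : n ≠ 0) {k : ℕ} :
    Measurable fun p : (Fin k → Fin n → ℂ) × (Fin m → Fin n → ℂ) =>
      if (outerSum p.1 + outerSum p.2).PosDef then
        smallestEigenvalue ((outerSum p.1 + outerSum p.2)⁻¹ * outerSum p.1) else 0 := by
  refine measurable_of_Ioi fun t => ?_
  have h : (fun p : (Fin k → Fin n → ℂ) × (Fin m → Fin n → ℂ) =>
      if (outerSum p.1 + outerSum p.2).PosDef then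
        smallestEigenvalue ((outerSum p.1 + outerSum p.2)⁻¹ * outerSum p.1) else 0) ⁻¹' Set.Ioi t =
      ({p | (outerSum p.1 + outerSum p.2).PosDef} ∩
        {p | (((1 - t : ℝ) : ℂ) • outerSum p.1 + ((-t : ℝ) : ℂ) • outerSum p.2).PosDef}) ∪
      ({p | (outerSum p.1 + outerSum p.2).PosDef}ᶜ ∩ {_p | t < 0}) := by
    ext p
    by_cases hp : (outerSum p.1 + outerSum p.2).PosDef
    · simp only [Set.mem_preimage, Set.mem_Ioi, Set.mem_union, Set.mem_inter_iff, Set.mem_ofPred_eq,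
        Set.mem_compl_iff, hp, if_true, true_and, not_true, false_and, or_false]
      exact lt_smallestEigenvalue_iff hn (posSemidef_outerSum p.1).1 hp t
    · simp [hp]
  rw [h]
  exact (measurableSet_posDef_outerSum_add_outerSum.inter
    (measurableSet_posDef_outerSum_add _ _)).union
    (measurableSet_posDef_outerSum_add_outerSum.compl.inter (MeasurableSet.const _))

open scoped Classical in
lemma measurable_largestEigenvalue (hn : n ≠ 0) {k : ℕ} :
    Measurable fun p : (Fin k → Fin n → ℂ) × (Fin m → Fin n → ℂ) =>
      if (outerSum p.1 + outerSum p.2).PosDef then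
        largestEigenvalue ((outerSum p.1 + outerSum p.2)⁻¹ * outerSum p.1) else 0 := by
  refine measurable_of_Iio fun t => ?_
  have h : (fun p : (Fin k → Fin n → ℂ) × (Fin m → Fin n → ℂ) =>
      if (outerSum p.1 + outerSum p.2).PosDef then
        largestEigenvalue ((outerSum p.1 + outerSum p.2)⁻¹ * outerSum p.1) else 0) ⁻¹' Set.Iio t =
      ({p | (outerSum p.1 + outerSum p.2).PosDef} ∩
        {p | (((t - 1 : ℝ) : ℂ) • outerSum p.1 + (t : ℂ) • outerSum p.2).PosDef}) ∪
      ({p | (outerSum p.1 + outerSum p.2).PosDef}ᶜ ∩ {_p | 0 < t}) := by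
    ext p
    by_cases hp : (outerSum p.1 + outerSum p.2).PosDef
    · simp only [Set.mem_preimage, Set.mem_Iio, Set.mem_union, Set.mem_inter_iff, Set.mem_ofPred_eq,
        Set.mem_compl_iff, hp, if_true, true_and, not_true, false_and, or_false]
      exact largestEigenvalue_lt_iff hn (posSemidef_outerSum p.1).1 hp t
    · simp [hp]
  rw [h]
  exact (measurableSet_posDef_outerSum_add_outerSum.inter
    (measurableSet_posDef_outerSum_add _ _)).union
    (measurableSet_posDef_outerSum_add_outerSum.compl.inter (MeasurableSet.const _))

lemma aemeasurable_smallestEigenvalue [IsProbabilityMeasure μ] (hn : n ≠ 0)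
    {S : Matrix (Fin n) (Fin n) ℂ} (hS : S.PosDef) {X : Ω → Matrix (Fin (n + α)) (Fin n) ℂ}
    {Y : Ω → Matrix (Fin m) (Fin n) ℂ}
    (hX : IsComplexGaussianMatrix X S μ) (hY : IsComplexGaussianMatrix Y S μ)
    (hXY : IndepFun (fun ω i j => X ω i j) (fun ω i j => Y ω i j) μ) :
    AEMeasurable (fun ω => smallestEigenvalue (doubleWishart (X ω) (Y ω))) μ :=
  aemeasurable_of_posDef hS hX hY hXY
    (g := fun W₁ W₂ => smallestEigenvalue ((W₁ + W₂)⁻¹ * W₁)) (measurable_smallestEigenvalue hn)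

lemma aemeasurable_largestEigenvalue [IsProbabilityMeasure μ] (hn : n ≠ 0)
    {S : Matrix (Fin n) (Fin n) ℂ} (hS : S.PosDef) {X : Ω → Matrix (Fin (n + α)) (Fin n) ℂ}
    {Y : Ω → Matrix (Fin m) (Fin n) ℂ}
    (hX : IsComplexGaussianMatrix X S μ) (hY : IsComplexGaussianMatrix Y S μ)
    (hXY : IndepFun (fun ω i j => X ω i j) (fun ω i j => Y ω i j) μ) :
    AEMeasurable (fun ω => largestEigenvalue (doubleWishart (X ω) (Y ω))) μ :=
  aemeasurable_of_posDef hS hX hY hXY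
    (g := fun W₁ W₂ => largestEigenvalue ((W₁ + W₂)⁻¹ * W₁)) (measurable_largestEigenvalue hn)

theorem measure_lt_smallestEigenvalue [IsProbabilityMeasure μ] (hn : n ≠ 0)
    {S : Matrix (Fin n) (Fin n) ℂ} (hS : S.PosDef) {X : Ω → Matrix (Fin (n + α)) (Fin n) ℂ}
    {Y : Ω → Matrix (Fin m) (Fin n) ℂ}
    (hX : IsComplexGaussianMatrix X S μ) (hY : IsComplexGaussianMatrix Y S μ)
    (hXY : IndepFun (fun ω i j => X ω i j) (fun ω i j => Y ω i j) μ) {t : ℝ} (ht : 0 ≤ t)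
    (ht1 : t < 1) :
    μ {ω | t < smallestEigenvalue (doubleWishart (X ω) (Y ω))} =
      ENNReal.ofReal (tailProb m n α t) := by
  rw [tailProb, ← measure_posDef_wishart_sub hS hX hY hXY ht ht1]
  refine measure_congr ?_
  filter_upwards [ae_posDef_wishart hS hX hY hXY] with ω hω
  refine propext ?_
  refine (lt_smallestEigenvalue_iff hn (posSemidef_wishart _).1 hω t).trans ?_
  exact (posDef_sub_div_smul_iff ht1).symm

/-- The event is `W₂ > sW₁`, the previous situation with the matrices exchanged; hence `α` is now
the excess of the second one. -/
theorem measure_largestEigenvalue_lt [IsProbabilityMeasure μ] (hn : n ≠ 0)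
    {S : Matrix (Fin n) (Fin n) ℂ} (hS : S.PosDef) {X : Ω → Matrix (Fin m) (Fin n) ℂ}
    {Y : Ω → Matrix (Fin (n + α)) (Fin n) ℂ}
    (hX : IsComplexGaussianMatrix X S μ) (hY : IsComplexGaussianMatrix Y S μ)
    (hXY : IndepFun (fun ω i j => X ω i j) (fun ω i j => Y ω i j) μ) {t : ℝ} (ht : 0 ≤ t)
    (ht1 : t < 1) :
    μ {ω | largestEigenvalue (doubleWishart (X ω) (Y ω)) < 1 - t} =
      ENNReal.ofReal (tailProb m n α t) := by
  rw [tailProb, ← measure_posDef_wishart_sub hS hY hX hXY.symm ht ht1]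
  refine measure_congr ?_
  filter_upwards [ae_posDef_wishart hS hY hX hXY.symm] with ω hω
  refine propext ?_
  refine (largestEigenvalue_lt_iff hn (posSemidef_wishart _).1 (add_comm (wishart (Y ω)) _ ▸ hω)
    (1 - t)).trans ?_
  refine Iff.trans ?_ (posDef_sub_div_smul_iff ht1).symm
  rw [add_comm, sub_sub_cancel_left]

end Distribution

/-! ### The hard edge limit -/

section HardEdge

open Matrix

/-- The index `k` is the power of `t` taken from `(X + t)^m`. Written as a series over all `k`, the
summation range does not depend on `n`, as dominated convergence requires. -/
lemma toeplitz_entry (m n α : ℕ) (t : ℝ) (a b : Fin α) :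
    toeplitz ((Polynomial.X + Polynomial.C t) ^ m * (Polynomial.X + 1) ^ n) m α a b =
      ∑' k : ℕ, if (b : ℕ) ≤ a + k then t ^ k * m.choose k * (n.choose (a + k - b) : ℝ) else 0 := by
  rw [tsum_eq_sum (s := Finset.range (m + 1))]
  · rw [toeplitz, of_apply, add_comm Polynomial.X (Polynomial.C t), add_pow, Finset.sum_mul,
      Finset.mul_sum, Polynomial.finsetSum_coeff]
    refine Finset.sum_congr rfl fun k hk => ?_
    have hkm : k ≤ m := Nat.lt_succ_iff.1 (Finset.mem_range.1 hk)
    have h : (Polynomial.X : Polynomial ℝ) ^ (b : ℕ) * (Polynomial.C t ^ k *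
        Polynomial.X ^ (m - k) * (m.choose k : Polynomial ℝ) * (Polynomial.X + 1) ^ n) =
        Polynomial.C (t ^ k * m.choose k) *
          ((Polynomial.X + 1) ^ n * Polynomial.X ^ (b + (m - k))) := by
      rw [Polynomial.C_mul, Polynomial.C_pow, Polynomial.C_eq_natCast, pow_add]
      ring
    rw [h, Polynomial.coeff_C_mul, Polynomial.coeff_mul_X_pow']
    by_cases hb : (b : ℕ) ≤ a + k
    · rw [if_pos (by omega), if_pos hb, Polynomial.coeff_X_add_one_pow]
      congr 3
      omega
    · rw [if_neg (by omega), if_neg hb, mul_zero]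
  · intro k hk
    rw [Nat.choose_eq_zero_of_lt (by simpa using hk)]
    simp

lemma tendsto_choose_div_pow (β k : ℕ) :
    Tendsto (fun n : ℕ => ((n + β).choose k : ℝ) / (n : ℝ) ^ k) atTop
      (𝓝 (1 / (k.factorial : ℝ))) := by
  have hp : Tendsto (fun N : ℕ => (N : ℝ) * ((N : ℝ) - β)⁻¹) atTop (𝓝 1) := by
    have h1 : Tendsto (fun N : ℕ => ((N : ℝ) - β)) atTop atTop :=
      tendsto_atTop_add_const_right _ _ tendsto_natCast_atTop_atTop
    have h2 : Tendsto (fun N : ℕ => 1 + β * ((N : ℝ) - β)⁻¹) atTop (𝓝 (1 + β * 0)) :=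
      tendsto_const_nhds.add (tendsto_const_nhds.mul (tendsto_inv_atTop_zero.comp h1))
    rw [mul_zero, add_zero] at h2
    refine h2.congr' ?_
    filter_upwards [h1.eventually_gt_atTop 0] with N hN
    field_simp
    ring
  have h := (tendsto_choose_mul_pow_atTop k hp).comp (tendsto_add_atTop_nat β)
  rw [one_pow] at h
  refine h.congr fun n => ?_
  simp only [Function.comp_apply]
  push_cast
  rw [add_sub_cancel_right, inv_pow, div_eq_mul_inv]

/-- The limit of the rescaled entries of the Toeplitz determinant. -/
def hardEdgeEntry (x : ℝ) (a b : ℕ) : ℝ :=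
  ∑' k : ℕ, if b ≤ a + k then x ^ k / (k.factorial * (a + k - b).factorial : ℝ) else 0

/-- The product of binomials grows like `n^(2k + a - b)`; the scale `x/n²` removes `2k` and the
conjugating factor `n^(b - a)` the rest. -/
lemma tendsto_rescaled_entry (α β : ℕ) {x : ℝ} (hx : 0 ≤ x) (a b : Fin α) :
    Tendsto (fun n : ℕ => ((n : ℝ) ^ (a : ℕ))⁻¹ * ((n : ℝ) ^ (b : ℕ) *
      toeplitz ((Polynomial.X + Polynomial.C (x / (n : ℝ) ^ 2)) ^ (n + β) * (Polynomial.X + 1) ^ n)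
        (n + β) α a b)) atTop (𝓝 (hardEdgeEntry x a b)) := by
  have hterm : ∀ (n : ℕ), 1 ≤ n → ∀ k : ℕ, (b : ℕ) ≤ a + k → ((n : ℝ) ^ (a : ℕ))⁻¹ *
      ((n : ℝ) ^ (b : ℕ) * ((x / (n : ℝ) ^ 2) ^ k * (n + β).choose k *
        (n.choose (a + k - b) : ℝ))) =
      x ^ k * (((n + β).choose k : ℝ) / (n : ℝ) ^ k) *
        ((n.choose (a + k - b) : ℝ) / (n : ℝ) ^ (a + k - b : ℕ)) := by
    intro n hn k hk
    have hn0 : (n : ℝ) ≠ 0 := by positivity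
    obtain ⟨j, hj⟩ := Nat.exists_eq_add_of_le hk
    have hj2 : (a : ℕ) + k - b = j := by omega
    rw [hj2]
    have hpow : (n : ℝ) ^ (a : ℕ) * (n : ℝ) ^ k = (n : ℝ) ^ (b : ℕ) * (n : ℝ) ^ j := by
      rw [← pow_add, ← pow_add, hj]
    rw [div_pow, ← pow_mul, mul_comm 2 k, pow_mul, pow_two]
    field_simp
    linear_combination (x ^ k * ((n + β).choose k : ℝ) * (n.choose j : ℝ)) * (-hpow)
  refine (tendsto_tsum_of_dominated_convergence (𝓕 := atTop)
    (f := fun (n : ℕ) (k : ℕ) => ((n : ℝ) ^ (a : ℕ))⁻¹ * ((n : ℝ) ^ (b : ℕ) *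
      if (b : ℕ) ≤ a + k then (x / (n : ℝ) ^ 2) ^ k * (n + β).choose k *
        (n.choose (a + k - b) : ℝ) else 0))
    -- For `n ≥ 1`, `C(n + β, k)/n^k ≤ (1 + β)^k/k!`, and the other normalised binomial is at most
    -- `1`.
    (bound := fun k => (x * (1 + β)) ^ k / k.factorial)
    (Real.summable_pow_div_factorial _) ?_ ?_).congr ?_
  · intro k
    split_ifs with hk
    · have h1 := (tendsto_choose_div_pow β k).const_mul (x ^ k)
      have h2 := tendsto_choose_div_pow 0 ((a : ℕ) + k - b)
      have h := h1.mul h2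
      have he : x ^ k * (1 / (k.factorial : ℝ)) * (1 / (((a : ℕ) + k - b).factorial : ℝ)) =
          x ^ k / (k.factorial * ((a : ℕ) + k - b).factorial : ℝ) := by
        field_simp
      rw [he] at h
      refine h.congr' ?_
      filter_upwards [eventually_ge_atTop 1] with n hn
      rw [hterm n hn k hk, add_zero]
    · simp
  · filter_upwards [eventually_ge_atTop 1] with n hn k
    split_ifs with hk
    · rw [hterm n hn k hk, Real.norm_of_nonneg (by positivity)]
      have hn1 : (1 : ℝ) ≤ n := by exact_mod_cast hn
      have h1 : ((n + β).choose k : ℝ) / (n : ℝ) ^ k ≤ (1 + β) ^ k / k.factorial := by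
        have h := Nat.choose_le_pow_div (α := ℝ) k (n + β)
        have h2 : ((n + β : ℕ) : ℝ) ^ k ≤ ((1 + β) * (n : ℝ)) ^ k := by
          refine pow_le_pow_left₀ (by positivity) ?_ k
          push_cast
          nlinarith [(Nat.cast_nonneg β : (0 : ℝ) ≤ β)]
        rw [div_le_iff₀ (by positivity)]
        refine h.trans ?_
        rw [div_mul_eq_mul_div, ← mul_pow]
        gcongr
      have h2 : (n.choose (a + k - b) : ℝ) / (n : ℝ) ^ (a + k - b : ℕ) ≤ 1 := by
        rw [div_le_one (by positivity)]
        exact_mod_cast Nat.choose_le_pow _ _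
      calc _ ≤ x ^ k * ((1 + β) ^ k / k.factorial) * 1 := by gcongr
        _ = _ := by rw [mul_one, mul_pow, mul_div_assoc]
    · simp only [mul_zero, norm_zero]
      positivity
  · intro n
    rw [toeplitz_entry, tsum_mul_left, tsum_mul_left]

lemma det_rescale {α : ℕ} {c : ℝ} (hc : c ≠ 0) (A : Matrix (Fin α) (Fin α) ℝ) :
    (of fun a b : Fin α => (c ^ (a : ℕ))⁻¹ * (c ^ (b : ℕ) * A a b)).det = A.det := by
  have h := det_mul_column (fun a : Fin α => (c ^ (a : ℕ))⁻¹)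
    (of fun a b : Fin α => c ^ (b : ℕ) * A a b)
  simp only [of_apply] at h
  rw [h, det_mul_row, ← mul_assoc, ← Finset.prod_mul_distrib]
  rw [Finset.prod_eq_one, one_mul]
  intro a _
  exact inv_mul_cancel₀ (pow_ne_zero _ hc)

lemma tendsto_tailDet (α β : ℕ) {x : ℝ} (hx : 0 ≤ x) :
    Tendsto (fun n : ℕ => tailDet (n + β) n α (x / (n : ℝ) ^ 2)) atTop
      (𝓝 (of fun a b : Fin α => hardEdgeEntry x a b).det) := by
  have h := tendsto_pi_nhds.2 fun a => tendsto_pi_nhds.2 fun b =>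
    tendsto_rescaled_entry α β hx a b
  have hdet : Continuous fun A : Fin α → Fin α → ℝ => (of A).det :=
    Continuous.matrix_det (by fun_prop)
  have h2 := (hdet.tendsto _).comp h
  refine h2.congr' ?_
  filter_upwards [eventually_ge_atTop 1] with n hn
  exact det_rescale (by positivity) _

/-- For `a ≥ b` this is the Bessel series itself. For `a < b` the first `b - a` terms vanish, and
shifting the index gives the series of order `b - a`, in accordance with `I_{-l} = I_l`. -/
lemma pow_mul_hardEdgeEntry {r : ℝ} (hr : r ≠ 0) (a b : ℕ) :
    hardEdgeEntry (r ^ 2) a b = (r ^ a)⁻¹ * (r ^ b * besselI ((a : ℤ) - b) (2 * r)) := by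
  have hbes : ∀ l : ℕ, ∀ i : ℤ, i.natAbs = l → besselI i (2 * r) =
      r ^ l * ∑' k : ℕ, (r ^ 2) ^ k / (k.factorial * (l + k).factorial : ℝ) := by
    intro l i hl
    rw [besselI, hl]
    congr 1
    · congr 1
      ring
    · refine tsum_congr fun k => ?_
      rw [mul_pow, pow_mul, pow_mul r, mul_assoc, mul_div_mul_left _ _ (by positivity)]
  rcases le_total b a with hab | hab
  · obtain ⟨l, rfl⟩ := Nat.exists_eq_add_of_le hab
    rw [hbes l _ (by omega), hardEdgeEntry, pow_add, mul_inv]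
    rw [← mul_assoc (r ^ b), ← mul_assoc, ← mul_inv, inv_mul_cancel₀ (by positivity), one_mul]
    refine tsum_congr fun k => ?_
    rw [if_pos (by omega), show b + l + k - b = l + k by omega]
  · obtain ⟨l, rfl⟩ := Nat.exists_eq_add_of_le hab
    rw [hbes l _ (by omega), hardEdgeEntry, pow_add]
    have h1 : (r ^ a)⁻¹ * (r ^ a * r ^ l * (r ^ l *
        ∑' k : ℕ, (r ^ 2) ^ k / (k.factorial * (l + k).factorial : ℝ))) =
        (r ^ 2) ^ l * ∑' k : ℕ, (r ^ 2) ^ k / (k.factorial * (l + k).factorial : ℝ) := by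
      field_simp
      ring
    rw [h1, ← tsum_mul_left]
    have hinj : Function.Injective fun k : ℕ => k + l := add_left_injective l
    rw [← hinj.tsum_eq]
    · refine tsum_congr fun k => ?_
      rw [if_pos (by omega), show a + (k + l) - (a + l) = k by omega, add_comm k l, pow_add]
      ring
    · intro k hk
      rw [Function.mem_support] at hk
      have hle : a + l ≤ a + k := by
        by_contra hcon
        exact hk (if_neg hcon)
      exact ⟨k - l, by simp only; omega⟩

lemma det_hardEdgeEntry (α : ℕ) {x : ℝ} (hx : 0 < x) :
    (of fun a b : Fin α => hardEdgeEntry x a b).det =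
      (of fun i j : Fin α => besselI ((i : ℤ) - (j : ℤ)) (Real.sqrt (4 * x))).det := by
  have h4 : Real.sqrt (4 * x) = 2 * Real.sqrt x := by
    rw [Real.sqrt_mul (by norm_num), show (4 : ℝ) = 2 ^ 2 by norm_num,
      Real.sqrt_sq (by norm_num)]
  have hr : Real.sqrt x ≠ 0 := (Real.sqrt_pos.2 hx).ne'
  have h : ∀ a b : Fin α, hardEdgeEntry x a b = (Real.sqrt x ^ (a : ℕ))⁻¹ *
      (Real.sqrt x ^ (b : ℕ) * besselI ((a : ℤ) - (b : ℤ)) (2 * Real.sqrt x)) := by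
    intro a b
    rw [← pow_mul_hardEdgeEntry hr, Real.sq_sqrt hx.le]
  simp only [h, h4]
  exact det_rescale hr (of fun i j : Fin α => besselI ((i : ℤ) - (j : ℤ)) (2 * Real.sqrt x))

lemma besselI_zero_right (l : ℤ) : besselI l 0 = if l = 0 then 1 else 0 := by
  split_ifs with h
  · subst h
    rw [besselI, tsum_eq_single 0 (by intro k hk; simp [hk])]
    simp
  · rw [besselI, zero_div, zero_pow (Int.natAbs_ne_zero.2 h), zero_mul]

lemma limitCDF_zero (α : ℕ) : limitCDF α 0 = 0 := by
  have h : (of fun i j : Fin α => besselI ((i : ℤ) - (j : ℤ)) (Real.sqrt (4 * 0))) = 1 := by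
    ext i j
    rw [of_apply, mul_zero, Real.sqrt_zero, besselI_zero_right, one_apply]
    congr 1
    rw [eq_iff_iff, sub_eq_zero, Nat.cast_inj, Fin.val_inj]
  rw [limitCDF, h, det_one, neg_zero, Real.exp_zero, mul_one, sub_self]

lemma tendsto_one_sub_pow (β : ℕ) (x : ℝ) :
    Tendsto (fun n : ℕ => (1 - x / (n : ℝ) ^ 2) ^ (n * (n + β))) atTop (𝓝 (Real.exp (-x))) := by
  have h1 : Tendsto (fun n : ℕ => (1 + -x / ((n ^ 2 : ℕ) : ℝ)) ^ (n ^ 2)) atTop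
      (𝓝 (Real.exp (-x))) :=
    (Real.tendsto_one_add_div_pow_exp (-x)).comp (tendsto_pow_atTop two_ne_zero)
  have h2 : Tendsto (fun n : ℕ => (1 + -x / (n : ℝ) ^ 2) ^ n) atTop (𝓝 (Real.exp 0)) := by
    refine Real.tendsto_one_add_pow_exp_of_tendsto ?_
    have h3 := (tendsto_const_div_atTop_nhds_zero_nat (-x))
    refine h3.congr' ?_
    filter_upwards [eventually_ge_atTop 1] with n hn
    have hn0 : (n : ℝ) ≠ 0 := by positivity
    field_simp
  have h := h1.mul (h2.pow β)
  rw [Real.exp_zero, one_pow, mul_one] at h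
  refine h.congr fun n => ?_
  rw [← pow_mul, Nat.cast_pow, ← pow_add, neg_div, ← sub_eq_add_neg]
  congr 1
  ring

theorem tendsto_tailProb (α β : ℕ) {x : ℝ} (hx : 0 ≤ x) :
    Tendsto (fun n : ℕ => tailProb (n + β) n α (x / (n : ℝ) ^ 2)) atTop
      (𝓝 (1 - limitCDF α x)) := by
  -- At `x = 0` the conjugation by powers of `√x` degenerates; there both sides are evaluated
  -- directly.
  rcases hx.eq_or_lt with rfl | hx
  · simp only [zero_div, tailProb_zero, limitCDF_zero, sub_zero]
    exact tendsto_const_nhds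
  have h := (tendsto_one_sub_pow β x).mul (tendsto_tailDet α β hx.le)
  rw [det_hardEdgeEntry α hx] at h
  rw [limitCDF, sub_sub_cancel]
  exact h

end HardEdge

/-! ### Distribution functions -/

section DistFun

variable {Ω : Type*} [MeasurableSpace Ω] {μ : Measure Ω} [IsProbabilityMeasure μ]

lemma distFun_eq {Y : Ω → ℝ} (hY : AEMeasurable Y μ) (x : ℝ) :
    distFun μ Y x = μ.real {ω | Y ω ≤ x} := by
  have := Measure.isProbabilityMeasure_map hY
  rw [distFun, cdf_eq_real, measureReal_def, measureReal_def,
    Measure.map_apply_of_aemeasurable hY measurableSet_Iic]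
  rfl

lemma real_le_eq_one_sub {Y : Ω → ℝ} (hY : AEMeasurable Y μ) (x : ℝ) :
    μ.real {ω | Y ω ≤ x} = 1 - μ.real {ω | x < Y ω} := by
  have hm : NullMeasurableSet {ω | x < Y ω} μ := hY.nullMeasurableSet_preimage measurableSet_Ioi
  rw [← probReal_compl_eq_one_sub₀ hm]
  congr 1
  ext ω
  simp

lemma real_ge_eq_one_sub {Y : Ω → ℝ} (hY : AEMeasurable Y μ) (x : ℝ) :
    μ.real {ω | x ≤ Y ω} = 1 - μ.real {ω | Y ω < x} := by
  have hm : NullMeasurableSet {ω | Y ω < x} μ := hY.nullMeasurableSet_preimage measurableSet_Iio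
  rw [← probReal_compl_eq_one_sub₀ hm]
  congr 1
  ext ω
  simp

/-- For `s < t` the event `Y ≤ 1 - t` lies in `Y < 1 - s`; letting `s` increase to `t`, continuity
of `Q` gives the bound. At `t = 0` it is the trivial bound `1`. -/
lemma real_le_of_forall_real_lt {Y : Ω → ℝ} {Q : ℝ → ℝ} (hQ : Continuous Q) (hQ0 : Q 0 = 1)
    (h : ∀ t, 0 ≤ t → t < 1 → μ.real {ω | Y ω < 1 - t} = Q t) {t : ℝ} (ht : 0 ≤ t) (ht1 : t < 1) :
    μ.real {ω | Y ω ≤ 1 - t} = Q t := by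
  refine le_antisymm ?_ ?_
  · rcases ht.eq_or_lt with rfl | htpos
    · rw [hQ0]
      exact measureReal_le_one
    · have hlim : Tendsto Q (𝓝[<] t) (𝓝 (Q t)) := (hQ.tendsto t).mono_left nhdsWithin_le_nhds
      refine ge_of_tendsto hlim ?_
      filter_upwards [Ioo_mem_nhdsLT htpos] with s hs
      rw [← h s hs.1.le (hs.2.trans ht1)]
      refine measureReal_mono fun ω hω => ?_
      have h1 : Y ω ≤ 1 - t := hω
      have h2 : Y ω < 1 - s := by linarith [hs.2]
      exact h2
  · rw [← h t ht ht1]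
    exact measureReal_mono fun ω (hω : Y ω < 1 - t) => show Y ω ≤ 1 - t from hω.le

end DistFun

end DoubleWishart

end

/-! ### The limit laws of the extreme eigenvalues. -/

theorem theorem2 (α₁ α₂ : ℕ)
    (Ω : ℕ → Type*) [∀ n, MeasurableSpace (Ω n)]
    (μ : ∀ n, Measure (Ω n)) [∀ n, IsProbabilityMeasure (μ n)]
    (S : ∀ n, Matrix (Fin n) (Fin n) ℂ) (hS : ∀ n, (S n).PosDef)
    (X₁ : ∀ n, Ω n → Matrix (Fin (n + α₁)) (Fin n) ℂ)
    (X₂ : ∀ n, Ω n → Matrix (Fin (n + α₂)) (Fin n) ℂ)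
    (hX₁ : ∀ n, DoubleWishart.IsComplexGaussianMatrix (X₁ n) (S n) (μ n))
    (hX₂ : ∀ n, DoubleWishart.IsComplexGaussianMatrix (X₂ n) (S n) (μ n))
    (hX : ∀ n, IndepFun (fun ω i j => X₁ n ω i j) (fun ω i j => X₂ n ω i j) (μ n))
    (φmin φmax : ∀ n, Ω n → ℝ)
    (hmin : ∀ n ω, φmin n ω =
      DoubleWishart.smallestEigenvalue (DoubleWishart.doubleWishart (X₁ n ω) (X₂ n ω)))
    (hmax : ∀ n ω, φmax n ω =
      DoubleWishart.largestEigenvalue (DoubleWishart.doubleWishart (X₁ n ω) (X₂ n ω)))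
    (x : ℝ) (hx : 0 ≤ x) :
    Tendsto (fun n : ℕ => DoubleWishart.distFun (μ n) (fun ω => (n : ℝ) ^ 2 * φmin n ω) x)
        atTop (𝓝 (DoubleWishart.limitCDF α₁ x)) ∧
      Tendsto (fun n : ℕ => DoubleWishart.distFun (μ n) (φmin n) (x / (n : ℝ) ^ 2))
        atTop (𝓝 (DoubleWishart.limitCDF α₁ x)) ∧
      Tendsto (fun n : ℕ => DoubleWishart.distFun (μ n) (fun ω => (n : ℝ) ^ 2 * (1 - φmax n ω)) x)
        atTop (𝓝 (DoubleWishart.limitCDF α₂ x)) ∧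
      Tendsto (fun n : ℕ => DoubleWishart.distFun (μ n) (φmax n) (1 - x / (n : ℝ) ^ 2))
        atTop (𝓝 (1 - DoubleWishart.limitCDF α₂ x)) := by
  have hev : ∀ᶠ n : ℕ in atTop, n ≠ 0 ∧ x / (n : ℝ) ^ 2 < 1 := by
    have h0 : Tendsto (fun n : ℕ => x / (n : ℝ) ^ 2) atTop (𝓝 0) :=
      tendsto_const_nhds.div_atTop
        ((tendsto_pow_atTop two_ne_zero).comp tendsto_natCast_atTop_atTop)
    filter_upwards [eventually_ne_atTop 0, h0.eventually_lt_const zero_lt_one] with n h1 h2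
    exact ⟨h1, h2⟩
  have hmeas : ∀ n, n ≠ 0 → AEMeasurable (φmin n) (μ n) ∧ AEMeasurable (φmax n) (μ n) := by
    intro n hn
    rw [funext (hmin n), funext (hmax n)]
    exact ⟨DoubleWishart.aemeasurable_smallestEigenvalue hn (hS n) (hX₁ n) (hX₂ n) (hX n),
      DoubleWishart.aemeasurable_largestEigenvalue hn (hS n) (hX₁ n) (hX₂ n) (hX n)⟩
  -- The excess `α₂` enters only through the number `n + α₂` of rows of the other matrix, and so has
  -- no effect in the limit; in `hPmax` the roles are exchanged.
  have hPmin : ∀ n, n ≠ 0 → ∀ t, 0 ≤ t → t < 1 → (μ n).real {ω | t < φmin n ω} =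
      DoubleWishart.tailProb (n + α₂) n α₁ t := by
    intro n hn t ht ht1
    simp only [hmin]
    rw [measureReal_def, DoubleWishart.measure_lt_smallestEigenvalue hn (hS n) (hX₁ n) (hX₂ n)
      (hX n) ht ht1, ENNReal.toReal_ofReal (DoubleWishart.tailProb_nonneg _ _ _ ht ht1)]
  have hPmax : ∀ n, n ≠ 0 → ∀ t, 0 ≤ t → t < 1 → (μ n).real {ω | φmax n ω < 1 - t} =
      DoubleWishart.tailProb (n + α₁) n α₂ t := by
    intro n hn t ht ht1
    simp only [hmax]
    rw [measureReal_def, DoubleWishart.measure_largestEigenvalue_lt hn (hS n) (hX₁ n) (hX₂ n)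
      (hX n) ht ht1, ENNReal.toReal_ofReal (DoubleWishart.tailProb_nonneg _ _ _ ht ht1)]
  have hlim₁ : Tendsto (fun n : ℕ => 1 - DoubleWishart.tailProb (n + α₂) n α₁ (x / (n : ℝ) ^ 2))
      atTop (𝓝 (DoubleWishart.limitCDF α₁ x)) := by
    simpa using (DoubleWishart.tendsto_tailProb α₁ α₂ hx).const_sub 1
  have hlim₂ := DoubleWishart.tendsto_tailProb α₂ α₁ hx
  have hlim₂' : Tendsto (fun n : ℕ => 1 - DoubleWishart.tailProb (n + α₁) n α₂ (x / (n : ℝ) ^ 2))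
      atTop (𝓝 (DoubleWishart.limitCDF α₂ x)) := by
    simpa using hlim₂.const_sub 1
  refine ⟨hlim₁.congr' ?_, hlim₁.congr' ?_, hlim₂'.congr' ?_, hlim₂.congr' ?_⟩
  · filter_upwards [hev] with n hn
    have hn2 : (0 : ℝ) < (n : ℝ) ^ 2 := by have := hn.1; positivity
    rw [DoubleWishart.distFun_eq ((hmeas n hn.1).1.const_mul _),
      ← hPmin n hn.1 _ (by positivity) hn.2, ← DoubleWishart.real_le_eq_one_sub (hmeas n hn.1).1]
    simp only [le_div_iff₀' hn2]
  · filter_upwards [hev] with n hn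
    rw [DoubleWishart.distFun_eq (hmeas n hn.1).1, ← hPmin n hn.1 _ (by positivity) hn.2,
      ← DoubleWishart.real_le_eq_one_sub (hmeas n hn.1).1]
  · filter_upwards [hev] with n hn
    have hn2 : (0 : ℝ) < (n : ℝ) ^ 2 := by have := hn.1; positivity
    rw [DoubleWishart.distFun_eq (((hmeas n hn.1).2.const_sub 1).const_mul _),
      ← hPmax n hn.1 _ (by positivity) hn.2, ← DoubleWishart.real_ge_eq_one_sub (hmeas n hn.1).2]
    -- The event `n²(1 - φmax) ≤ x` is `1 - x/n² ≤ φmax`, the complement of a strict event, so no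
    -- continuity is needed here.
    simp only [← le_div_iff₀' hn2, sub_le_comm]
  · filter_upwards [hev] with n hn
    rw [DoubleWishart.distFun_eq (hmeas n hn.1).2]
    exact (DoubleWishart.real_le_of_forall_real_lt (DoubleWishart.continuous_tailProb _ _ _)
      (DoubleWishart.tailProb_zero _ _ _) (hPmax n hn.1) (by positivity) hn.2).symm
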